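/- All manifolds are Hausdorff smooth manifolds modelled on Hausdorff locally convex real vector spaces, smoothness being understood in the sense of Michal–Bastiani; Lie groups are locally convex Lie groups; $\mathbb{T}$ is the circle group. Let a Lie group $G$ act smoothly on connected manifolds $M$ and $N$, and let $\psi\colon N\to M$ be a smooth $G$-equivariant map. For a smooth principal $\mathbb{T}$-bundle $\pi\colon P\to M$ with principal connection form $\theta$, the holonomy is a homomorphism $h_{(P,\theta)}\colon Z_1(M)\to\mathbb{T}$ on smooth singular $1$-cycles; it is called $G$-invariant if $h_{(P,\theta)}(g\circ c)=h_{(P,\theta)}(c)$ for all $g\in G$, $c\in Z_1(M)$. In this case let $\hat G_{(P,\theta)}$ be the group of pairs $(g,\phi)$, where $g\in G$ and $\phi\in\mathrm{Aut}(P,\theta)$ is a connection-preserving bundle automorphism covering the action of $g$ on $M$. With the homomorphisms $\mathbb{T}\to\hat G_{(P,\theta)}$, $z\mapsto(1,z\,\cdot)$, and $\hat G_{(P,\theta)}\to G$, $(g,\phi)\mapsto g$, it is a central Lie group extension of $G$ by $\mathbb{T}$; for every $p\in P$, the map $(g,\phi)\mapsto(g,\phi(p))$ is a bijection onto the pull-back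 of $P$ along the orbit map $g\mapsto g\cdot\pi(p)$, and the manifold structure of $\hat G_{(P,\theta)}$ is the one for which it is a diffeomorphism. (a) Let $(P,\theta)$ be a principal $\mathbb{T}$-bundle with connection over $M$ whose holonomy is $G$-invariant. Then $(\psi^*P,\psi^*\theta)$ is a principal $\mathbb{T}$-bundle with connection over $N$. For every $(g,\phi)\in\hat G_{(P,\theta)}$, the map $$\overline\phi\colon\psi^*P\to\psi^*P,\qquad (n,p)\mapsto(g\cdot n,\phi(p)),$$ is a bundle automorphism preserving $\psi^*\theta$ and covering the action of $g$ on $N$, and $(g,\phi)\mapsto(g,\overline\phi)$ is a group isomorphism $\hat G_{(P,\theta)}\to\hat G_{(\psi^*P,\psi^*\theta)}$ which is compatible with the inclusions of $\mathbb{T}$ and the projections to $G$ and which is smooth with smooth inverse, i.e. a smooth isomorphism of central Lie group extensions. (b) Let $h_M\colon Z_1(M)\to\mathbb{T}$ and $h_N\colon Z_1(N)\to\mathbb{T}$ be $G$-invariant differential characters of degree one with $\psi^*h_M=h_N$, that is, $h_N(c)=h_M(\psi\circ c)$ for all $c\in Z_1(N)$. Then, for all principal $\mathbb{T}$-bundles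 with connection $(P,\theta)$ over $M$ and $(Q,\eta)$ over $N$ with holonomies $h_{(P,\theta)}=h_M$ and $h_{(Q,\eta)}=h_N$, the central Lie group extensions $\hat G_{(P,\theta)}$ and $\hat G_{(Q,\eta)}$ of $G$ are smoothly isomorphic. -/

import Mathlib

open Set Filter Topology Bundle MeasureTheory

universe u v w

noncomputable section

namespace LC

/-! ## Differential calculus in locally convex spaces -/

section Calculus

/-- `w` is the directional derivative of `f` at `x` in the direction `v`. -/
def HasDirDeriv {E : Type u} [AddCommGroup E] [Module ℝ E]
    {F : Type v} [AddCommGroup F] [Module ℝ F] [TopologicalSpace F]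
    (f : E → F) (x v : E) (w : F) : Prop :=
  Tendsto (fun t : ℝ => t⁻¹ • (f (x + t • v) - f x)) (𝓝[≠] 0) (𝓝 w)

/-- The directional derivative `df(x, v)` (meaningful where it exists). -/
def dirDeriv {E : Type u} [AddCommGroup E] [Module ℝ E]
    {F : Type v} [AddCommGroup F] [Module ℝ F] [TopologicalSpace F]
    (f : E → F) (x v : E) : F :=
  limUnder (𝓝[≠] (0 : ℝ)) (fun t : ℝ => t⁻¹ • (f (x + t • v) - f x))

/-- `f` is a `C^n` map (in the sense of Michal and Bastiani) on the open set `U`: it is continuous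
and, if `n ≥ 1`, its directional derivatives exist at all points of `U` and
`df : U × E → F` is `C^(n-1)`. -/
def IsCk : ℕ → ∀ {E : Type u} [AddCommGroup E] [Module ℝ E] [TopologicalSpace E]
    {F : Type v} [AddCommGroup F] [Module ℝ F] [TopologicalSpace F], (E → F) → Set E → Prop
  | 0, _, _, _, _, _, _, _, _, f, U => ContinuousOn f U
  | n + 1, _, _, _, _, _, _, _, _, f, U =>
      ContinuousOn f U ∧ (∀ x ∈ U, ∀ v, HasDirDeriv f x v (dirDeriv f x v)) ∧
        IsCk n (fun p => dirDeriv f p.1 p.2) (U ×ˢ univ)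

/-- Smooth maps on an open subset of a locally convex space. -/
def IsSmoothOn {E : Type u} [AddCommGroup E] [Module ℝ E] [TopologicalSpace E]
    {F : Type v} [AddCommGroup F] [Module ℝ F] [TopologicalSpace F]
    (f : E → F) (U : Set E) : Prop := ∀ n, IsCk n f U

theorem HasDirDeriv.dirDeriv_eq {E : Type u} [AddCommGroup E] [Module ℝ E]
    {F : Type v} [AddCommGroup F] [Module ℝ F] [TopologicalSpace F] [T2Space F]
    {f : E → F} {x v : E} {w : F} (h : HasDirDeriv f x v w) : dirDeriv f x v = w :=
  Tendsto.limUnder_eq h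

theorem tendsto_line {E : Type u} [AddCommGroup E] [Module ℝ E] [TopologicalSpace E]
    [IsTopologicalAddGroup E] [ContinuousSMul ℝ E] (x v : E) :
    Tendsto (fun t : ℝ => x + t • v) (𝓝[≠] 0) (𝓝 x) := by
  have : Continuous fun t : ℝ => x + t • v := by fun_prop
  exact (this.tendsto' 0 x (by simp)).mono_left nhdsWithin_le_nhds

theorem quot_congr {E : Type u} [AddCommGroup E] [Module ℝ E] [TopologicalSpace E]
    [IsTopologicalAddGroup E] [ContinuousSMul ℝ E]
    {F : Type v} [AddCommGroup F] [Module ℝ F] {f g : E → F} {x : E}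
    (h : f =ᶠ[𝓝 x] g) (v : E) :
    (fun t : ℝ => t⁻¹ • (f (x + t • v) - f x)) =ᶠ[𝓝[≠] 0]
      (fun t : ℝ => t⁻¹ • (g (x + t • v) - g x)) := by
  filter_upwards [(tendsto_line x v).eventually h] with t ht
  rw [ht, h.self_of_nhds]

theorem HasDirDeriv.congr {E : Type u} [AddCommGroup E] [Module ℝ E] [TopologicalSpace E]
    [IsTopologicalAddGroup E] [ContinuousSMul ℝ E]
    {F : Type v} [AddCommGroup F] [Module ℝ F] [TopologicalSpace F] {f g : E → F} {x v : E} {w : F}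
    (hf : HasDirDeriv f x v w) (h : f =ᶠ[𝓝 x] g) : HasDirDeriv g x v w :=
  Tendsto.congr' (quot_congr h v) hf

theorem dirDeriv_congr {E : Type u} [AddCommGroup E] [Module ℝ E] [TopologicalSpace E]
    [IsTopologicalAddGroup E] [ContinuousSMul ℝ E]
    {F : Type v} [AddCommGroup F] [Module ℝ F] [TopologicalSpace F] {f g : E → F} {x : E}
    (h : f =ᶠ[𝓝 x] g) (v : E) : dirDeriv f x v = dirDeriv g x v := by
  unfold dirDeriv limUnder
  rw [Filter.map_congr (quot_congr h v)]

theorem IsCk.continuousOn : ∀ {n : ℕ} {E : Type u} [AddCommGroup E] [Module ℝ E]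
    [TopologicalSpace E] {F : Type v} [AddCommGroup F] [Module ℝ F] [TopologicalSpace F]
    {f : E → F} {U : Set E}, IsCk n f U → ContinuousOn f U
  | 0, _, _, _, _, _, _, _, _, _, _, h => h
  | _ + 1, _, _, _, _, _, _, _, _, _, _, h => h.1

theorem IsCk.mono : ∀ {n : ℕ} {E : Type u} [AddCommGroup E] [Module ℝ E]
    [TopologicalSpace E] {F : Type v} [AddCommGroup F] [Module ℝ F] [TopologicalSpace F]
    {f : E → F} {U V : Set E}, IsCk n f U → V ⊆ U → IsCk n f V
  | 0, _, _, _, _, _, _, _, _, _, _, _, h, hV => ContinuousOn.mono h hV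
  | _ + 1, _, _, _, _, _, _, _, _, _, _, _, h, hV =>
      ⟨h.1.mono hV, fun x hx v => h.2.1 x (hV hx) v, h.2.2.mono (prod_mono hV subset_rfl)⟩

theorem IsCk.of_succ : ∀ {n : ℕ} {E : Type u} [AddCommGroup E] [Module ℝ E]
    [TopologicalSpace E] {F : Type v} [AddCommGroup F] [Module ℝ F] [TopologicalSpace F]
    {f : E → F} {U : Set E}, IsCk (n + 1) f U → IsCk n f U
  | 0, _, _, _, _, _, _, _, _, _, _, h => h.1
  | _ + 1, _, _, _, _, _, _, _, _, _, _, h => ⟨h.1, h.2.1, h.2.2.of_succ⟩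

theorem IsCk.congr : ∀ {n : ℕ} {E : Type u} [AddCommGroup E] [Module ℝ E]
    [TopologicalSpace E] [IsTopologicalAddGroup E] [ContinuousSMul ℝ E]
    {F : Type v} [AddCommGroup F] [Module ℝ F] [TopologicalSpace F]
    {f g : E → F} {U : Set E}, IsCk n f U → IsOpen U → EqOn f g U → IsCk n g U
  | 0, _, _, _, _, _, _, _, _, _, _, _, _, _, h, _, hfg => ContinuousOn.congr h hfg.symm
  | _ + 1, _, _, _, _, _, _, _, _, _, _, _, _, _, h, hU, hfg => by
      have key : ∀ x ∈ _, _ =ᶠ[𝓝 x] _ := fun x hx => hfg.eventuallyEq_of_mem (hU.mem_nhds hx)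
      refine ⟨h.1.congr hfg.symm, fun x hx v => ?_, h.2.2.congr (hU.prod isOpen_univ) ?_⟩
      · rw [← dirDeriv_congr (key x hx)]
        exact (h.2.1 x hx v).congr (key x hx)
      · exact fun p hp => dirDeriv_congr (key p.1 hp.1) p.2

theorem isCk_affine : ∀ (n : ℕ) {E : Type u} [AddCommGroup E] [Module ℝ E]
    [TopologicalSpace E] [IsTopologicalAddGroup E] [ContinuousSMul ℝ E]
    {F : Type v} [AddCommGroup F] [Module ℝ F] [TopologicalSpace F] [IsTopologicalAddGroup F]
    [ContinuousSMul ℝ F] [T2Space F] (c : F) (L : E →L[ℝ] F) (U : Set E),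
    IsCk n (fun x => c + L x) U
  | 0, _, _, _, _, _, _, _, _, _, _, _, _, _, c, L, _ =>
      (continuous_const.add L.continuous).continuousOn
  | n + 1, E, _, _, _, _, _, F, _, _, _, _, _, _, c, L, U => by
      have key : ∀ x v, HasDirDeriv (fun x => c + L x) x v (L v) := by
        intro x v
        refine tendsto_const_nhds.congr' ?_
        filter_upwards [self_mem_nhdsWithin] with t ht
        have ht' : t ≠ 0 := ht
        simp [inv_smul_smul₀ ht']
      refine ⟨(continuous_const.add L.continuous).continuousOn, fun x _ v => ?_, ?_⟩
      · rw [(key x v).dirDeriv_eq]; exact key x v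
      · have := isCk_affine n 0 (L.comp (ContinuousLinearMap.snd ℝ E E)) (U ×ˢ univ)
        convert this using 2 with p
        rw [(key _ _).dirDeriv_eq]; simp

theorem IsCk.prodMk : ∀ {n : ℕ} {E : Type u} [AddCommGroup E] [Module ℝ E]
    [TopologicalSpace E] [IsTopologicalAddGroup E] [ContinuousSMul ℝ E]
    {F : Type v} [AddCommGroup F] [Module ℝ F] [TopologicalSpace F] [T2Space F]
    {F' : Type w} [AddCommGroup F'] [Module ℝ F'] [TopologicalSpace F'] [T2Space F']
    {f : E → F} {g : E → F'} {U : Set E}, IsOpen U → IsCk n f U → IsCk n g U →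
      IsCk n (fun x => (f x, g x)) U
  | 0, _, _, _, _, _, _, _, _, _, _, _, _, _, _, _, _, _, _, _, _, hf, hg =>
      ContinuousOn.prodMk hf hg
  | _ + 1, _, _, _, _, _, _, _, _, _, _, _, _, _, _, _, _, f, g, U, hU, hf, hg => by
      have key : ∀ x ∈ U, ∀ v, HasDirDeriv (fun x => (f x, g x)) x v
          (dirDeriv f x v, dirDeriv g x v) := fun x hx v =>
        (hf.2.1 x hx v).prodMk_nhds (hg.2.1 x hx v)
      refine ⟨hf.1.prodMk hg.1, fun x hx v => ?_, ?_⟩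
      · rw [(key x hx v).dirDeriv_eq]; exact key x hx v
      · exact (IsCk.prodMk (hU.prod isOpen_univ) hf.2.2 hg.2.2).congr (hU.prod isOpen_univ)
          fun p hp => ((key p.1 hp.1 p.2).dirDeriv_eq).symm

theorem IsCk.comp_linear : ∀ {n : ℕ} {E' : Type w} [AddCommGroup E'] [Module ℝ E']
    [TopologicalSpace E'] [IsTopologicalAddGroup E'] [ContinuousSMul ℝ E']
    {E : Type u} [AddCommGroup E] [Module ℝ E] [TopologicalSpace E]
    {F : Type v} [AddCommGroup F] [Module ℝ F] [TopologicalSpace F] [T2Space F]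
    {f : E → F} {U : Set E}, IsCk n f U → ∀ (L : E' →L[ℝ] E), IsOpen U →
      IsCk n (fun x => f (L x)) (L ⁻¹' U)
  | 0, _, _, _, _, _, _, _, _, _, _, _, _, _, _, _, _, _, hf, L, _ =>
      ContinuousOn.comp hf L.continuous.continuousOn fun _ hx => hx
  | _ + 1, E', _, _, _, _, _, _, _, _, _, _, _, _, _, _, f, U, hf, L, hU => by
      have key : ∀ x ∈ L ⁻¹' U, ∀ v, HasDirDeriv (fun x => f (L x)) x v
          (dirDeriv f (L x) (L v)) := by
        intro x hx v
        have := hf.2.1 (L x) hx (L v)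
        simpa only [HasDirDeriv, map_add, map_smul] using this
      refine ⟨ContinuousOn.comp hf.1 L.continuous.continuousOn fun _ hx => hx,
        fun x hx v => ?_, ?_⟩
      · rw [(key x hx v).dirDeriv_eq]; exact key x hx v
      · have hopen := (hU.preimage L.continuous).prod (isOpen_univ (X := E'))
        refine ((IsCk.comp_linear hf.2.2 (L.prodMap L) (hU.prod isOpen_univ)).mono
          fun p hp => ⟨hp.1, mem_univ _⟩).congr hopen ?_
        exact fun p hp => ((key p.1 hp.1 p.2).dirDeriv_eq).symm

/-- A mean value theorem: the increment of `g` along a short segment lies in any closed convex set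
that contains the directional derivatives along this segment. -/
theorem mean_value {E : Type u} [AddCommGroup E] [Module ℝ E]
    {F : Type v} [AddCommGroup F] [Module ℝ F] [TopologicalSpace F] [IsTopologicalAddGroup F]
    [ContinuousSMul ℝ F] [LocallyConvexSpace ℝ F] {g : E → F} {dg : E → F} {y w : E} {t : ℝ}
    (ht : t ≠ 0) (hd : ∀ s ∈ Icc (0 : ℝ) 1, HasDirDeriv g (y + s • t • w) w (dg (y + s • t • w)))
    {C : Set F} (hC : Convex ℝ C) (hC' : IsClosed C)
    (hmem : ∀ s ∈ Icc (0 : ℝ) 1, dg (y + s • t • w) ∈ C) :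
    t⁻¹ • (g (y + t • w) - g y) ∈ C := by
  by_contra hq
  obtain ⟨l, c, hlt, hgt⟩ := geometric_hahn_banach_closed_point hC hC' hq
  have hder : ∀ s ∈ Icc (0 : ℝ) 1, HasDerivAt (fun s : ℝ => l (g (y + s • t • w)))
      (t * l (dg (y + s • t • w))) s := by
    intro s hs
    rw [hasDerivAt_iff_tendsto_slope_zero]
    have h1 : Tendsto (fun h : ℝ => h * t) (𝓝[≠] 0) (𝓝[≠] 0) := by
      refine tendsto_nhdsWithin_iff.2 ⟨?_, ?_⟩
      · have : Continuous fun h : ℝ => h * t := by fun_prop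
        exact (this.tendsto' 0 0 (by simp)).mono_left nhdsWithin_le_nhds
      · filter_upwards [self_mem_nhdsWithin] with h hh
        exact mul_ne_zero hh ht
    have h2 := ((l.continuous.tendsto _).comp ((hd s hs).comp h1)).const_mul t
    refine h2.congr' ?_
    filter_upwards [self_mem_nhdsWithin] with h hh
    have hh' : h ≠ 0 := hh
    have e : y + s • t • w + (h * t) • w = y + (s + h) • t • w := by module
    simp only [Function.comp_apply, map_smul, map_sub, smul_eq_mul, e]
    field_simp
  obtain ⟨s, hs, hs'⟩ := exists_hasDerivAt_eq_slope (fun s : ℝ => l (g (y + s • t • w)))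
    (fun s => t * l (dg (y + s • t • w))) zero_lt_one
    (fun s hs => (hder s hs).continuousAt.continuousWithinAt)
    (fun s hs => hder s (Ioo_subset_Icc_self hs))
  have h3 := hlt _ (hmem s (Ioo_subset_Icc_self hs))
  have h4 : l (t⁻¹ • (g (y + t • w) - g y)) = l (dg (y + s • t • w)) := by
    simp only [one_smul, zero_smul, add_zero, sub_zero, div_one] at hs'
    rw [map_smul, map_sub, ← hs', smul_eq_mul, inv_mul_cancel_left₀ ht]
  linarith

/-- The chain rule for directional derivatives. -/
theorem HasDirDeriv.comp {E : Type u} [AddCommGroup E] [Module ℝ E] [TopologicalSpace E]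
    [IsTopologicalAddGroup E] [ContinuousSMul ℝ E]
    {F : Type v} [AddCommGroup F] [Module ℝ F] [TopologicalSpace F] [IsTopologicalAddGroup F]
    [ContinuousSMul ℝ F]
    {H : Type w} [AddCommGroup H] [Module ℝ H] [TopologicalSpace H] [IsTopologicalAddGroup H]
    [ContinuousSMul ℝ H] [LocallyConvexSpace ℝ H]
    {g : F → H} {f : E → F} {V : Set F} {x v : E} {w : F} {dg : F × F → H}
    (hf : HasDirDeriv f x v w) (hfc : ContinuousAt f x) (hV : V ∈ 𝓝 (f x))
    (hg : ∀ y ∈ V, ∀ z, HasDirDeriv g y z (dg (y, z))) (hdg : ContinuousAt dg (f x, w)) :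
    HasDirDeriv (g ∘ f) x v (dg (f x, w)) := by
  intro N hN
  obtain ⟨K, ⟨hK, hKc⟩, hKN⟩ := (closed_nhds_basis (dg (f x, w))).mem_iff.1 hN
  obtain ⟨S, ⟨hS, hSc⟩, hSK⟩ :=
    (LocallyConvexSpace.convex_basis (𝕜 := ℝ) (dg (f x, w))).mem_iff.1 hK
  have hSN : closure S ⊆ N := (closure_minimal hSK hKc).trans hKN
  have h1 : ∀ᶠ p : F × F in 𝓝 (f x, w), dg p ∈ closure S :=
    hdg.eventually (mem_of_superset hS subset_closure)
  rw [nhds_prod_eq] at h1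
  obtain ⟨A, hA, B, hB, hAB⟩ := eventually_prod_iff.1 h1
  have h2 : {k : F | f x + k ∈ V ∧ A (f x + k)} ∈ 𝓝 (0 : F) := by
    have : Continuous fun k : F => f x + k := by fun_prop
    have hev : ∀ᶠ y in 𝓝 (f x), y ∈ V ∧ A y := Filter.Eventually.and hV hA
    exact (this.tendsto' 0 (f x) (by simp)).eventually hev
  have h3 := balancedCore_mem_nhds_zero (𝕜 := ℝ) h2
  have h4 : Tendsto (fun t : ℝ => f (x + t • v) - f x) (𝓝[≠] 0) (𝓝 0) := by
    have := (hfc.tendsto.comp (tendsto_line x v)).sub_const (f x)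
    simpa using this
  have h5 : ∀ᶠ t : ℝ in 𝓝[≠] 0, t ≠ 0 := self_mem_nhdsWithin
  show ∀ᶠ t : ℝ in 𝓝[≠] 0, t⁻¹ • ((g ∘ f) (x + t • v) - (g ∘ f) x) ∈ N
  filter_upwards [h4 h3, hf hB, h5] with t ht1 ht2 ht
  have ht' : t ≠ 0 := ht
  set q := t⁻¹ • (f (x + t • v) - f x) with hqdef
  have hk : t • q = f (x + t • v) - f x := smul_inv_smul₀ ht' _
  have hk' : f x + t • q = f (x + t • v) := by rw [hk]; abel
  have hsmall : ∀ s ∈ Icc (0 : ℝ) 1, f x + s • t • q ∈ V ∧ A (f x + s • t • q) := by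
    intro s hs
    have : s • t • q ∈ balancedCore ℝ {k : F | f x + k ∈ V ∧ A (f x + k)} := by
      refine balancedCore_balanced _ s ?_ (smul_mem_smul_set ?_)
      · rw [Real.norm_eq_abs, abs_le]; exact ⟨by linarith [hs.1], hs.2⟩
      · rw [hk]; exact ht1
    have h6 := balancedCore_subset {k : F | f x + k ∈ V ∧ A (f x + k)} this
    exact h6
  apply hSN
  show t⁻¹ • (g (f (x + t • v)) - g (f x)) ∈ closure S
  rw [← hk']
  exact mean_value (dg := fun z => dg (z, q)) ht' (fun s hs => hg _ (hsmall s hs).1 q)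
    hSc.closure isClosed_closure (fun s hs => hAB (hsmall s hs).2 ht2)

theorem IsCk.comp : ∀ {n : ℕ} {E : Type u} [AddCommGroup E] [Module ℝ E]
    [TopologicalSpace E] [IsTopologicalAddGroup E] [ContinuousSMul ℝ E] [T2Space E]
    {F : Type v} [AddCommGroup F] [Module ℝ F] [TopologicalSpace F] [IsTopologicalAddGroup F]
    [ContinuousSMul ℝ F] [T2Space F]
    {H : Type w} [AddCommGroup H] [Module ℝ H] [TopologicalSpace H] [IsTopologicalAddGroup H]
    [ContinuousSMul ℝ H] [LocallyConvexSpace ℝ H] [T2Space H]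
    {g : F → H} {f : E → F} {U : Set E} {V : Set F}, IsCk n g V → IsCk n f U → IsOpen U →
      IsOpen V → MapsTo f U V → IsCk n (g ∘ f) U := by
  intro n
  induction n with
  | zero => exact fun hg hf _ _ hUV => ContinuousOn.comp hg hf hUV
  | succ n ih =>
    intro E _ _ _ _ _ _ F _ _ _ _ _ _ H _ _ _ _ _ _ _ g f U V hg hf hU hV hUV
    have key : ∀ x ∈ U, ∀ v, HasDirDeriv (g ∘ f) x v (dirDeriv g (f x) (dirDeriv f x v)) := by
      intro x hx v
      refine HasDirDeriv.comp (dg := fun p => dirDeriv g p.1 p.2) (hf.2.1 x hx v)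
        (hf.1.continuousAt (hU.mem_nhds hx)) (hV.mem_nhds (hUV hx)) hg.2.1 ?_
      exact hg.2.2.continuousOn.continuousAt
        ((hV.prod isOpen_univ).mem_nhds ⟨hUV hx, mem_univ _⟩)
    refine ⟨hg.1.comp hf.1 hUV, fun x hx v => ?_, ?_⟩
    · rw [(key x hx v).dirDeriv_eq]; exact key x hx v
    · have h1 : IsCk n (fun p : E × E => f p.1) (U ×ˢ univ) :=
        (hf.of_succ.comp_linear (ContinuousLinearMap.fst ℝ E E) hU).mono fun p hp => hp.1
      have h2 := IsCk.prodMk (hU.prod isOpen_univ) h1 hf.2.2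
      have h3 := ih hg.2.2 h2 (hU.prod isOpen_univ) (hV.prod isOpen_univ)
        (fun p hp => ⟨hUV hp.1, mem_univ _⟩)
      exact h3.congr (hU.prod isOpen_univ) fun p hp => ((key p.1 hp.1 p.2).dirDeriv_eq).symm

end Calculus

/-! ## Locally convex manifolds -/

section Manifolds

set_option linter.unusedSectionVars false

/-- A charted space `M` over the locally convex space `E` is a (Hausdorff) smooth manifold:
all changes of charts are smooth. -/
class IsLCManifold (E : Type u) [AddCommGroup E] [Module ℝ E] [TopologicalSpace E]
    (M : Type v) [TopologicalSpace M] [ChartedSpace E M] : Prop extends T2Space M where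
  compatible : ∀ e ∈ atlas E M, ∀ e' ∈ atlas E M,
    IsSmoothOn (e' ∘ e.symm) (e.target ∩ e.symm ⁻¹' e'.source)

/-- Products of manifolds, with the product charts. -/
instance instChartedSpaceProd {E : Type*} [TopologicalSpace E] {F : Type*} [TopologicalSpace F]
    {M : Type*} [TopologicalSpace M] [ChartedSpace E M]
    {N : Type*} [TopologicalSpace N] [ChartedSpace F N] : ChartedSpace (E × F) (M × N) :=
  prodChartedSpace E M F N

variable (E : Type*) [AddCommGroup E] [Module ℝ E] [TopologicalSpace E]
  (F : Type*) [AddCommGroup F] [Module ℝ F] [TopologicalSpace F]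
  (H : Type*) [AddCommGroup H] [Module ℝ H] [TopologicalSpace H]
  {M : Type*} [TopologicalSpace M] [ChartedSpace E M]
  {N : Type*} [TopologicalSpace N] [ChartedSpace F N]
  {K : Type*} [TopologicalSpace K] [ChartedSpace H K]

/-- The map `f`, read in the preferred charts at `x` and `f x`. -/
def inCharts (f : M → N) (x : M) : E → F :=
  chartAt F (f x) ∘ f ∘ (chartAt E x).symm

/-- `f` is smooth near `x`: it is continuous at `x`, and its expression in the preferred charts is
smooth on a neighbourhood of `x`. -/
def IsSmoothMapAt (f : M → N) (x : M) : Prop :=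
  ContinuousAt f x ∧
    ∃ W : Set E, IsOpen W ∧ chartAt E x x ∈ W ∧ IsSmoothOn (inCharts E F f x) W

/-- Smooth maps on an open subset of a manifold. -/
def IsSmoothMapOn (f : M → N) (U : Set M) : Prop := ∀ x ∈ U, IsSmoothMapAt E F f x

/-- Smooth maps between manifolds. -/
def IsSmoothMap (f : M → N) : Prop := ∀ x, IsSmoothMapAt E F f x

/-- The tangent map `T_x f : T_x M → T_{f x} N`, where (as usual in Mathlib) `T_x M` is identified
with the model space by means of the preferred chart at `x`. -/
def tmap (f : M → N) (x : M) (v : E) : F := dirDeriv (inCharts E F f x) (chartAt E x x) v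

variable {E F H}

theorem IsSmoothMapAt.continuousAt {f : M → N} {x : M} (h : IsSmoothMapAt E F f x) :
    ContinuousAt f x := h.1

theorem IsSmoothMap.continuous {f : M → N} (h : IsSmoothMap E F f) : Continuous f :=
  continuous_iff_continuousAt.2 fun x => (h x).1

theorem inCharts_comp_eventuallyEq {g : N → K} {f : M → N} {x : M} (hf : ContinuousAt f x) :
    inCharts F H g (f x) ∘ inCharts E F f x =ᶠ[𝓝 (chartAt E x x)] inCharts E H (g ∘ f) x := by
  have h1 : ContinuousAt (f ∘ (chartAt E x).symm) (chartAt E x x) := by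
    refine ContinuousAt.comp ?_ ((chartAt E x).continuousAt_symm (mem_chart_target E x))
    rwa [(chartAt E x).left_inv (mem_chart_source E x)]
  have h2 : (chartAt F (f x)).source ∈ 𝓝 ((f ∘ (chartAt E x).symm) (chartAt E x x)) := by
    rw [Function.comp_apply, (chartAt E x).left_inv (mem_chart_source E x)]
    exact chart_source_mem_nhds F (f x)
  filter_upwards [h1 h2] with y hy
  have hy' : f ((chartAt E x).symm y) ∈ (chartAt F (f x)).source := hy
  simp [inCharts, (chartAt F (f x)).left_inv hy']

theorem inCharts_self {f : M → N} {x : M} :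
    inCharts E F f x (chartAt E x x) = chartAt F (f x) (f x) := by
  simp [inCharts]

theorem inCharts_id_eventuallyEq (x : M) :
    (id : E → E) =ᶠ[𝓝 (chartAt E x x)] inCharts E E (id : M → M) x := by
  filter_upwards [(chartAt E x).open_target.mem_nhds (mem_chart_target E x)] with y hy
  simp [inCharts, (chartAt E x).right_inv hy]

variable [IsTopologicalAddGroup E] [ContinuousSMul ℝ E] [T2Space E]
  [IsTopologicalAddGroup F] [ContinuousSMul ℝ F] [LocallyConvexSpace ℝ F] [T2Space F]
  [IsTopologicalAddGroup H] [ContinuousSMul ℝ H] [LocallyConvexSpace ℝ H] [T2Space H]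

theorem isSmoothOn_id (U : Set E) : IsSmoothOn (id : E → E) U := fun n => by
  have := isCk_affine n (0 : E) (ContinuousLinearMap.id ℝ E) U
  have h : (fun x : E => (0 : E) + ContinuousLinearMap.id ℝ E x) = id := by ext; simp
  rwa [h] at this

theorem isSmoothMap_id : IsSmoothMap E E (id : M → M) := fun x => by
  obtain ⟨W, hW, hWo, hxW⟩ := eventually_nhds_iff.1 (inCharts_id_eventuallyEq (E := E) x)
  exact ⟨continuousAt_id, W, hWo, hxW, fun n => (isSmoothOn_id W n).congr hWo hW⟩

theorem IsSmoothMapAt.comp {g : N → K} {f : M → N} {x : M} (hg : IsSmoothMapAt F H g (f x))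
    (hf : IsSmoothMapAt E F f x) : IsSmoothMapAt E H (g ∘ f) x := by
  obtain ⟨hgc, V, hVo, hxV, hV⟩ := hg
  obtain ⟨hfc, U, hUo, hxU, hU⟩ := hf
  refine ⟨hgc.comp hfc, ?_⟩
  obtain ⟨W, hW, hWo, hxW⟩ := eventually_nhds_iff.1
    (inCharts_comp_eventuallyEq (E := E) (F := F) (H := H) (g := g) hfc)
  have hpre : IsOpen (U ∩ inCharts E F f x ⁻¹' V) :=
    (hU 0).continuousOn.isOpen_inter_preimage hUo hVo
  refine ⟨U ∩ inCharts E F f x ⁻¹' V ∩ W, hpre.inter hWo, ⟨⟨hxU, ?_⟩, hxW⟩, fun n => ?_⟩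
  · show inCharts E F f x (chartAt E x x) ∈ V
    rwa [inCharts_self]
  · exact (IsCk.comp (hV n) ((hU n).mono fun y hy => hy.1.1) (hpre.inter hWo) hVo
      fun y hy => hy.1.2).congr (hpre.inter hWo) fun y hy => hW y hy.2

theorem IsSmoothMap.comp {g : N → K} {f : M → N} (hg : IsSmoothMap F H g)
    (hf : IsSmoothMap E F f) : IsSmoothMap E H (g ∘ f) := fun x => (hg (f x)).comp (hf x)

theorem tmap_id (x : M) (v : E) : tmap E E (id : M → M) x v = v := by
  have h : HasDirDeriv (id : E → E) (chartAt E x x) v v := by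
    refine tendsto_const_nhds.congr' ?_
    filter_upwards [self_mem_nhdsWithin] with t ht
    have ht' : t ≠ 0 := ht
    simp [inv_smul_smul₀ ht']
  exact (h.congr (inCharts_id_eventuallyEq x)).dirDeriv_eq

theorem tmap_comp {g : N → K} {f : M → N} {x : M} (hg : IsSmoothMapAt F H g (f x))
    (hf : IsSmoothMapAt E F f x) (v : E) :
    tmap E H (g ∘ f) x v = tmap F H g (f x) (tmap E F f x v) := by
  have hfc := hf.1
  obtain ⟨-, V, hVo, hxV, hV⟩ := hg
  obtain ⟨-, U, hUo, hxU, hU⟩ := hf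
  have h1 := hV 1
  have h2 := hU 1
  have hx : inCharts E F f x (chartAt E x x) ∈ V := by rwa [inCharts_self]
  have h3 := HasDirDeriv.comp (dg := fun p => dirDeriv (inCharts F H g (f x)) p.1 p.2)
    (h2.2.1 _ hxU v) (h2.1.continuousAt (hUo.mem_nhds hxU)) (hVo.mem_nhds hx) h1.2.1
    (h1.2.2.continuousOn.continuousAt ((hVo.prod isOpen_univ).mem_nhds ⟨hx, mem_univ _⟩))
  have h4 := (h3.congr (inCharts_comp_eventuallyEq hfc)).dirDeriv_eq
  simp only [inCharts_self] at h4
  exact h4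

theorem isSmoothMap_prodMk_left (a : N) :
    IsSmoothMap E (F × E) (fun x : M => ((a, x) : N × M)) := fun x => by
  obtain ⟨W, hW, hWo, hxW⟩ := eventually_nhds_iff.1 (inCharts_id_eventuallyEq (E := E) x)
  refine ⟨by fun_prop, W, hWo, hxW, fun n => ?_⟩
  have h := isCk_affine n ((chartAt F a a, 0) : F × E) (ContinuousLinearMap.inr ℝ F E) W
  refine h.congr hWo fun y hy => ?_
  have := hW y hy
  simp only [inCharts, id, Function.comp_apply] at this
  refine Prod.ext ?_ ?_
  · simp [inCharts]; rfl
  · simp [inCharts]; exact this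

/-- Continuous affine maps of locally convex spaces are smooth. -/
theorem isSmoothMap_affine (c : F) (L : E →L[ℝ] F) : IsSmoothMap E F (fun x : E => c + L x) :=
  fun x => ⟨by fun_prop, univ, isOpen_univ, mem_univ _, fun n => isCk_affine n c L univ⟩

end Manifolds

/-! ## Smooth singular chains and differential characters of degree one -/

section Characters

set_option linter.unusedSectionVars false

variable (E : Type*) [AddCommGroup E] [Module ℝ E] [TopologicalSpace E]
  [IsTopologicalAddGroup E] [ContinuousSMul ℝ E] [LocallyConvexSpace ℝ E] [T2Space E]
  (M : Type*) [TopologicalSpace M] [ChartedSpace E M]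
  {F : Type*} [AddCommGroup F] [Module ℝ F] [TopologicalSpace F]
  [IsTopologicalAddGroup F] [ContinuousSMul ℝ F] [LocallyConvexSpace ℝ F] [T2Space F]
  {N : Type*} [TopologicalSpace N] [ChartedSpace F N]

/-- Smooth singular `1`-simplices: smooth paths `[0, 1] → M`. -/
def SmoothPath : Type _ :=
  {c : unitInterval → M // ∃ f : ℝ → M, IsSmoothMap ℝ E f ∧ ∀ t : unitInterval, f t = c t}

/-- The standard `2`-simplex, with vertices `(0,0)`, `(1,0)`, `(0,1)`. -/
def stdTriangle : Set (Fin 2 → ℝ) := {x | 0 ≤ x 0 ∧ 0 ≤ x 1 ∧ x 0 + x 1 ≤ 1}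

/-- Smooth singular `2`-simplices. -/
def SmoothTriangle : Type _ :=
  {c : stdTriangle → M //
    ∃ f : (Fin 2 → ℝ) → M, IsSmoothMap (Fin 2 → ℝ) E f ∧ ∀ x : stdTriangle, f x = c x}

theorem line_mem_stdTriangle {a b : Fin 2 → ℝ} (ha : a ∈ stdTriangle) (hb : b ∈ stdTriangle)
    (t : unitInterval) : a + (t : ℝ) • (b - a) ∈ stdTriangle := by
  obtain ⟨t, ht0, ht1⟩ := t
  obtain ⟨a0, a1, a2⟩ := ha
  obtain ⟨b0, b1, b2⟩ := hb
  have h1 : 0 ≤ 1 - t := by linarith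
  refine ⟨?_, ?_, ?_⟩ <;> simp only [Pi.add_apply, Pi.smul_apply, Pi.sub_apply, smul_eq_mul]
  · nlinarith [mul_nonneg h1 a0, mul_nonneg ht0 b0]
  · nlinarith [mul_nonneg h1 a1, mul_nonneg ht0 b1]
  · nlinarith [mul_nonneg h1 (sub_nonneg.2 a2), mul_nonneg ht0 (sub_nonneg.2 b2)]

theorem vertex_mem_zero : ![0, 0] ∈ stdTriangle := by simp [stdTriangle]
theorem vertex_mem_one : ![1, 0] ∈ stdTriangle := by simp [stdTriangle]
theorem vertex_mem_two : ![0, 1] ∈ stdTriangle := by simp [stdTriangle]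

variable {E M}

/-- The image `f ∘ c` of a smooth path under a smooth map. -/
def SmoothPath.map (f : M → N) (hf : IsSmoothMap E F f) (c : SmoothPath E M) : SmoothPath F N :=
  ⟨fun t => f (c.1 t), by
    obtain ⟨g, hg, hgc⟩ := c.2
    exact ⟨f ∘ g, hf.comp hg, fun t => congrArg f (hgc t)⟩⟩

/-- The edge `[a, b]` of a smooth singular triangle. -/
def SmoothTriangle.edge (τ : SmoothTriangle E M) {a b : Fin 2 → ℝ} (ha : a ∈ stdTriangle)
    (hb : b ∈ stdTriangle) : SmoothPath E M :=
  ⟨fun t => τ.1 ⟨a + (t : ℝ) • (b - a), line_mem_stdTriangle ha hb t⟩, by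
    obtain ⟨g, hg, hgc⟩ := τ.2
    refine ⟨g ∘ fun t : ℝ => a + ContinuousLinearMap.toSpanSingleton ℝ (b - a) t,
      hg.comp (isSmoothMap_affine a _), fun t => ?_⟩
    simpa using hgc ⟨_, line_mem_stdTriangle ha hb t⟩⟩

variable (E M)

/-- The boundary map `∂ : C_1(M) → C_0(M)` on smooth singular chains. -/
def boundaryOne : (SmoothPath E M →₀ ℤ) →+ (M →₀ ℤ) :=
  Finsupp.liftAddHom fun c =>
    zmultiplesHom (M →₀ ℤ) (Finsupp.single (c.1 1) 1 - Finsupp.single (c.1 0) 1)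

/-- The group `Z_1(M)` of smooth singular `1`-cycles. -/
def OneCycles : AddSubgroup (SmoothPath E M →₀ ℤ) := (boundaryOne E M).ker

/-- The boundary map `∂ : C_2(M) → C_1(M)` on smooth singular chains. -/
def boundaryTwo : (SmoothTriangle E M →₀ ℤ) →+ (SmoothPath E M →₀ ℤ) :=
  Finsupp.liftAddHom fun τ =>
    zmultiplesHom (SmoothPath E M →₀ ℤ)
      (Finsupp.single (τ.edge vertex_mem_one vertex_mem_two) 1
        - Finsupp.single (τ.edge vertex_mem_zero vertex_mem_two) 1
        + Finsupp.single (τ.edge vertex_mem_zero vertex_mem_one) 1)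

theorem edge_zero (τ : SmoothTriangle E M) {a b : Fin 2 → ℝ} (ha : a ∈ stdTriangle)
    (hb : b ∈ stdTriangle) : (τ.edge ha hb).1 0 = τ.1 ⟨a, ha⟩ := by
  simp [SmoothTriangle.edge]

theorem edge_one (τ : SmoothTriangle E M) {a b : Fin 2 → ℝ} (ha : a ∈ stdTriangle)
    (hb : b ∈ stdTriangle) : (τ.edge ha hb).1 1 = τ.1 ⟨b, hb⟩ := by
  simp [SmoothTriangle.edge]

theorem boundaryOne_boundaryTwo (z : SmoothTriangle E M →₀ ℤ) :
    boundaryOne E M (boundaryTwo E M z) = 0 := by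
  have : (boundaryOne E M).comp (boundaryTwo E M) = 0 := by
    ext1 τ
    ext1
    simp only [AddMonoidHom.comp_apply, boundaryTwo, boundaryOne, Finsupp.singleAddHom_apply,
      Finsupp.liftAddHom_apply_single, zmultiplesHom_apply, one_smul, map_add, map_sub,
      edge_zero, edge_one, AddMonoidHom.zero_apply]
    abel
  exact DFunLike.congr_fun this z

/-- The boundary of a `2`-chain, as a `1`-cycle. -/
def boundaryCycle (z : SmoothTriangle E M →₀ ℤ) : OneCycles E M :=
  ⟨boundaryTwo E M z, boundaryOne_boundaryTwo E M z⟩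

variable {E M}

theorem boundaryOne_map (f : M → N) (hf : IsSmoothMap E F f) (c : SmoothPath E M →₀ ℤ) :
    boundaryOne F N (Finsupp.mapDomain.addMonoidHom (SmoothPath.map f hf) c) =
      Finsupp.mapDomain.addMonoidHom f (boundaryOne E M c) := by
  have : (boundaryOne F N).comp (Finsupp.mapDomain.addMonoidHom (SmoothPath.map f hf)) =
      (Finsupp.mapDomain.addMonoidHom f).comp (boundaryOne E M) := by
    ext1 c
    ext1
    simp only [AddMonoidHom.comp_apply, boundaryOne, Finsupp.singleAddHom_apply,
      Finsupp.liftAddHom_apply_single, zmultiplesHom_apply, one_smul, map_sub,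
      Finsupp.mapDomain.addMonoidHom_apply, Finsupp.mapDomain_single]
    rfl
  exact DFunLike.congr_fun this c

/-- The push-forward `c ↦ f ∘ c` on `1`-cycles. -/
def OneCycles.map (f : M → N) (hf : IsSmoothMap E F f) : OneCycles E M →+ OneCycles F N :=
  ((Finsupp.mapDomain.addMonoidHom (SmoothPath.map f hf)).comp (OneCycles E M).subtype).codRestrict
    (OneCycles F N) fun c => by
      have hc : boundaryOne E M c.1 = 0 := c.2
      show boundaryOne F N (Finsupp.mapDomain.addMonoidHom (SmoothPath.map f hf) c.1) = 0
      rw [boundaryOne_map, hc, map_zero]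

/-- The pull-back `(f^* h)(c) = h(f ∘ c)` of a homomorphism `h : Z_1(N) → 𝕋`. -/
def pullbackCharacter (f : M → N) (hf : IsSmoothMap E F f) (h : AddChar (OneCycles F N) Circle) :
    AddChar (OneCycles E M) Circle :=
  h.compAddMonoidHom (OneCycles.map f hf)

/-- `α` (a family of functions on the tangent spaces `T_x M`, identified with the model space by
the preferred chart at `x`) is a smooth differential `1`-form. -/
def IsOneForm (α : M → E → ℝ) : Prop :=
  (∀ x, IsLinearMap ℝ (α x)) ∧
    ∀ e ∈ atlas E M,
      IsSmoothOn (fun y : E × E => α (e.symm y.1) (tmap E E e.symm y.1 y.2)) (e.target ×ˢ univ)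

/-- `ω` is a smooth differential `2`-form. -/
def IsTwoForm (ω : M → E → E → ℝ) : Prop :=
  (∀ x v, IsLinearMap ℝ (ω x v)) ∧ (∀ x v, ω x v v = 0) ∧ (∀ x v w, ω x v w = -ω x w v) ∧
    ∀ e ∈ atlas E M,
      IsSmoothOn (fun y : E × E × E => ω (e.symm y.1) (tmap E E e.symm y.1 y.2.1)
        (tmap E E e.symm y.1 y.2.2)) (e.target ×ˢ univ)

/-- The integral of a `2`-form over a smooth singular triangle. -/
def SmoothTriangle.integral (ω : M → E → E → ℝ) (τ : SmoothTriangle E M) : ℝ :=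
  ∫ x in stdTriangle, ω (τ.2.choose x) (tmap (Fin 2 → ℝ) E τ.2.choose x (Pi.single 0 1))
    (tmap (Fin 2 → ℝ) E τ.2.choose x (Pi.single 1 1))

/-- A homomorphism `h : Z_1(M) → 𝕋` is a differential character of degree one if there is a
`2`-form `ω` on `M` with `h(∂z) = exp(2πi ∫_z ω)` for all smooth singular `2`-chains `z`. -/
def IsDifferentialCharacter (h : AddChar (OneCycles E M) Circle) : Prop :=
  ∃ ω : M → E → E → ℝ, IsTwoForm ω ∧ ∀ z : SmoothTriangle E M →₀ ℤ,
    h (boundaryCycle E M z) =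
      Circle.exp (2 * Real.pi * z.sum fun τ n => (n : ℝ) * τ.integral ω)

end Characters

/-! ## Principal circle bundles with connection and their holonomy -/

/-- The model space of the circle group (as in Mathlib). -/
abbrev Line : Type := EuclideanSpace ℝ (Fin 1)

section Bundles

set_option linter.unusedSectionVars false

variable (E : Type*) [AddCommGroup E] [Module ℝ E] [TopologicalSpace E]
  [IsTopologicalAddGroup E] [ContinuousSMul ℝ E] [LocallyConvexSpace ℝ E] [T2Space E]
  {M : Type*} [TopologicalSpace M] [ChartedSpace E M]
  (P : M → Type*) [∀ x, TopologicalSpace (P x)] [TopologicalSpace (TotalSpace Circle P)]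
  [FiberBundle Circle P] [∀ x, MulAction Circle (P x)]

/-- A locally trivial bundle `P → M` with fibre the circle and a fibrewise action of the circle
group `𝕋` is a smooth principal `𝕋`-bundle if its trivializations are `𝕋`-equivariant and its
transition functions `M ⊇ U ∩ U' → 𝕋` are smooth. -/
class IsSmoothCircleBundle : Prop where
  equivariant : ∀ (e : Trivialization Circle (π Circle P)) [MemTrivializationAtlas e],
    ∀ x ∈ e.baseSet, ∀ (z : Circle) (p : P x),
      (e (TotalSpace.mk x (z • p))).2 = z * (e (TotalSpace.mk x p)).2
  smooth_transition : ∀ (e e' : Trivialization Circle (π Circle P)) [MemTrivializationAtlas e]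
    [MemTrivializationAtlas e'],
      IsSmoothMapOn E Line (fun x => (e' (e.toOpenPartialHomeomorph.symm (x, 1))).2)
        (e.baseSet ∩ e'.baseSet)

/-- The total space of a circle bundle over `M` as a manifold modelled on `E × ℝ`: the charts are
obtained from the local trivializations and the charts of `M` and of the circle. -/
instance instChartedSpaceTotalSpace : ChartedSpace (E × Line) (TotalSpace Circle P) :=
  ChartedSpace.comp (E × Line) (M × Circle) (TotalSpace Circle P)

variable {P}

/-- The action of `𝕋` on the total space. -/
def rot (z : Circle) : Equiv.Perm (TotalSpace Circle P) where
  toFun p := ⟨p.proj, z • p.2⟩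
  invFun p := ⟨p.proj, z⁻¹ • p.2⟩
  left_inv p := by simp
  right_inv p := by simp

/-- The `1`-form `θ` on the total space is a principal connection form: it is `𝕋`-invariant and
takes the value `1` on the vector field generating the action `t ↦ exp(2πit)`. -/
structure IsConnection (θ : TotalSpace Circle P → E × Line → ℝ) : Prop where
  isOneForm : IsOneForm θ
  invariant : ∀ (z : Circle) (p : TotalSpace Circle P) (v : E × Line),
    θ (rot z p) (tmap (E × Line) (E × Line) (rot z) p v) = θ p v
  normalized : ∀ p : TotalSpace Circle P,
    θ p (tmap ℝ (E × Line) (fun t : ℝ => rot (Circle.exp (2 * Real.pi * t)) p) 0 1) = 1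

variable {E}

/-- `q` is the parallel transport of `p` along the smooth path `c`: there is a smooth curve from
`p` to `q` which covers `c` and is horizontal. -/
def IsParallel (θ : TotalSpace Circle P → E × Line → ℝ) (c : SmoothPath E M)
    (p q : TotalSpace Circle P) : Prop :=
  ∃ γ : ℝ → TotalSpace Circle P, IsSmoothMap ℝ (E × Line) γ ∧ γ 0 = p ∧ γ 1 = q ∧
    ∀ t : unitInterval, (γ t).proj = c.1 t ∧ θ (γ t) (tmap ℝ (E × Line) γ t 1) = 0

variable (P) in
/-- A (not necessarily continuous) section of `P → M`, used to compare fibres. -/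
def refPoint (x : M) : TotalSpace Circle P :=
  (trivializationAt Circle P x).toOpenPartialHomeomorph.symm (x, 1)

/-- The element `u` of `𝕋` such that parallel transport along `c` sends the reference point over
`c(0)` to `u` times the reference point over `c(1)`. -/
def transport (θ : TotalSpace Circle P → E × Line → ℝ) (c : SmoothPath E M) : Circle :=
  Classical.epsilon fun u => IsParallel θ c (refPoint P (c.1 0)) (rot u (refPoint P (c.1 1)))

/-- The holonomy `Z_1(M) → 𝕋` of the bundle with connection `(P, θ)`. On a closed path `c` it is
the element `u` of `𝕋` such that parallel transport around `c` sends `p` to `u • p`; on a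
general cycle it is the product of the parallel transports along the simplices of the cycle,
relative to reference points in the fibres (which cancel, the chain being a cycle). -/
def holonomy (θ : TotalSpace Circle P → E × Line → ℝ) : AddChar (OneCycles E M) Circle where
  toFun c := c.1.prod fun σ n => transport θ σ ^ n
  map_zero_eq_one' := by simp
  map_add_eq_mul' a b :=
    Finsupp.prod_add_index' (fun _ => zpow_zero _) (fun _ _ _ => zpow_add _ _ _)

end Bundles

/-! ## Pull-back of circle bundles with connection -/

section Pullback

variable {E : Type*} [AddCommGroup E] [Module ℝ E] [TopologicalSpace E]
  {M : Type*} [TopologicalSpace M] [ChartedSpace E M]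
  {F : Type*} [AddCommGroup F] [Module ℝ F] [TopologicalSpace F]
  {N : Type*} [TopologicalSpace N] [ChartedSpace F N]
  {P : M → Type*} [∀ x, TopologicalSpace (P x)] [TopologicalSpace (TotalSpace Circle P)]
  [FiberBundle Circle P] [∀ x, MulAction Circle (P x)] [∀ x, Nonempty (P x)]

instance instMulActionPullback {N : Type*} (f : N → M) (n : N) : MulAction Circle ((f *ᵖ P) n) :=
  inferInstanceAs (MulAction Circle (P (f n)))

instance instNonemptyPullback {N : Type*} (f : N → M) (n : N) : Nonempty ((f *ᵖ P) n) :=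
  inferInstanceAs (Nonempty (P (f n)))

/-- The pull-back `ψ^*θ` of `θ` to `ψ^*P`: the pull-back of the `1`-form `θ` along the canonical
bundle map `ψ^*P → P`, `(n, p) ↦ p`. -/
def pullbackForm (ψ : C(N, M)) (θ : TotalSpace Circle P → E × Line → ℝ) :
    TotalSpace Circle ((ψ : N → M) *ᵖ P) → F × Line → ℝ :=
  fun q v => θ (Pullback.lift ψ q) (tmap (F × Line) (E × Line) (Pullback.lift ψ) q v)

end Pullback

/-! ## Lie groups, central extensions -/

section Groups

set_option linter.unusedSectionVars false

/-- Locally convex Lie groups. -/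
class IsLCLieGroup (E : Type u) [AddCommGroup E] [Module ℝ E] [TopologicalSpace E]
    (G : Type v) [TopologicalSpace G] [ChartedSpace E G] [Group G] : Prop
    extends IsLCManifold E G where
  smooth_mul : IsSmoothMap (E × E) E (fun p : G × G => p.1 * p.2)
  smooth_inv : IsSmoothMap E E (fun g : G => g⁻¹)

/-- Smooth actions of a Lie group on a manifold. -/
class IsSmoothAction (EG : Type*) [AddCommGroup EG] [Module ℝ EG] [TopologicalSpace EG]
    (E : Type*) [AddCommGroup E] [Module ℝ E] [TopologicalSpace E]
    (G : Type*) [TopologicalSpace G] [ChartedSpace EG G] [Group G]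
    (M : Type*) [TopologicalSpace M] [ChartedSpace E M] [MulAction G M] : Prop where
  smooth_smul : IsSmoothMap (EG × E) E (fun q : G × M => q.1 • q.2)

variable (EG : Type*) [AddCommGroup EG] [Module ℝ EG] [TopologicalSpace EG]
  [IsTopologicalAddGroup EG] [ContinuousSMul ℝ EG] [LocallyConvexSpace ℝ EG] [T2Space EG]
  (G : Type*) [TopologicalSpace G] [ChartedSpace EG G] [Group G]
  {E : Type*} [AddCommGroup E] [Module ℝ E] [TopologicalSpace E]
  [IsTopologicalAddGroup E] [ContinuousSMul ℝ E] [LocallyConvexSpace ℝ E] [T2Space E]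
  {M : Type*} [TopologicalSpace M] [ChartedSpace E M] [MulAction G M]
  [IsSmoothAction EG E G M]
  {P : M → Type*} [∀ x, TopologicalSpace (P x)] [TopologicalSpace (TotalSpace Circle P)]
  [FiberBundle Circle P] [∀ x, MulAction Circle (P x)] [∀ x, Nonempty (P x)]

/-- A central extension `1 → 𝕋 → Ĝ → G → 1` of Lie groups: an exact sequence of smooth
homomorphisms of Lie groups with central kernel, admitting smooth local sections. -/
structure IsCentralLieExtension (EG' : Type*) [AddCommGroup EG'] [Module ℝ EG']
    [TopologicalSpace EG'] {G' : Type*} [TopologicalSpace G'] [ChartedSpace EG' G'] [Group G']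
    (ι : Circle →* G') (q : G' →* G) : Prop where
  lieGroup : IsLCLieGroup EG' G'
  injective : Function.Injective ι
  exact : ι.range = q.ker
  surjective : Function.Surjective q
  central : ∀ z a, ι z * a = a * ι z
  smooth_inclusion : IsSmoothMap Line EG' ι
  smooth_projection : IsSmoothMap EG' EG q
  local_section : ∀ g : G, ∃ U : Set G, IsOpen U ∧ g ∈ U ∧ ∃ s : G → G',
    IsSmoothMapOn EG EG' s U ∧ ∀ x ∈ U, q (s x) = x

theorem IsSmoothAction.isSmoothMap_smul (h : IsSmoothAction EG E G M) (g : G) :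
    IsSmoothMap E E (fun x : M => g • x) :=
  h.smooth_smul.comp (isSmoothMap_prodMk_left g)

/-- A character `h : Z_1(M) → 𝕋` is `G`-invariant if `g^* h = h` for all `g`. -/
def IsInvariantCharacter (h : AddChar (OneCycles E M) Circle) : Prop :=
  ∀ g : G, pullbackCharacter (fun x : M => g • x)
    (IsSmoothAction.isSmoothMap_smul EG G inferInstance g) h = h

variable (E) in
/-- The orbit map `g ↦ g • x`. -/
def orbitMap (x : M) : C(G, M) :=
  ⟨fun g => g • x,
    (IsSmoothAction.smooth_smul (EG := EG) (E := E) (G := G) (M := M)).continuous.comp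
      (Continuous.prodMk_left x)⟩

/-- The group `Ĝ` obtained from `(P, θ)`: the pull-back along the action of `G` on `M` of the group
of automorphisms of the principal bundle with connection `(P, θ)`. Its elements are the pairs
`(g, φ)` of an element `g` of `G` and an automorphism `φ` of `(P, θ)` covering the action of `g`. -/
def extensionGroup (θ : TotalSpace Circle P → E × Line → ℝ) :
    Subgroup (G × Equiv.Perm (TotalSpace Circle P)) where
  carrier := {a |
    IsSmoothMap (E × Line) (E × Line) a.2 ∧ IsSmoothMap (E × Line) (E × Line) a.2.symm ∧
    (∀ z p, a.2 (rot z p) = rot z (a.2 p)) ∧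
    (∀ p, (a.2 p).proj = a.1 • p.proj) ∧
    (∀ p v, θ (a.2 p) (tmap (E × Line) (E × Line) a.2 p v) = θ p v)}
  one_mem' := by
    refine ⟨isSmoothMap_id, isSmoothMap_id, fun _ _ => rfl, fun p => (one_smul _ _).symm,
      fun p v => ?_⟩
    exact congrArg (θ p) (tmap_id p v)
  mul_mem' := by
    rintro ⟨g, φ⟩ ⟨h, χ⟩ ⟨a1, a2, a3, a4, a5⟩ ⟨b1, b2, b3, b4, b5⟩
    refine ⟨a1.comp b1, b2.comp a2, fun z p => ?_, fun p => ?_, fun p v => ?_⟩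
    · show φ (χ (rot z p)) = rot z (φ (χ p))
      rw [b3, a3]
    · show (φ (χ p)).proj = (g * h) • p.proj
      rw [a4, b4, mul_smul]
    · show θ (φ (χ p)) (tmap (E × Line) (E × Line) (φ ∘ χ) p v) = θ p v
      rw [tmap_comp (a1 _) (b1 _), a5, b5]
  inv_mem' := by
    rintro ⟨g, φ⟩ ⟨a1, a2, a3, a4, a5⟩
    refine ⟨a2, a1, fun z p => ?_, fun p => ?_, fun p v => ?_⟩
    · show φ.symm (rot z p) = rot z (φ.symm p)
      rw [Equiv.symm_apply_eq, a3, Equiv.apply_symm_apply]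
    · show (φ.symm p).proj = g⁻¹ • p.proj
      rw [eq_inv_smul_iff, ← a4, Equiv.apply_symm_apply]
    · show θ (φ.symm p) (tmap (E × Line) (E × Line) φ.symm p v) = θ p v
      rw [← a5, ← tmap_comp (a1 _) (a2 _), Equiv.apply_symm_apply]
      have : (φ ∘ φ.symm : TotalSpace Circle P → TotalSpace Circle P) = id := by
        ext1 x; simp
      rw [this, tmap_id]

variable {G}

theorem proj_apply {θ : TotalSpace Circle P → E × Line → ℝ} (a : extensionGroup G θ)
    (p : TotalSpace Circle P) : (a.1.2 p).proj = a.1.1 • p.proj := a.2.2.2.2.1 p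

/-- The map `(g, φ) ↦ (g, φ(p))` from `Ĝ` to the pull-back of `P` along the orbit map of the point
of `M` under `p`. -/
def evalAt {θ : TotalSpace Circle P → E × Line → ℝ} (p : TotalSpace Circle P)
    (a : extensionGroup G θ) :
    TotalSpace Circle ((orbitMap EG G E p.proj : G → M) *ᵖ P) :=
  ⟨a.1.1, (show P (a.1.1 • p.proj) from proj_apply a p ▸ (a.1.2 p).2)⟩

theorem lift_evalAt {θ : TotalSpace Circle P → E × Line → ℝ} (p : TotalSpace Circle P)
    (a : extensionGroup G θ) :
    Pullback.lift (orbitMap EG G E p.proj) (evalAt EG p a) = a.1.2 p := by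
  refine Bundle.TotalSpace.ext (proj_apply a p).symm ?_
  exact eqRec_heq _ _

/-- The group `Ĝ`, with the topology and the charts that come from the identification
`(g, φ) ↦ (g, φ(p))` with the pull-back of `P` along an orbit map. -/
def ExtensionAt (_ : Type*) (θ : TotalSpace Circle P → E × Line → ℝ)
    (_ : TotalSpace Circle P) : Type _ :=
  extensionGroup G θ

instance instGroupExtensionAt (θ : TotalSpace Circle P → E × Line → ℝ) (p : TotalSpace Circle P) :
    Group (ExtensionAt (G := G) EG θ p) := inferInstanceAs (Group (extensionGroup G θ))

instance instTopologicalSpaceExtensionAt (θ : TotalSpace Circle P → E × Line → ℝ)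
    (p : TotalSpace Circle P) : TopologicalSpace (ExtensionAt (G := G) EG θ p) :=
  TopologicalSpace.induced (evalAt (G := G) (θ := θ) EG p) inferInstance

/-- The identification of `Ĝ` with the pull-back of `P` along an orbit map, provided that it is
bijective. -/
def evalHomeomorph (θ : TotalSpace Circle P → E × Line → ℝ) (p : TotalSpace Circle P)
    (hb : Function.Bijective (evalAt (G := G) (θ := θ) EG p)) :
    ExtensionAt (G := G) EG θ p ≃ₜ TotalSpace Circle ((orbitMap EG G E p.proj : G → M) *ᵖ P) :=
  Equiv.toHomeomorphOfIsInducing (X := ExtensionAt (G := G) EG θ p)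
    (Equiv.ofBijective (evalAt (G := G) (θ := θ) EG p) hb) ⟨rfl⟩

/-- The charts on `Ĝ` obtained by the identification with the pull-back of `P`
along an orbit map. -/
instance instChartedSpaceExtensionAt (θ : TotalSpace Circle P → E × Line → ℝ)
    (p : TotalSpace Circle P)
    [hb : Fact (Function.Bijective (evalAt (G := G) (θ := θ) EG p))] :
    ChartedSpace (EG × Line) (ExtensionAt (G := G) EG θ p) :=
  letI : ChartedSpace (TotalSpace Circle ((orbitMap EG G E p.proj : G → M) *ᵖ P))
      (ExtensionAt (G := G) EG θ p) :=
    (evalHomeomorph EG θ p hb.out).toOpenPartialHomeomorph.singletonChartedSpace rfl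
  ChartedSpace.comp (EG × Line) (TotalSpace Circle ((orbitMap EG G E p.proj : G → M) *ᵖ P))
    (ExtensionAt (G := G) EG θ p)

/-- The projection `Ĝ → G`, `(g, φ) ↦ g`. -/
def extensionProj (θ : TotalSpace Circle P → E × Line → ℝ) : extensionGroup G θ →* G :=
  (MonoidHom.fst G (Equiv.Perm (TotalSpace Circle P))).comp (extensionGroup G θ).subtype

/-- The central extension `𝕋 → Ĝ → G` obtained from `(P, θ)` is a central extension of Lie groups;
here `𝕋` acts on `P` by automorphisms covering the identity, and the smooth structure of `Ĝ` comes
from the bijection `(g, φ) ↦ (g, φ(p))`, for an arbitrary point `p` of `P`. -/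
def IsLieExtension (G : Type*) [TopologicalSpace G] [ChartedSpace EG G] [Group G]
    [MulAction G M] [IsSmoothAction EG E G M] (θ : TotalSpace Circle P → E × Line → ℝ) : Prop :=
  ∃ ι : Circle →* extensionGroup G θ,
    (∀ z, (ι z : G × Equiv.Perm (TotalSpace Circle P)) = (1, rot z)) ∧
    ∀ p : TotalSpace Circle P,
      ∃ _ : Fact (Function.Bijective (evalAt (G := G) (θ := θ) EG p)),
        IsCentralLieExtension EG G (EG × Line) (G' := ExtensionAt (G := G) EG θ p)
          ι (extensionProj θ)

variable {F : Type*} [AddCommGroup F] [Module ℝ F] [TopologicalSpace F]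
  [IsTopologicalAddGroup F] [ContinuousSMul ℝ F] [LocallyConvexSpace ℝ F] [T2Space F]
  {N : Type*} [TopologicalSpace N] [ChartedSpace F N] [MulAction G N]
  [IsSmoothAction EG F G N]
  {Q : N → Type*} [∀ x, TopologicalSpace (Q x)] [TopologicalSpace (TotalSpace Circle Q)]
  [FiberBundle Circle Q] [∀ x, MulAction Circle (Q x)] [∀ x, Nonempty (Q x)]

/-- The group isomorphism `Φ` between the extensions of `G` obtained from `(P, θ)` and from
`(Q, η)` is a smooth isomorphism of central extensions: it is compatible with the projections to
`G` and the inclusions of `𝕋`, and `Φ` and its inverse are smooth. -/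
structure IsSmoothExtensionIso (θ : TotalSpace Circle P → E × Line → ℝ)
    (η : TotalSpace Circle Q → F × Line → ℝ) (Φ : extensionGroup G θ ≃* extensionGroup G η) :
    Prop where
  proj : ∀ a, extensionProj η (Φ a) = extensionProj θ a
  incl : ∀ (z : Circle) (a : extensionGroup G θ), a.1 = (1, rot z) → (Φ a).1 = (1, rot z)
  smooth : ∀ (p : TotalSpace Circle P) (q : TotalSpace Circle Q)
    [Fact (Function.Bijective (evalAt (G := G) (θ := θ) EG p))]
    [Fact (Function.Bijective (evalAt (G := G) (θ := η) EG q))],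
    IsSmoothMap (EG × Line) (EG × Line) (M := ExtensionAt (G := G) EG θ p)
      (N := ExtensionAt (G := G) EG η q) Φ ∧
    IsSmoothMap (EG × Line) (EG × Line) (M := ExtensionAt (G := G) EG η q)
      (N := ExtensionAt (G := G) EG θ p) Φ.symm

end Groups

end LC

end

open LC Bundle

/-!
The notion that carries the proof is that of a parallel map (`IsParallelMap`): a `𝕋`-equivariant map
`χ : Q → P` between total spaces of circle bundles with connection over a smooth map `f` of the
bases which sends horizontal curves to horizontal curves. No smoothness is required of `χ`.

* Uniqueness (`IsParallelMap.eq_of_apply_eq`): over a connected base, `χ` is determined by its value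
  at one point, since horizontal curves are determined by their projection and one value, and any
  two points of the base are joined by a chain of smooth curves.
* Existence (`exists_parallelMap`): if the holonomy of `Q` is the pull-back of the holonomy of `P`,
  the discrepancy between the parallel transports along a path and along its image is a cochain
  which vanishes on cycles, hence the variation of a function on the base; rotating reference points
  by this function yields `χ`, and its value at one point may be prescribed.
* Smoothness (`smoothAt_family`, `IsParallelMap.isSmoothMap`): in local trivializations, parallel
  transport along the segments of a chart is the exponential of the integral of the connection
  form, and depends smoothly on the end point. So parallel maps are smooth, and a family of parallel
  maps which depends smoothly on a parameter at one point is jointly smooth. A smooth parallel map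
  preserves the connection forms (`IsParallelMap.preserves`). The group of automorphisms thus acts
  smoothly on the bundle.

An element `(g, φ)` of the extension `Ĝ` is a parallel map `φ : P → P` over the action of `g`. If
the holonomy is invariant, existence and uniqueness show that `(g, φ) ↦ (g, φ(p))` is a bijection onto
the pull-back of `P` along the orbit map (`bijective_evalAt`); smoothness of the action on `P` then
makes `Ĝ` a Lie group and a central extension of `G` (`isLieExtension`).

Finally, let `Λ : Q → P` be a parallel map over the equivariant map `ψ : N → M`. An automorphism of
`P` and one of `Q` over the same element of `G` correspond to each other if `Λ` intertwines them;
by uniqueness this can be tested at a single point, so this correspondence is an isomorphism of the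
two extensions (`exists_extensionIso`). In the first part of the theorem, `Λ` is the canonical map
`ψ^*P → P`, and the holonomy of the pull-back is the pull-back of the holonomy
(`holonomy_pullbackForm`). In the second part, `Λ` is given by the existence theorem.
-/

namespace LC

/-! ### Calculus of Michal–Bastiani smooth maps -/

section CalculusLemmas

theorem isCk_of_local : ∀ {n : ℕ} {E : Type u} [AddCommGroup E] [Module ℝ E] [TopologicalSpace E]
    {F : Type v} [AddCommGroup F] [Module ℝ F] [TopologicalSpace F] {f : E → F} {U : Set E},
    (∀ x ∈ U, ∃ W, IsOpen W ∧ x ∈ W ∧ IsCk n f W) → IsCk n f U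
  | 0, _, _, _, _, _, _, _, _, _, _, h => fun x hx => by
      obtain ⟨W, hW, hxW, hf⟩ := h x hx
      exact (ContinuousOn.continuousAt hf (hW.mem_nhds hxW)).continuousWithinAt
  | n + 1, _, _, _, _, _, _, _, _, _, _, h => by
      refine ⟨fun x hx => ?_, fun x hx => ?_, isCk_of_local fun p hp => ?_⟩
      · obtain ⟨W, hW, hxW, hf⟩ := h x hx
        exact (hf.1.continuousAt (hW.mem_nhds hxW)).continuousWithinAt
      · obtain ⟨W, hW, hxW, hf⟩ := h x hx
        exact hf.2.1 x hxW
      · obtain ⟨W, hW, hxW, hf⟩ := h p.1 hp.1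
        exact ⟨W ×ˢ univ, hW.prod isOpen_univ, ⟨hxW, mem_univ _⟩, hf.2.2⟩

theorem isSmoothOn_of_local {E : Type u} [AddCommGroup E] [Module ℝ E] [TopologicalSpace E]
    {F : Type v} [AddCommGroup F] [Module ℝ F] [TopologicalSpace F] {f : E → F} {U : Set E}
    (h : ∀ x ∈ U, ∃ W, IsOpen W ∧ x ∈ W ∧ IsSmoothOn f W) : IsSmoothOn f U := fun n =>
  isCk_of_local fun x hx => let ⟨W, hW, hxW, hf⟩ := h x hx; ⟨W, hW, hxW, hf n⟩

/-- Over normed spaces, maps that are `C^n` in the sense of Fréchet are `C^n` in the sense of Michal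
and Bastiani. -/
theorem isCk_of_contDiffOn : ∀ {n : ℕ} {E : Type u} [NormedAddCommGroup E] [NormedSpace ℝ E]
    {F : Type v} [NormedAddCommGroup F] [NormedSpace ℝ F] {f : E → F} {U : Set E},
    IsOpen U → ContDiffOn ℝ n f U → IsCk n f U
  | 0, _, _, _, _, _, _, _, _, _, h => h.continuousOn
  | n + 1, E, _, _, _, _, _, f, U, hU, h => by
      have h' := (contDiffOn_succ_iff_fderiv_of_isOpen (n := n) hU).1 (by exact_mod_cast h)
      have key : ∀ x ∈ U, ∀ v, HasDirDeriv f x v (fderiv ℝ f x v) := fun x hx v =>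
        hasLineDerivAt_iff_tendsto_slope_zero.1
          ((h'.1.differentiableAt (hU.mem_nhds hx)).hasFDerivAt.hasLineDerivAt v)
      refine ⟨h.continuousOn, fun x hx v => ?_, ?_⟩
      · rw [(key x hx v).dirDeriv_eq]; exact key x hx v
      · have h3 : ContDiffOn ℝ n (fun p : E × E => fderiv ℝ f p.1 p.2) (U ×ˢ univ) :=
          (h'.2.2.comp contDiff_fst.contDiffOn fun p hp => hp.1).clm_apply contDiff_snd.contDiffOn
        exact (isCk_of_contDiffOn (hU.prod isOpen_univ) h3).congr (hU.prod isOpen_univ)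
          fun p hp => (key p.1 hp.1 p.2).dirDeriv_eq.symm

theorem isSmoothOn_of_contDiffOn {E : Type u} [NormedAddCommGroup E] [NormedSpace ℝ E]
    {F : Type v} [NormedAddCommGroup F] [NormedSpace ℝ F] {f : E → F} {U : Set E}
    (hU : IsOpen U) (h : ContDiffOn ℝ (⊤ : ℕ∞) f U) : IsSmoothOn f U := fun n =>
  isCk_of_contDiffOn hU (h.of_le (by exact_mod_cast le_top))

theorem HasDirDeriv.smul {E : Type u} [AddCommGroup E] [Module ℝ E]
    {F : Type v} [AddCommGroup F] [Module ℝ F] [TopologicalSpace F] [ContinuousSMul ℝ F]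
    {f : E → F} {x v : E} {w : F} (h : HasDirDeriv f x v w) (c : ℝ) :
    HasDirDeriv f x (c • v) (c • w) := by
  rcases eq_or_ne c 0 with rfl | hc
  · simp only [HasDirDeriv, zero_smul, smul_zero, add_zero, sub_self]
    exact tendsto_const_nhds
  · have h1 : Tendsto (fun t : ℝ => t * c) (𝓝[≠] 0) (𝓝[≠] 0) := by
      refine tendsto_nhdsWithin_iff.2 ⟨?_, ?_⟩
      · have : Continuous fun t : ℝ => t * c := by fun_prop
        exact (this.tendsto' 0 0 (by simp)).mono_left nhdsWithin_le_nhds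
      · filter_upwards [self_mem_nhdsWithin] with t ht
        exact mul_ne_zero ht hc
    refine ((Tendsto.comp h h1).const_smul c).congr' ?_
    filter_upwards [self_mem_nhdsWithin] with t ht
    have ht' : t ≠ 0 := ht
    simp only [Function.comp_apply, smul_smul]
    congr 1
    field_simp

/-- The directional derivatives of a `C^1` map are additive in the direction: the second of the two
increments that make up the increment in the direction `v + w` is taken at a moving base point, and
is controlled by the mean value theorem. -/
theorem HasDirDeriv.add {E : Type u} [AddCommGroup E] [Module ℝ E] [TopologicalSpace E]
    [IsTopologicalAddGroup E] [ContinuousSMul ℝ E]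
    {F : Type v} [AddCommGroup F] [Module ℝ F] [TopologicalSpace F] [IsTopologicalAddGroup F]
    [ContinuousSMul ℝ F] [LocallyConvexSpace ℝ F]
    {f : E → F} {U : Set E} (hU : IsOpen U) (hf : IsCk 1 f U) {x : E} (hx : x ∈ U) (v w : E) :
    HasDirDeriv f x (v + w) (dirDeriv f x v + dirDeriv f x w) := by
  have hmain : Tendsto (fun t : ℝ => t⁻¹ • (f (x + t • v + t • w) - f (x + t • v))) (𝓝[≠] 0)
      (𝓝 (dirDeriv f x w)) := by
    intro N hN
    obtain ⟨K, ⟨hK, hKc⟩, hKN⟩ := (closed_nhds_basis (dirDeriv f x w)).mem_iff.1 hN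
    obtain ⟨S, ⟨hS, hSc⟩, hSK⟩ :=
      (LocallyConvexSpace.convex_basis (𝕜 := ℝ) (dirDeriv f x w)).mem_iff.1 hK
    have hSN : closure S ⊆ N := (closure_minimal hSK hKc).trans hKN
    have hc : ContinuousAt (fun y => dirDeriv f y w) x := by
      have h1 : ContinuousAt (fun p : E × E => dirDeriv f p.1 p.2) (x, w) :=
        hf.2.2.continuousOn.continuousAt ((hU.prod isOpen_univ).mem_nhds ⟨hx, mem_univ _⟩)
      exact ContinuousAt.comp (f := fun y : E => (y, w)) h1 (by fun_prop)
    have h1 : ∀ᶠ y in 𝓝 x, y ∈ U ∧ dirDeriv f y w ∈ closure S :=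
      Filter.Eventually.and (hU.mem_nhds hx)
        (hc.eventually (mem_of_superset hS subset_closure))
    have h2 : ∀ᶠ t : ℝ in 𝓝 0, ∀ s ∈ Icc (0 : ℝ) 1, (x + t • v) + s • t • w ∈ U ∧
        dirDeriv f ((x + t • v) + s • t • w) w ∈ closure S := by
      refine isCompact_Icc.eventually_forall_of_forall_eventually fun s _ => ?_
      have : Continuous fun p : ℝ × ℝ => (x + p.1 • v) + p.2 • p.1 • w := by fun_prop
      exact (this.tendsto' (0, s) x (by simp)).eventually h1
    show ∀ᶠ t : ℝ in 𝓝[≠] 0, t⁻¹ • (f (x + t • v + t • w) - f (x + t • v)) ∈ N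
    filter_upwards [nhdsWithin_le_nhds h2, self_mem_nhdsWithin] with t ht ht0
    exact hSN (mean_value (dg := fun y => dirDeriv f y w) ht0
      (fun s hs => hf.2.1 _ (ht s hs).1 w) hSc.closure isClosed_closure fun s hs => (ht s hs).2)
  refine (Tendsto.add (hf.2.1 x hx v) hmain).congr fun t => ?_
  rw [← smul_add, smul_add t v w, ← add_assoc]
  congr 1
  abel

theorem dirDeriv_smul {E : Type u} [AddCommGroup E] [Module ℝ E] [TopologicalSpace E]
    {F : Type v} [AddCommGroup F] [Module ℝ F] [TopologicalSpace F] [ContinuousSMul ℝ F] [T2Space F]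
    {f : E → F} {U : Set E} (hf : IsCk 1 f U) {x : E} (hx : x ∈ U) (c : ℝ) (v : E) :
    dirDeriv f x (c • v) = c • dirDeriv f x v :=
  ((hf.2.1 x hx v).smul c).dirDeriv_eq

theorem dirDeriv_add {E : Type u} [AddCommGroup E] [Module ℝ E] [TopologicalSpace E]
    [IsTopologicalAddGroup E] [ContinuousSMul ℝ E]
    {F : Type v} [AddCommGroup F] [Module ℝ F] [TopologicalSpace F] [IsTopologicalAddGroup F]
    [ContinuousSMul ℝ F] [LocallyConvexSpace ℝ F] [T2Space F]
    {f : E → F} {U : Set E} (hU : IsOpen U) (hf : IsCk 1 f U) {x : E} (hx : x ∈ U) (v w : E) :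
    dirDeriv f x (v + w) = dirDeriv f x v + dirDeriv f x w :=
  (HasDirDeriv.add hU hf hx v w).dirDeriv_eq

theorem hasDirDeriv_real_iff {F : Type v} [NormedAddCommGroup F] [NormedSpace ℝ F] {f : ℝ → F}
    {t : ℝ} {w : F} : HasDirDeriv f t 1 w ↔ HasDerivAt f w t := by
  rw [hasDerivAt_iff_tendsto_slope_zero]
  simp [HasDirDeriv]

theorem HasDirDeriv.hasDerivAt_line {E : Type u} [AddCommGroup E] [Module ℝ E]
    {F : Type v} [NormedAddCommGroup F] [NormedSpace ℝ F] {f : E → F} {x v : E} {s : ℝ} {w : F}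
    (h : HasDirDeriv f (x + s • v) v w) : HasDerivAt (fun s : ℝ => f (x + s • v)) w s := by
  rw [hasDerivAt_iff_tendsto_slope_zero]
  refine Tendsto.congr (fun t => ?_) h
  rw [add_smul, add_assoc]

theorem continuousOn_parametric_integral {Z : Type u} [TopologicalSpace Z] {h : Z × ℝ → ℝ}
    {O : Set Z} (hO : IsOpen O) (hh : ContinuousOn h (O ×ˢ univ)) :
    ContinuousOn (fun z => ∫ t in (0 : ℝ)..1, h (z, t)) O := by
  intro z hz
  refine ContinuousAt.continuousWithinAt ?_
  rw [ContinuousAt, Metric.tendsto_nhds]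
  intro ε hε
  have hint : ∀ z ∈ O, IntervalIntegrable (fun t => h (z, t)) volume 0 1 := fun z hz =>
    (hh.comp_continuous (f := fun t : ℝ => (z, t)) (by fun_prop)
      fun t => ⟨hz, mem_univ _⟩).intervalIntegrable _ _
  have h1 : ∀ᶠ z' in 𝓝 z, ∀ t ∈ Icc (0 : ℝ) 1, ‖h (z', t) - h (z, t)‖ < ε / 2 := by
    refine isCompact_Icc.eventually_forall_of_forall_eventually fun t _ => ?_
    have c1 : ContinuousAt h (z, t) :=
      hh.continuousAt ((hO.prod isOpen_univ).mem_nhds ⟨hz, mem_univ _⟩)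
    have c2 : ContinuousAt (fun p : Z × ℝ => h (z, p.2)) (z, t) :=
      ContinuousAt.comp (f := fun p : Z × ℝ => (z, p.2)) c1 (by fun_prop)
    have c3 : Tendsto (fun p : Z × ℝ => ‖h p - h (z, p.2)‖) (𝓝 (z, t)) (𝓝 0) := by
      simpa using (c1.sub c2).norm.tendsto
    exact c3.eventually (gt_mem_nhds (half_pos hε))
  filter_upwards [h1, hO.mem_nhds hz] with z' hz' hz'O
  rw [dist_eq_norm, ← intervalIntegral.integral_sub (hint z' hz'O) (hint z hz)]
  have := intervalIntegral.norm_integral_le_of_norm_le_const (a := 0) (b := 1) (C := ε / 2)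
    (f := fun t => h (z', t) - h (z, t)) fun t ht => by
      rw [uIoc_of_le zero_le_one] at ht
      exact (hz' t (Ioc_subset_Icc_self ht)).le
  refine this.trans_lt ?_
  simp; linarith

/-- Differentiation under the integral sign. -/
theorem hasDirDeriv_parametric_integral {Z : Type u} [AddCommGroup Z] [Module ℝ Z]
    [TopologicalSpace Z] [IsTopologicalAddGroup Z] [ContinuousSMul ℝ Z] {h : Z × ℝ → ℝ}
    {O : Set Z} (hO : IsOpen O) (hh : IsCk 1 h (O ×ˢ univ)) {z : Z} (hz : z ∈ O) (v : Z) :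
    HasDirDeriv (fun z => ∫ t in (0 : ℝ)..1, h (z, t)) z v
      (∫ t in (0 : ℝ)..1, dirDeriv h (z, t) (v, 0)) := by
  have hopen : IsOpen (O ×ˢ (univ : Set ℝ)) := hO.prod isOpen_univ
  have hcont : ∀ z ∈ O, Continuous fun t => h (z, t) := fun z hz =>
    hh.1.comp_continuous (f := fun t : ℝ => (z, t)) (by fun_prop) fun t => ⟨hz, mem_univ _⟩
  have hdc : ContinuousOn (fun p : (Z × ℝ) × Z × ℝ => dirDeriv h p.1 p.2)
    ((O ×ˢ univ) ×ˢ univ) := hh.2.2.continuousOn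
  have hc1 : Continuous fun t : ℝ => dirDeriv h (z, t) (v, 0) :=
    hdc.comp_continuous (f := fun t : ℝ => ((z, t), (v, (0 : ℝ)))) (by fun_prop)
      fun t => ⟨⟨hz, mem_univ _⟩, mem_univ _⟩
  obtain ⟨C, hC⟩ := (isCompact_Icc (a := (0 : ℝ)) (b := 1)).exists_bound_of_continuousOn
    hc1.continuousOn
  have hline : Tendsto (fun s : ℝ => z + s • v) (𝓝 0) (𝓝 z) := by
    have : Continuous fun s : ℝ => z + s • v := by fun_prop
    exact this.tendsto' 0 z (by simp)
  have h1 : ∀ᶠ s : ℝ in 𝓝 0, ∀ t ∈ Icc (0 : ℝ) 1,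
      ‖dirDeriv h (z + s • v, t) (v, 0)‖ < C + 1 := by
    refine isCompact_Icc.eventually_forall_of_forall_eventually fun t ht => ?_
    have c1 : ContinuousAt (fun p : (Z × ℝ) × Z × ℝ => dirDeriv h p.1 p.2)
        ((z + (0 : ℝ) • v, t), (v, 0)) :=
      hdc.continuousAt ((hopen.prod isOpen_univ).mem_nhds
        ⟨⟨by simpa using hz, mem_univ _⟩, mem_univ _⟩)
    have c2 : ContinuousAt (fun p : ℝ × ℝ => dirDeriv h (z + p.1 • v, p.2) (v, 0)) (0, t) :=
      ContinuousAt.comp (g := fun p : (Z × ℝ) × Z × ℝ => dirDeriv h p.1 p.2)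
        (f := fun p : ℝ × ℝ => ((z + p.1 • v, p.2), (v, (0 : ℝ)))) (x := ((0 : ℝ), t)) c1
        (by fun_prop)
    refine c2.norm.eventually (gt_mem_nhds ?_)
    simp only [zero_smul, add_zero]
    linarith [hC t ht]
  have hWn : {s : ℝ | z + s • v ∈ O ∧ ∀ t ∈ Icc (0 : ℝ) 1,
      ‖dirDeriv h (z + s • v, t) (v, 0)‖ < C + 1} ∈ 𝓝 (0 : ℝ) :=
    Filter.Eventually.and (hline.eventually (hO.mem_nhds hz)) h1
  have hI : uIoc (0 : ℝ) 1 ⊆ Icc 0 1 := by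
    rw [uIoc_of_le zero_le_one]; exact Ioc_subset_Icc_self
  have hd : ∀ t s : ℝ, z + s • v ∈ O →
      HasDerivAt (fun s : ℝ => h (z + s • v, t)) (dirDeriv h (z + s • v, t) (v, 0)) s := by
    intro t s hs
    have e : ∀ s : ℝ, ((z, t) : Z × ℝ) + s • (v, (0 : ℝ)) = (z + s • v, t) := by
      intro s; ext <;> simp
    have h2 := hh.2.1 (z + s • v, t) ⟨hs, mem_univ _⟩ (v, 0)
    have h3 := HasDirDeriv.hasDerivAt_line (f := h) (x := (z, t)) (v := (v, 0)) (s := s)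
      (w := dirDeriv h (z + s • v, t) (v, 0)) (by rw [e]; exact h2)
    simpa only [e] using h3
  have hm : AEStronglyMeasurable (fun t : ℝ => dirDeriv h (z + (0 : ℝ) • v, t) (v, 0))
      (volume.restrict (uIoc (0 : ℝ) 1)) := by
    rw [zero_smul, add_zero]; exact hc1.aestronglyMeasurable
  have hi : IntervalIntegrable (fun t : ℝ => h (z + (0 : ℝ) • v, t)) volume 0 1 := by
    rw [zero_smul, add_zero]; exact (hcont z hz).intervalIntegrable _ _
  have hm' : ∀ᶠ s : ℝ in 𝓝 0, AEStronglyMeasurable (fun t : ℝ => h (z + s • v, t))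
      (volume.restrict (uIoc (0 : ℝ) 1)) := by
    filter_upwards [hline.eventually (hO.mem_nhds hz)] with s hs
    exact (hcont _ hs).aestronglyMeasurable
  have hb : ∀ t : ℝ, t ∈ uIoc (0 : ℝ) 1 → ∀ s ∈ {s : ℝ | z + s • v ∈ O ∧ ∀ t ∈ Icc (0 : ℝ) 1,
      ‖dirDeriv h (z + s • v, t) (v, 0)‖ < C + 1},
      ‖dirDeriv h (z + s • v, t) (v, 0)‖ ≤ C + 1 := fun t ht s hs => (hs.2 t (hI ht)).le
  have hd' : ∀ t : ℝ, t ∈ uIoc (0 : ℝ) 1 → ∀ s ∈ {s : ℝ | z + s • v ∈ O ∧ ∀ t ∈ Icc (0 : ℝ) 1,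
      ‖dirDeriv h (z + s • v, t) (v, 0)‖ < C + 1},
      HasDerivAt (fun s : ℝ => h (z + s • v, t)) (dirDeriv h (z + s • v, t) (v, 0)) s :=
    fun t _ s hs => hd t s hs.1
  have hmain := (intervalIntegral.hasDerivAt_integral_of_dominated_loc_of_deriv_le (𝕜 := ℝ)
    (μ := volume) (a := 0) (b := 1) (bound := fun _ => C + 1)
    (F := fun (s : ℝ) t => h (z + s • v, t))
    (F' := fun (s : ℝ) t => dirDeriv h (z + s • v, t) (v, 0)) (x₀ := (0 : ℝ)) hWn hm' hi hm
    (Eventually.of_forall hb) intervalIntegrable_const (Eventually.of_forall hd')).2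
  rw [zero_smul, add_zero] at hmain
  rw [hasDerivAt_iff_tendsto_slope_zero] at hmain
  refine Tendsto.congr (fun t => ?_) hmain
  simp only [zero_add, zero_smul, add_zero]

theorem isCk_parametric_integral : ∀ {n : ℕ} {Z : Type u} [AddCommGroup Z] [Module ℝ Z]
    [TopologicalSpace Z] [IsTopologicalAddGroup Z] [ContinuousSMul ℝ Z] {h : Z × ℝ → ℝ}
    {O : Set Z}, IsOpen O → IsCk n h (O ×ˢ univ) →
      IsCk n (fun z => ∫ t in (0 : ℝ)..1, h (z, t)) O
  | 0, _, _, _, _, _, _, _, _, hO, hh => continuousOn_parametric_integral hO hh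
  | n + 1, Z, _, _, _, _, _, h, O, hO, hh => by
      have hh1 : IsCk 1 h (O ×ˢ univ) := ⟨hh.1, hh.2.1, hh.2.2.continuousOn⟩
      have key : ∀ z ∈ O, ∀ v, HasDirDeriv (fun z => ∫ t in (0 : ℝ)..1, h (z, t)) z v
          (∫ t in (0 : ℝ)..1, dirDeriv h (z, t) (v, 0)) := fun z hz v =>
        hasDirDeriv_parametric_integral hO hh1 hz v
      refine ⟨continuousOn_parametric_integral hO hh.1, fun z hz v => ?_, ?_⟩
      · rw [(key z hz v).dirDeriv_eq]; exact key z hz v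
      · have hopen : IsOpen (O ×ˢ (univ : Set Z)) := hO.prod isOpen_univ
        let L : (Z × Z) × ℝ →L[ℝ] (Z × ℝ) × Z × ℝ :=
          (((ContinuousLinearMap.fst ℝ Z Z).comp (ContinuousLinearMap.fst ℝ (Z × Z) ℝ)).prod
            (ContinuousLinearMap.snd ℝ (Z × Z) ℝ)).prod
          (((ContinuousLinearMap.snd ℝ Z Z).comp (ContinuousLinearMap.fst ℝ (Z × Z) ℝ)).prod 0)
        have h3 := hh.2.2.comp_linear L ((hO.prod isOpen_univ).prod isOpen_univ)
        have h4 := isCk_parametric_integral (h := fun p : (Z × Z) × ℝ =>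
          dirDeriv h (p.1.1, p.2) (p.1.2, 0)) hopen (h3.mono fun p hp =>
            ⟨⟨hp.1.1, mem_univ _⟩, mem_univ _⟩)
        exact h4.congr hopen fun p hp => (key p.1 hp.1 p.2).dirDeriv_eq.symm

theorem IsSmoothOn.comp {E : Type u} [AddCommGroup E] [Module ℝ E]
    [TopologicalSpace E] [IsTopologicalAddGroup E] [ContinuousSMul ℝ E] [T2Space E]
    {F : Type v} [AddCommGroup F] [Module ℝ F] [TopologicalSpace F] [IsTopologicalAddGroup F]
    [ContinuousSMul ℝ F] [T2Space F]
    {H : Type w} [AddCommGroup H] [Module ℝ H] [TopologicalSpace H] [IsTopologicalAddGroup H]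
    [ContinuousSMul ℝ H] [LocallyConvexSpace ℝ H] [T2Space H]
    {g : F → H} {f : E → F} {U : Set E} {V : Set F} (hg : IsSmoothOn g V) (hf : IsSmoothOn f U)
    (hU : IsOpen U) (hV : IsOpen V) (h : MapsTo f U V) : IsSmoothOn (g ∘ f) U := fun n =>
  (hg n).comp (hf n) hU hV h

theorem IsSmoothOn.mono {E : Type u} [AddCommGroup E] [Module ℝ E] [TopologicalSpace E]
    {F : Type v} [AddCommGroup F] [Module ℝ F] [TopologicalSpace F] {f : E → F} {U V : Set E}
    (h : IsSmoothOn f U) (hV : V ⊆ U) : IsSmoothOn f V := fun n => (h n).mono hV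

theorem IsSmoothOn.congr {E : Type u} [AddCommGroup E] [Module ℝ E]
    [TopologicalSpace E] [IsTopologicalAddGroup E] [ContinuousSMul ℝ E]
    {F : Type v} [AddCommGroup F] [Module ℝ F] [TopologicalSpace F]
    {f g : E → F} {U : Set E} (h : IsSmoothOn f U) (hU : IsOpen U) (hfg : EqOn f g U) :
    IsSmoothOn g U := fun n => (h n).congr hU hfg

theorem IsSmoothOn.prodMk {E : Type u} [AddCommGroup E] [Module ℝ E]
    [TopologicalSpace E] [IsTopologicalAddGroup E] [ContinuousSMul ℝ E]
    {F : Type v} [AddCommGroup F] [Module ℝ F] [TopologicalSpace F] [T2Space F]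
    {F' : Type w} [AddCommGroup F'] [Module ℝ F'] [TopologicalSpace F'] [T2Space F']
    {f : E → F} {g : E → F'} {U : Set E} (hU : IsOpen U) (hf : IsSmoothOn f U)
    (hg : IsSmoothOn g U) : IsSmoothOn (fun x => (f x, g x)) U := fun n =>
  IsCk.prodMk hU (hf n) (hg n)

/-- A function of one real variable with a smooth derivative is smooth. -/
theorem isSmoothOn_of_hasDerivAt {g G : ℝ → ℝ} {U : Set ℝ} (hU : IsOpen U)
    (hG : ∀ t ∈ U, HasDerivAt G (g t) t) (hg : IsSmoothOn g U) : IsSmoothOn G U := by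
  have hc : ContinuousOn G U := fun t ht => (hG t ht).continuousAt.continuousWithinAt
  intro n
  cases n with
  | zero => exact hc
  | succ n =>
    have key : ∀ t ∈ U, ∀ v, HasDirDeriv G t v (v * g t) := by
      intro t ht v
      simpa using (hasDirDeriv_real_iff.2 (hG t ht)).smul v
    have hopen : IsOpen (U ×ˢ (univ : Set ℝ)) := hU.prod isOpen_univ
    refine ⟨hc, fun t ht v => ?_, ?_⟩
    · rw [(key t ht v).dirDeriv_eq]; exact key t ht v
    · have h1 : IsCk n (fun p : ℝ × ℝ => g p.1) (U ×ˢ univ) :=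
        ((hg n).comp_linear (ContinuousLinearMap.fst ℝ ℝ ℝ) hU).mono fun p hp => hp.1
      have h2 : IsCk n (fun p : ℝ × ℝ => p.2) (U ×ˢ univ) :=
        isCk_of_contDiffOn hopen contDiff_snd.contDiffOn
      have h3 : IsCk n (fun p : ℝ × ℝ => p.1 * p.2) univ :=
        isCk_of_contDiffOn isOpen_univ (contDiff_fst.mul contDiff_snd).contDiffOn
      exact (h3.comp (IsCk.prodMk hopen h2 h1) hopen isOpen_univ (mapsTo_univ _ _)).congr hopen
        fun p hp => (key p.1 hp.1 p.2).dirDeriv_eq.symm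

theorem hasDerivAt_integral_of_isOpen {g : ℝ → ℝ} {I : Set ℝ} (hI : IsOpen I)
    (hI' : I.OrdConnected) (hg : ContinuousOn g I) {t₀ t : ℝ} (h₀ : t₀ ∈ I) (ht : t ∈ I) :
    HasDerivAt (fun t => ∫ s in t₀..t, g s) (g t) t :=
  intervalIntegral.integral_hasDerivAt_right
    ((hg.mono (hI'.uIcc_subset h₀ ht)).intervalIntegrable)
    (hg.stronglyMeasurableAtFilter hI t ht) (hg.continuousAt (hI.mem_nhds ht))

end CalculusLemmas

/-! ### Smooth maps between manifolds -/

section ManifoldLemmas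

set_option linter.unusedSectionVars false

variable {E : Type*} [AddCommGroup E] [Module ℝ E] [TopologicalSpace E]
  {F : Type*} [AddCommGroup F] [Module ℝ F] [TopologicalSpace F]
  {H : Type*} [AddCommGroup H] [Module ℝ H] [TopologicalSpace H]
  {M : Type*} [TopologicalSpace M] [ChartedSpace E M]
  {N : Type*} [TopologicalSpace N] [ChartedSpace F N]
  {K : Type*} [TopologicalSpace K] [ChartedSpace H K]

theorem inCharts_congr {f g : M → N} {x : M} (h : f =ᶠ[𝓝 x] g) :
    inCharts E F f x =ᶠ[𝓝 (chartAt E x x)] inCharts E F g x := by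
  have h1 : Tendsto (chartAt E x).symm (𝓝 (chartAt E x x)) (𝓝 x) := by
    simpa using ((chartAt E x).continuousAt_symm (mem_chart_target E x)).tendsto
  filter_upwards [h1.eventually h] with y hy
  simp [inCharts, hy, h.self_of_nhds]

theorem isSmoothMapAt_self_iff {f : E → F} {x : E} :
    IsSmoothMapAt E F f x ↔ ∃ W, IsOpen W ∧ x ∈ W ∧ IsSmoothOn f W := by
  refine ⟨fun h => h.2, fun h => ⟨?_, h⟩⟩
  obtain ⟨W, hW, hxW, hf⟩ := h
  exact (hf 0).continuousOn.continuousAt (hW.mem_nhds hxW)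

theorem isSmoothMapOn_self_iff {f : E → F} {U : Set E} (hU : IsOpen U) :
    IsSmoothMapOn E F f U ↔ IsSmoothOn f U :=
  ⟨fun h => isSmoothOn_of_local fun x hx => isSmoothMapAt_self_iff.1 (h x hx),
    fun h _ hx => isSmoothMapAt_self_iff.2 ⟨U, hU, hx, h⟩⟩

/-- On a product of model spaces, the product of the self-charts and the self-chart define the same
smooth maps. -/
theorem isSmoothMapAt_prod_self_iff {f : E × F → K} {x : E × F} :
    IsSmoothMapAt (E × F) H f x ↔
      @IsSmoothMapAt (E × F) _ _ _ H _ _ _ (E × F) _ (chartedSpaceSelf (E × F)) K _ _ f x := by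
  have : (instChartedSpaceProd : ChartedSpace (E × F) (E × F)) = chartedSpaceSelf (E × F) :=
    chartedSpaceSelf_prod
  rw [this]

theorem isSmoothMapAt_fst {x : M × N} [IsTopologicalAddGroup E] [ContinuousSMul ℝ E] [T2Space E]
    [IsTopologicalAddGroup F] [ContinuousSMul ℝ F] :
    IsSmoothMapAt (E × F) E (Prod.fst : M × N → M) x := by
  refine ⟨continuousAt_fst, (chartAt E x.1).target ×ˢ univ,
    (chartAt E x.1).open_target.prod isOpen_univ, ⟨mem_chart_target E x.1, mem_univ _⟩, fun n => ?_⟩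
  refine (isCk_affine n 0 (ContinuousLinearMap.fst ℝ E F) _).congr
    ((chartAt E x.1).open_target.prod isOpen_univ) fun y hy => ?_
  have : (chartAt E x.1) ((chartAt E x.1).symm y.1) = y.1 := (chartAt E x.1).right_inv hy.1
  exact (zero_add y.1).trans this.symm

theorem isSmoothMapAt_snd {x : M × N} [IsTopologicalAddGroup E] [ContinuousSMul ℝ E]
    [IsTopologicalAddGroup F] [ContinuousSMul ℝ F] [T2Space F] :
    IsSmoothMapAt (E × F) F (Prod.snd : M × N → N) x := by
  refine ⟨continuousAt_snd, univ ×ˢ (chartAt F x.2).target,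
    isOpen_univ.prod (chartAt F x.2).open_target, ⟨mem_univ _, mem_chart_target F x.2⟩, fun n => ?_⟩
  refine (isCk_affine n 0 (ContinuousLinearMap.snd ℝ E F) _).congr
    (isOpen_univ.prod (chartAt F x.2).open_target) fun y hy => ?_
  have : (chartAt F x.2) ((chartAt F x.2).symm y.2) = y.2 := (chartAt F x.2).right_inv hy.2
  exact (zero_add y.2).trans this.symm

variable [IsTopologicalAddGroup E] [ContinuousSMul ℝ E]

theorem IsSmoothMapAt.congr {f g : M → N} {x : M} (hf : IsSmoothMapAt E F f x)
    (h : f =ᶠ[𝓝 x] g) : IsSmoothMapAt E F g x := by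
  obtain ⟨hfc, W, hW, hxW, hfW⟩ := hf
  obtain ⟨V, hV, hVo, hxV⟩ := eventually_nhds_iff.1 (inCharts_congr (E := E) (F := F) h)
  exact ⟨hfc.congr h, W ∩ V, hW.inter hVo, ⟨hxW, hxV⟩,
    (hfW.mono inter_subset_left).congr (hW.inter hVo) fun y hy => hV y hy.2⟩

theorem tmap_congr {f g : M → N} {x : M} (h : f =ᶠ[𝓝 x] g) (v : E) :
    tmap E F f x v = tmap E F g x v := dirDeriv_congr (inCharts_congr h) v

theorem IsSmoothMapAt.prodMk [T2Space F] [T2Space H] {f : M → N} {g : M → K} {x : M}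
    (hf : IsSmoothMapAt E F f x) (hg : IsSmoothMapAt E H g x) :
    IsSmoothMapAt E (F × H) (fun x => (f x, g x)) x := by
  obtain ⟨hfc, W, hW, hxW, hfW⟩ := hf
  obtain ⟨hgc, V, hV, hxV, hgV⟩ := hg
  exact ⟨hfc.prodMk hgc, W ∩ V, hW.inter hV, ⟨hxW, hxV⟩,
    (hfW.mono inter_subset_left).prodMk (hW.inter hV) (hgV.mono inter_subset_right)⟩

theorem tmap_prodMk [T2Space F] [T2Space H] {f : M → N} {g : M → K} {x : M}
    (hf : IsSmoothMapAt E F f x) (hg : IsSmoothMapAt E H g x) (v : E) :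
    tmap E (F × H) (fun x => (f x, g x)) x v = (tmap E F f x v, tmap E H g x v) := by
  obtain ⟨-, W, hW, hxW, hfW⟩ := hf
  obtain ⟨-, V, hV, hxV, hgV⟩ := hg
  exact HasDirDeriv.dirDeriv_eq
    (((hfW 1).2.1 _ hxW v).prodMk_nhds ((hgV 1).2.1 _ hxV v))

theorem isSmoothMapAt_const [IsTopologicalAddGroup F] [ContinuousSMul ℝ F] [T2Space F] (c : N)
    {x : M} : IsSmoothMapAt E F (fun _ : M => c) x := by
  refine ⟨continuousAt_const, univ, isOpen_univ, mem_univ _, fun n => ?_⟩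
  have := isCk_affine n (chartAt F c c) (0 : E →L[ℝ] F) univ
  simpa [inCharts, Function.comp_def] using this

theorem isLinearMap_tmap [IsTopologicalAddGroup F] [ContinuousSMul ℝ F] [LocallyConvexSpace ℝ F]
    [T2Space F] {f : M → N} {x : M} (hf : IsSmoothMapAt E F f x) :
    IsLinearMap ℝ (tmap E F f x) := by
  obtain ⟨-, W, hW, hxW, hfW⟩ := hf
  exact ⟨fun v w => dirDeriv_add hW (hfW 1) hxW v w, fun c v => dirDeriv_smul (hfW 1) hxW c v⟩

variable [T2Space E] [IsTopologicalAddGroup F] [ContinuousSMul ℝ F] [LocallyConvexSpace ℝ F]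
  [T2Space F] [IsTopologicalAddGroup H] [ContinuousSMul ℝ H] [LocallyConvexSpace ℝ H] [T2Space H]

/-- The smoothness of a map near a point may be tested in any charts of the atlases. -/
theorem smoothOn_change_charts [LocallyConvexSpace ℝ E] [IsLCManifold E M] [IsLCManifold F N]
    {f : M → N} {x : M}
    (hf : ContinuousAt f x) {e₁ e₂ : OpenPartialHomeomorph M E} {d₁ d₂ : OpenPartialHomeomorph N F}
    (he₁ : e₁ ∈ atlas E M) (he₂ : e₂ ∈ atlas E M) (hd₁ : d₁ ∈ atlas F N) (hd₂ : d₂ ∈ atlas F N)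
    (hx₁ : x ∈ e₁.source) (hx₂ : x ∈ e₂.source) (hy₁ : f x ∈ d₁.source) (hy₂ : f x ∈ d₂.source)
    (h : ∃ W, IsOpen W ∧ e₁ x ∈ W ∧ IsSmoothOn (d₁ ∘ f ∘ e₁.symm) W) :
    ∃ W, IsOpen W ∧ e₂ x ∈ W ∧ IsSmoothOn (d₂ ∘ f ∘ e₂.symm) W := by
  obtain ⟨W, hW, hxW, hfW⟩ := h
  have hD : IsOpen (e₂.target ∩ e₂.symm ⁻¹' e₁.source) :=
    e₂.isOpen_inter_preimage_symm e₁.open_source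
  have hT := IsLCManifold.compatible e₂ he₂ e₁ he₁
  have hD' : IsOpen (d₁.target ∩ d₁.symm ⁻¹' d₂.source) :=
    d₁.isOpen_inter_preimage_symm d₂.open_source
  have hT' := IsLCManifold.compatible d₁ hd₁ d₂ hd₂
  have hA := (hfW 0).continuousOn.isOpen_inter_preimage hW hD'
  have hB := (hT 0).continuousOn.isOpen_inter_preimage hD hA
  have h1 : Tendsto e₂.symm (𝓝 (e₂ x)) (𝓝 x) := by
    simpa [hx₂] using (e₂.continuousAt_symm (e₂.map_source hx₂)).tendsto
  have h2 : ∀ᶠ y in 𝓝 (e₂ x), f (e₂.symm y) ∈ d₁.source :=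
    h1.eventually (hf.eventually (d₁.open_source.mem_nhds hy₁))
  obtain ⟨V, hV, hVo, hxV⟩ := eventually_nhds_iff.1 h2
  have e21 : e₂.symm (e₂ x) = x := e₂.left_inv hx₂
  have e11 : e₁.symm (e₁ x) = x := e₁.left_inv hx₁
  have d11 : d₁.symm (d₁ (f x)) = f x := d₁.left_inv hy₁
  refine ⟨_, hB.inter hVo, ⟨⟨⟨e₂.map_source hx₂, by simpa [e21] using hx₁⟩, ?_, ?_⟩, hxV⟩,
    (((hT'.comp (hfW.mono inter_subset_left) hA hD' fun y hy => hy.2).comp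
      (hT.mono inter_subset_left) hB hA fun y hy => hy.2).mono inter_subset_left).congr
      (hB.inter hVo) fun y hy => ?_⟩
  · simpa [e21] using hxW
  · simpa [e21, e11, d11, d₁.map_source hy₁] using hy₂
  · have h3 : e₁.symm (e₁ (e₂.symm y)) = e₂.symm y := e₁.left_inv hy.1.1.2
    have h4 : d₁.symm (d₁ (f (e₂.symm y))) = f (e₂.symm y) := d₁.left_inv (hV y hy.2)
    simp [h3, h4]

theorem isSmoothMapAt_iff_charts [LocallyConvexSpace ℝ E] [IsLCManifold E M] [IsLCManifold F N]
    {f : M → N} {x : M} {e : OpenPartialHomeomorph M E} {d : OpenPartialHomeomorph N F}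
    (he : e ∈ atlas E M) (hd : d ∈ atlas F N) (hx : x ∈ e.source) (hy : f x ∈ d.source) :
    IsSmoothMapAt E F f x ↔
      ContinuousAt f x ∧ ∃ W, IsOpen W ∧ e x ∈ W ∧ IsSmoothOn (d ∘ f ∘ e.symm) W :=
  and_congr_right fun hc =>
    ⟨smoothOn_change_charts hc (chart_mem_atlas E x) he (chart_mem_atlas F _) hd
        (mem_chart_source E x) hx (mem_chart_source F _) hy,
      smoothOn_change_charts hc he (chart_mem_atlas E x) hd (chart_mem_atlas F _)
        hx (mem_chart_source E x) hy (mem_chart_source F _)⟩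

/-- Smoothness at a point is an open condition. -/
theorem IsSmoothMapAt.eventually [LocallyConvexSpace ℝ E] [IsLCManifold E M] [IsLCManifold F N]
    {f : M → N} {x : M} (hf : IsSmoothMapAt E F f x) : ∀ᶠ y in 𝓝 x, IsSmoothMapAt E F f y := by
  obtain ⟨hfc, W, hW, hxW, hfW⟩ := hf
  have h1 : ∀ᶠ y in 𝓝 x, f y ∈ (chartAt F (f x)).source :=
    hfc.eventually (chart_source_mem_nhds F (f x))
  have h2 : ∀ᶠ y in 𝓝 x, chartAt E x y ∈ W :=
    ((chartAt E x).continuousAt (mem_chart_source E x)).eventually (hW.mem_nhds hxW)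
  filter_upwards [h1.eventually_nhds, h2, chart_source_mem_nhds E x] with y hy1 hy2 hy3
  have hc : ContinuousAt f y := by
    have c1 : ContinuousAt (inCharts E F f x ∘ chartAt E x) y :=
      ((hfW 0).continuousOn.continuousAt (hW.mem_nhds hy2)).comp ((chartAt E x).continuousAt hy3)
    have e1 : (inCharts E F f x ∘ chartAt E x) y = chartAt F (f x) (f y) := by
      simp [inCharts, (chartAt E x).left_inv hy3]
    have c2 : ContinuousAt ((chartAt F (f x)).symm ∘ inCharts E F f x ∘ chartAt E x) y := by
      refine ContinuousAt.comp ?_ c1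
      rw [e1]
      exact (chartAt F (f x)).continuousAt_symm ((chartAt F (f x)).map_source hy1.self_of_nhds)
    refine c2.congr ?_
    filter_upwards [hy1, (chartAt E x).open_source.mem_nhds hy3] with z hz1 hz2
    simp [inCharts, (chartAt E x).left_inv hz2, (chartAt F (f x)).left_inv hz1]
  exact (isSmoothMapAt_iff_charts (chart_mem_atlas E x) (chart_mem_atlas F _) hy3
    hy1.self_of_nhds).2 ⟨hc, W, hW, hy2, hfW⟩

instance instIsLCManifoldSelf : IsLCManifold E E where
  compatible e he e' he' := by
    rw [chartedSpaceSelf_atlas] at he he'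
    subst he he'
    exact isSmoothOn_id _

instance instIsLCManifoldProd [LocallyConvexSpace ℝ E] [IsLCManifold E M] [IsLCManifold F N] :
    IsLCManifold (E × F) (M × N) where
  toT2Space := by
    have := (inferInstance : IsLCManifold E M).toT2Space
    have := (inferInstance : IsLCManifold F N).toT2Space
    infer_instance
  compatible := by
    rintro _ ⟨e₁, he₁, e₂, he₂, rfl⟩ _ ⟨d₁, hd₁, d₂, hd₂, rfl⟩
    have h1 := IsLCManifold.compatible e₁ he₁ d₁ hd₁
    have h2 := IsLCManifold.compatible e₂ he₂ d₂ hd₂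
    have o1 : IsOpen (e₁.target ∩ e₁.symm ⁻¹' d₁.source) :=
      e₁.isOpen_inter_preimage_symm d₁.open_source
    have o2 : IsOpen (e₂.target ∩ e₂.symm ⁻¹' d₂.source) :=
      e₂.isOpen_inter_preimage_symm d₂.open_source
    have s1 := fun n => (h1 n).comp_linear (ContinuousLinearMap.fst ℝ E F) o1
    have s2 := fun n => (h2 n).comp_linear (ContinuousLinearMap.snd ℝ E F) o2
    have o3 := (o1.prod o2)
    refine (IsSmoothOn.prodMk o3 (IsSmoothOn.mono s1 fun p hp => hp.1)
      (IsSmoothOn.mono s2 fun p hp => hp.2)).mono ?_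
    rintro ⟨a, b⟩ ⟨⟨ha, hb⟩, hc, hd⟩
    exact ⟨⟨ha, hc⟩, hb, hd⟩

theorem isSmoothMapAt_chart [LocallyConvexSpace ℝ E] [IsLCManifold E M]
    {e : OpenPartialHomeomorph M E} (he : e ∈ atlas E M) {x : M} (hx : x ∈ e.source) :
    IsSmoothMapAt E E e x := by
  refine (isSmoothMapAt_iff_charts he (chart_mem_atlas E (e x)) hx (mem_chart_source E _)).2
    ⟨e.continuousAt hx, e.target, e.open_target, e.map_source hx,
      (isSmoothOn_id _).congr e.open_target fun y hy => ?_⟩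
  simp [chartAt_self_eq, e.right_inv hy]

theorem isSmoothMapAt_chart_symm [LocallyConvexSpace ℝ E] [IsLCManifold E M]
    {e : OpenPartialHomeomorph M E} (he : e ∈ atlas E M) {y : E} (hy : y ∈ e.target) :
    IsSmoothMapAt E E e.symm y := by
  refine (isSmoothMapAt_iff_charts (chart_mem_atlas E y) he (mem_chart_source E _)
    (e.map_target hy)).2
    ⟨e.continuousAt_symm hy, e.target, e.open_target, hy,
      (isSmoothOn_id _).congr e.open_target fun y hy => ?_⟩
  simp [chartAt_self_eq, e.right_inv hy]

/-- A map to a model space is smooth near `x` if it is so in the preferred chart at `x`. -/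
theorem isSmoothMapAt_of_comp_chart_symm [LocallyConvexSpace ℝ E] [IsLCManifold E M] {f : M → F}
    {x : M} {W : Set E} (hW : IsOpen W) (hxW : chartAt E x x ∈ W)
    (hf : IsSmoothOn (f ∘ (chartAt E x).symm) W) : IsSmoothMapAt E F f x := by
  have h1 : IsSmoothMapAt E F (f ∘ (chartAt E x).symm) (chartAt E x x) :=
    isSmoothMapAt_self_iff.2 ⟨W, hW, hxW, hf⟩
  refine (h1.comp (isSmoothMapAt_chart (chart_mem_atlas E x) (mem_chart_source E x))).congr ?_
  filter_upwards [chart_source_mem_nhds E x] with y hy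
  simp [(chartAt E x).left_inv hy]

theorem IsSmoothMapAt.comp₂ {F' : Type*} [AddCommGroup F'] [Module ℝ F'] [TopologicalSpace F']
    [IsTopologicalAddGroup F'] [ContinuousSMul ℝ F'] [LocallyConvexSpace ℝ F'] [T2Space F']
    {f : M → F} {g : M → F'} {x : M} {φ : F × F' → H} (hφ : IsSmoothOn φ univ)
    (hf : IsSmoothMapAt E F f x) (hg : IsSmoothMapAt E F' g x) :
    IsSmoothMapAt E H (fun x => φ (f x, g x)) x :=
  IsSmoothMapAt.comp (g := φ) (isSmoothMapAt_prod_self_iff.2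
    (isSmoothMapAt_self_iff.2 ⟨univ, isOpen_univ, mem_univ _, hφ⟩)) (hf.prodMk hg)

theorem isSmoothMapAt_clm (L : E →L[ℝ] F) (x : E) : IsSmoothMapAt E F L x := by
  have := isSmoothMap_affine (0 : F) L x
  simpa using this

end ManifoldLemmas

/-! ### Smooth real-valued functions -/

section RealFunctions

set_option linter.unusedSectionVars false

variable {E : Type*} [AddCommGroup E] [Module ℝ E] [TopologicalSpace E]
  [IsTopologicalAddGroup E] [ContinuousSMul ℝ E] [T2Space E]
  {M : Type*} [TopologicalSpace M] [ChartedSpace E M]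

theorem IsSmoothMapAt.add {f g : M → ℝ} {x : M} (hf : IsSmoothMapAt E ℝ f x)
    (hg : IsSmoothMapAt E ℝ g x) : IsSmoothMapAt E ℝ (fun x => f x + g x) x :=
  hf.comp₂ (φ := fun p : ℝ × ℝ => p.1 + p.2) (isSmoothOn_of_contDiffOn isOpen_univ
    (contDiff_fst.add contDiff_snd).contDiffOn) hg

theorem IsSmoothMapAt.sub {f g : M → ℝ} {x : M} (hf : IsSmoothMapAt E ℝ f x)
    (hg : IsSmoothMapAt E ℝ g x) : IsSmoothMapAt E ℝ (fun x => f x - g x) x :=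
  hf.comp₂ (φ := fun p : ℝ × ℝ => p.1 - p.2) (isSmoothOn_of_contDiffOn isOpen_univ
    (contDiff_fst.sub contDiff_snd).contDiffOn) hg

theorem isSmoothMap_of_contDiff {f : ℝ → ℝ} (hf : ContDiff ℝ (⊤ : ℕ∞) f) : IsSmoothMap ℝ ℝ f :=
  fun _ => isSmoothMapAt_self_iff.2 ⟨univ, isOpen_univ, mem_univ _,
    isSmoothOn_of_contDiffOn isOpen_univ hf.contDiffOn⟩

theorem IsSmoothMapAt.neg {f : M → ℝ} {x : M} (hf : IsSmoothMapAt E ℝ f x) :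
    IsSmoothMapAt E ℝ (fun x => - f x) x :=
  IsSmoothMapAt.comp (g := fun t : ℝ => -t) (isSmoothMap_of_contDiff contDiff_neg _) hf

theorem tmap_real_eq_deriv {f : ℝ → ℝ} {t w : ℝ} (h : HasDerivAt f w t) : tmap ℝ ℝ f t 1 = w :=
  (hasDirDeriv_real_iff.2 h).dirDeriv_eq

theorem IsSmoothMapAt.hasDerivAt {f : ℝ → ℝ} {t : ℝ} (h : IsSmoothMapAt ℝ ℝ f t) :
    HasDerivAt f (tmap ℝ ℝ f t 1) t := by
  obtain ⟨W, hW, hxW, hf⟩ := isSmoothMapAt_self_iff.1 h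
  exact hasDirDeriv_real_iff.1 ((hf 1).2.1 t hxW 1)

end RealFunctions

/-! ### The circle group as a manifold -/

section CircleGroup

set_option linter.unusedSectionVars false

open scoped Manifold ContDiff

/-- Analytic maps of Mathlib manifolds are smooth in the sense of Michal and Bastiani. -/
theorem isSmoothMapAt_of_contMDiffAt {E : Type*} [NormedAddCommGroup E] [NormedSpace ℝ E]
    {F : Type*} [NormedAddCommGroup F] [NormedSpace ℝ F]
    {M : Type*} [TopologicalSpace M] [ChartedSpace E M]
    {N : Type*} [TopologicalSpace N] [ChartedSpace F N] {f : M → N} {x : M}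
    (h : ContMDiffAt 𝓘(ℝ, E) 𝓘(ℝ, F) ω f x) : IsSmoothMapAt E F f x := by
  rw [contMDiffAt_iff] at h
  obtain ⟨hc, h⟩ := h
  simp only [extChartAt, mfld_simps] at h
  rw [contDiffWithinAt_univ] at h
  obtain ⟨W, hW, hWo, hxW⟩ := eventually_nhds_iff.1 (h.eventually (by simp))
  refine ⟨hc, W, hWo, hxW, isSmoothOn_of_contDiffOn hWo fun y hy => ?_⟩
  exact ((hW y hy).of_le le_top).contDiffWithinAt

instance instIsLCManifoldCircle : IsLCManifold Line Circle where
  compatible e he e' he' := by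
    have h := (contDiffGroupoid ω (𝓡 1)).compatible he he'
    rw [contDiffGroupoid, mem_groupoid_of_pregroupoid] at h
    have h1 := h.1
    simp only [contDiffPregroupoid, mfld_simps] at h1
    exact isSmoothOn_of_contDiffOn (e.isOpen_inter_preimage_symm e'.open_source)
      (h1.of_le le_top)

theorem isSmoothMap_circleExp : IsSmoothMap ℝ Line (fun t : ℝ => Circle.exp (2 * Real.pi * t)) :=
  fun _ => IsSmoothMapAt.comp (g := fun t : ℝ => Circle.exp t)
    (isSmoothMapAt_of_contMDiffAt (contMDiff_circleExp _))
    (isSmoothMap_of_contDiff (contDiff_const.mul contDiff_id) _)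

/-- The inverse `ℝ/ℤ ← 𝕋` of `t ↦ exp(2πit)` has smooth real-valued branches near every point. -/
theorem exists_circleLog (z₀ : Circle) : ∃ κ : Circle → ℝ, IsSmoothMapAt Line ℝ κ z₀ ∧
    ∀ z, Circle.exp (2 * Real.pi * κ z) = z := by
  refine ⟨fun z => (Complex.log ((z : ℂ) * ((z₀⁻¹ : Circle) : ℂ))).im / (2 * Real.pi) +
    Complex.arg z₀ / (2 * Real.pi), ?_, fun z => ?_⟩
  · refine IsSmoothMapAt.add ?_ (isSmoothMapAt_const _)
    have := finrank_real_complex_fact'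
    have h1 : ContMDiffAt (𝓡 1) 𝓘(ℝ, ℂ) ω (fun z : Circle => (z : ℂ)) z₀ :=
      contMDiff_coe_sphere _
    have h2 : ContDiffAt ℝ ω (fun w : ℂ => (Complex.log (w * ((z₀⁻¹ : Circle) : ℂ))).im /
        (2 * Real.pi)) z₀ := by
      have h3 : ContDiffAt ℝ ω Complex.log ((z₀ : ℂ) * ((z₀⁻¹ : Circle) : ℂ)) := by
        refine (Complex.contDiffAt_log ?_).restrict_scalars ℝ
        rw [← Circle.coe_mul, mul_inv_cancel]
        simp
      have h4 : ContDiffAt ℝ ω (fun w : ℂ => Complex.log (w * ((z₀⁻¹ : Circle) : ℂ))) z₀ :=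
        h3.comp (z₀ : ℂ) (contDiffAt_id.mul contDiffAt_const)
      exact (Complex.imCLM.contDiff.contDiffAt.comp (z₀ : ℂ) h4).div_const _
    exact isSmoothMapAt_of_contMDiffAt (h2.contMDiffAt.comp z₀ h1)
  · have hpi : (2 * Real.pi) ≠ 0 := by positivity
    show Circle.exp (2 * Real.pi * ((Complex.log ((z : ℂ) * ((z₀⁻¹ : Circle) : ℂ))).im /
      (2 * Real.pi) + Complex.arg z₀ / (2 * Real.pi))) = z
    rw [← Circle.coe_mul, Complex.log_im, mul_add, mul_div_cancel₀ _ hpi, mul_div_cancel₀ _ hpi,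
      Circle.exp_add, Circle.exp_arg, Circle.exp_arg, inv_mul_cancel_right]

variable {E : Type*} [AddCommGroup E] [Module ℝ E] [TopologicalSpace E]
  [IsTopologicalAddGroup E] [ContinuousSMul ℝ E] [T2Space E]
  {M : Type*} [TopologicalSpace M] [ChartedSpace E M]

theorem IsSmoothMapAt.circleExp {κ : M → ℝ} {x : M} (h : IsSmoothMapAt E ℝ κ x) :
    IsSmoothMapAt E Line (fun x => Circle.exp (2 * Real.pi * κ x)) x :=
  IsSmoothMapAt.comp (g := fun t : ℝ => Circle.exp (2 * Real.pi * t))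
    (isSmoothMap_circleExp (κ x)) h

theorem IsSmoothMapAt.exists_log {k : M → Circle} {x : M} (h : IsSmoothMapAt E Line k x) :
    ∃ κ : M → ℝ, IsSmoothMapAt E ℝ κ x ∧ ∀ y, Circle.exp (2 * Real.pi * κ y) = k y := by
  obtain ⟨κ, hκ, hexp⟩ := exists_circleLog (k x)
  exact ⟨κ ∘ k, hκ.comp h, fun y => hexp (k y)⟩

theorem IsSmoothMapAt.circle_mul {k l : M → Circle} {x : M} (hk : IsSmoothMapAt E Line k x)
    (hl : IsSmoothMapAt E Line l x) : IsSmoothMapAt E Line (fun x => k x * l x) x := by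
  obtain ⟨κ, hκ, h1⟩ := hk.exists_log
  obtain ⟨μ, hμ, h2⟩ := hl.exists_log
  refine (hκ.add hμ).circleExp.congr (Eventually.of_forall fun y => ?_)
  simp only [mul_add, Circle.exp_add, h1, h2]

theorem IsSmoothMapAt.circle_inv {k : M → Circle} {x : M} (hk : IsSmoothMapAt E Line k x) :
    IsSmoothMapAt E Line (fun x => (k x)⁻¹) x := by
  obtain ⟨κ, hκ, h1⟩ := hk.exists_log
  refine hκ.neg.circleExp.congr (Eventually.of_forall fun y => ?_)
  simp only [mul_neg, Circle.exp_neg, h1]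

theorem IsSmoothMapAt.circle_div {k l : M → Circle} {x : M} (hk : IsSmoothMapAt E Line k x)
    (hl : IsSmoothMapAt E Line l x) : IsSmoothMapAt E Line (fun x => k x / l x) x := by
  simpa only [div_eq_mul_inv] using hk.circle_mul hl.circle_inv

end CircleGroup

/-! ### Pull-backs and integrals of differential forms of degree one -/

section Forms

set_option linter.unusedSectionVars false

variable {V : Type*} [AddCommGroup V] [Module ℝ V] [TopologicalSpace V]
  [IsTopologicalAddGroup V] [ContinuousSMul ℝ V] [LocallyConvexSpace ℝ V] [T2Space V]
  {E : Type*} [AddCommGroup E] [Module ℝ E] [TopologicalSpace E]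
  [IsTopologicalAddGroup E] [ContinuousSMul ℝ E] [LocallyConvexSpace ℝ E] [T2Space E]
  {M : Type*} [TopologicalSpace M] [ChartedSpace E M] [IsLCManifold E M]
  {Z : Type*} [TopologicalSpace Z] [ChartedSpace V Z]

/-- The pull-back of a smooth `1`-form along a smooth map, defined on an open subset of a locally
convex space, is smooth. -/
theorem IsOneForm.isSmoothOn_pullback {α : M → E → ℝ} (hα : IsOneForm α) {Ψ : V → M} {O : Set V}
    (hO : IsOpen O) (hΨ : IsSmoothMapOn V E Ψ O) :
    IsSmoothOn (fun p : V × V => α (Ψ p.1) (tmap V E Ψ p.1 p.2)) (O ×ˢ univ) := by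
  refine isSmoothOn_of_local fun p hp => ?_
  set e := chartAt E (Ψ p.1) with he
  have hcont : ContinuousOn Ψ O := fun x hx => (hΨ x hx).1.continuousWithinAt
  have hW : IsOpen (O ∩ Ψ ⁻¹' e.source) := hcont.isOpen_inter_preimage hO e.open_source
  have hg : IsSmoothOn (e ∘ Ψ) (O ∩ Ψ ⁻¹' e.source) := (isSmoothMapOn_self_iff hW).1 fun x hx =>
    (isSmoothMapAt_chart (chart_mem_atlas E _) hx.2).comp (hΨ x hx.1)
  have hopen := hW.prod (isOpen_univ (X := V))
  refine ⟨_, hopen, ⟨⟨hp.1, mem_chart_source E _⟩, mem_univ _⟩, ?_⟩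
  have h1 : IsSmoothOn (fun q : V × V => (e ∘ Ψ) q.1) ((O ∩ Ψ ⁻¹' e.source) ×ˢ univ) := fun n =>
    ((hg n).comp_linear (ContinuousLinearMap.fst ℝ V V) hW).mono fun q hq => hq.1
  have h2 : IsSmoothOn (fun q : V × V => dirDeriv (e ∘ Ψ) q.1 q.2)
      ((O ∩ Ψ ⁻¹' e.source) ×ˢ univ) := fun n => (hg (n + 1)).2.2
  refine ((hα.2 e (chart_mem_atlas E _)).comp (h1.prodMk hopen h2) hopen
    (e.open_target.prod isOpen_univ) fun q hq => ⟨e.map_source hq.1.2, mem_univ _⟩).congr hopen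
    fun q hq => ?_
  have hq' : Ψ q.1 ∈ e.source := hq.1.2
  have h3 : e.symm ∘ (e ∘ Ψ) =ᶠ[𝓝 q.1] Ψ := by
    filter_upwards [hW.mem_nhds hq.1] with y hy
    exact e.left_inv hy.2
  have h4 : tmap V E Ψ q.1 q.2 = tmap E E e.symm (e (Ψ q.1)) (dirDeriv (e ∘ Ψ) q.1 q.2) := by
    have h5 : IsSmoothMapAt V E (e ∘ Ψ) q.1 := isSmoothMapAt_self_iff.2 ⟨_, hW, hq.1, hg⟩
    have h6 : IsSmoothMapAt E E e.symm ((e ∘ Ψ) q.1) :=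
      isSmoothMapAt_chart_symm (chart_mem_atlas E _) (e.map_source hq')
    rw [← tmap_congr h3]
    exact tmap_comp h6 h5 q.2
  simp only [Function.comp_apply, e.left_inv hq', h4]

/-- The value of a smooth `1`-form on the velocity of the curves `s ↦ Ψ (z, s)` of a smooth family
depends smoothly on `z` (read in a chart `c`) and on time. The variable `p` ranges over a copy `V'`
of `V × ℝ`, with coordinates `a p` and `b p`, and `d` is the unit vector in the direction of time.
With an abstract `V'`, the self-chart is the only charted space structure in sight. -/
theorem IsOneForm.isSmoothOn_velocity [IsLCManifold V Z] {α : M → E → ℝ} (hα : IsOneForm α)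
    {V' : Type*} [AddCommGroup V'] [Module ℝ V'] [TopologicalSpace V']
    [IsTopologicalAddGroup V'] [ContinuousSMul ℝ V'] [LocallyConvexSpace ℝ V'] [T2Space V']
    (a : V' →L[ℝ] V) (b : V' →L[ℝ] ℝ) {d : V'} (had : a d = 0) (hbd : b d = 1)
    {Ψ : Z × ℝ → M} {c : OpenPartialHomeomorph Z V} (hc : c ∈ atlas V Z) {O : Set V}
    (hO : IsOpen O) (hOc : O ⊆ c.target)
    (hΨ : ∀ y ∈ O, ∀ t, IsSmoothMapAt (V × ℝ) E Ψ (c.symm y, t)) :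
    IsSmoothOn (fun p : V' => α (Ψ (c.symm (a p), b p))
      (tmap ℝ E (fun s => Ψ (c.symm (a p), s)) (b p) 1)) (a ⁻¹' O) := by
  have hΨ' : IsSmoothMapOn V' E (fun p => Ψ (c.symm (a p), b p)) (a ⁻¹' O) := fun p hp =>
    IsSmoothMapAt.comp (g := Ψ) (hΨ _ hp _)
      ((IsSmoothMapAt.comp (g := c.symm) (isSmoothMapAt_chart_symm hc (hOc hp))
        (isSmoothMapAt_clm a p)).prodMk (isSmoothMapAt_clm b p))
  have hopen : IsOpen (a ⁻¹' O) := hO.preimage a.continuous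
  have h2 : IsSmoothOn (fun p : V' => (p, d)) (a ⁻¹' O) :=
    (isSmoothOn_id _).prodMk hopen fun n => by
      simpa using isCk_affine n d (0 : V' →L[ℝ] V') _
  refine ((hα.isSmoothOn_pullback hopen hΨ').comp h2 hopen (hopen.prod isOpen_univ)
    fun p hp => ⟨hp, mem_univ _⟩).congr hopen fun p hp => ?_
  have hline : IsSmoothMapAt ℝ V' (fun s : ℝ => (p - b p • d) +
      ContinuousLinearMap.toSpanSingleton ℝ d s) (b p) := isSmoothMap_affine _ _ _
  have hpt : (p - b p • d) + ContinuousLinearMap.toSpanSingleton ℝ d (b p) = p := by simp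
  have hd : tmap ℝ V' (fun s : ℝ => (p - b p • d) +
      ContinuousLinearMap.toSpanSingleton ℝ d s) (b p) 1 = d := by
    refine HasDirDeriv.dirDeriv_eq ?_
    refine tendsto_const_nhds.congr' ?_
    filter_upwards [self_mem_nhdsWithin] with s hs
    have hs' : s ≠ 0 := hs
    have h4 : p - b p • d + (b p • d + s • d) - p = s • d := by abel
    simp [inCharts, chartAt_self_eq, add_smul, h4, hs']
  have h3 := tmap_comp (g := fun p => Ψ (c.symm (a p), b p)) (by rw [hpt]; exact hΨ' p hp) hline 1
  rw [hd, hpt] at h3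
  simp only [Function.comp_apply]
  rw [← h3]
  congr 2
  funext s
  simp [had, hbd]

/-- The integral of a smooth `1`-form along the curves of a smooth family depends smoothly on the
parameter. -/
theorem IsOneForm.isSmoothMapAt_integral [IsLCManifold V Z] {α : M → E → ℝ} (hα : IsOneForm α)
    {Ψ : Z × ℝ → M} {z₀ : Z} (hΨ : ∀ᶠ z in 𝓝 z₀, ∀ t, IsSmoothMapAt (V × ℝ) E Ψ (z, t)) :
    IsSmoothMapAt V ℝ
      (fun z => ∫ t in (0 : ℝ)..1, α (Ψ (z, t)) (tmap ℝ E (fun s => Ψ (z, s)) t 1)) z₀ := by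
  obtain ⟨O, hO, hOo, hzO⟩ := eventually_nhds_iff.1 hΨ
  set c := chartAt V z₀ with hc
  have hW : IsOpen (c.target ∩ c.symm ⁻¹' O) := c.isOpen_inter_preimage_symm hOo
  have h3 := hα.isSmoothOn_velocity (ContinuousLinearMap.fst ℝ V ℝ)
    (ContinuousLinearMap.snd ℝ V ℝ) (d := (0, 1)) rfl rfl (chart_mem_atlas V z₀) hW
    inter_subset_left fun y hy t => hO _ hy.2 t
  have h4 : IsSmoothOn _ (c.target ∩ c.symm ⁻¹' O) := fun n =>
    isCk_parametric_integral hW ((h3 n).mono fun p hp => hp.1)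
  exact isSmoothMapAt_of_comp_chart_symm hW ⟨mem_chart_target V z₀, by
    simpa [← hc, c.left_inv (mem_chart_source V z₀)] using hzO⟩ h4

end Forms

/-! ### Smoothness in arbitrary charts -/

section GeneralCharts

set_option linter.unusedSectionVars false

variable {V : Type*} [AddCommGroup V] [Module ℝ V] [TopologicalSpace V]
  [IsTopologicalAddGroup V] [ContinuousSMul ℝ V] [LocallyConvexSpace ℝ V] [T2Space V]
  {E : Type*} [AddCommGroup E] [Module ℝ E] [TopologicalSpace E]
  [IsTopologicalAddGroup E] [ContinuousSMul ℝ E] [LocallyConvexSpace ℝ E] [T2Space E]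
  {A : Type*} [TopologicalSpace A] [ChartedSpace V A]
  {B : Type*} [TopologicalSpace B] [ChartedSpace E B]

theorem IsSmoothMapOn.isSmoothOn_charts [IsLCManifold V A] [IsLCManifold E B] {T : A → B}
    {W : Set V} (hW : IsOpen W)
    {c : OpenPartialHomeomorph A V} {d : OpenPartialHomeomorph B E} (hc : c ∈ atlas V A)
    (hd : d ∈ atlas E B) (hWc : W ⊆ c.target) (hT : ∀ y ∈ W, IsSmoothMapAt V E T (c.symm y))
    (hTd : ∀ y ∈ W, T (c.symm y) ∈ d.source) : IsSmoothOn (d ∘ T ∘ c.symm) W :=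
  (isSmoothMapOn_self_iff hW).1 fun y hy =>
    IsSmoothMapAt.comp (g := d) (f := T ∘ c.symm) (isSmoothMapAt_chart hd (hTd y hy))
      (IsSmoothMapAt.comp (hT y hy) (isSmoothMapAt_chart_symm hc (hWc hy)))

theorem tmap_const (b : B) (x : A) (v : V) : tmap V E (fun _ : A => b) x v = 0 := by
  refine HasDirDeriv.dirDeriv_eq ?_
  simp only [HasDirDeriv, inCharts, Function.comp_apply, sub_self, smul_zero]
  exact tendsto_const_nhds

end GeneralCharts

/-! ### Principal circle bundles -/

section CircleBundles

set_option linter.unusedSectionVars false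

variable {E : Type*} [AddCommGroup E] [Module ℝ E] [TopologicalSpace E]
  [IsTopologicalAddGroup E] [ContinuousSMul ℝ E] [LocallyConvexSpace ℝ E] [T2Space E]
  {M : Type*} [TopologicalSpace M] [ChartedSpace E M]
  {P : M → Type*} [∀ x, TopologicalSpace (P x)] [TopologicalSpace (TotalSpace Circle P)]
  [FiberBundle Circle P] [∀ x, MulAction Circle (P x)]

@[simp] theorem rot_proj (z : Circle) (p : TotalSpace Circle P) : (rot z p).proj = p.proj := rfl

theorem rot_mul (z w : Circle) (p : TotalSpace Circle P) :
    rot (z * w) p = rot z (rot w p) :=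
  congrArg (TotalSpace.mk p.proj) (mul_smul z w p.2)

@[simp] theorem rot_one (p : TotalSpace Circle P) : rot 1 p = p :=
  congrArg (TotalSpace.mk p.proj) (one_smul Circle p.2)

theorem rot_comm (z w : Circle) (p : TotalSpace Circle P) :
    rot z (rot w p) = rot w (rot z p) := by
  rw [← rot_mul, mul_comm, rot_mul]

/-- The local section of `P → M` which takes the value `1` in the trivialization `e`. -/
noncomputable def unitSection (e : Trivialization Circle (π Circle P)) (x : M) :
    TotalSpace Circle P :=
  e.toOpenPartialHomeomorph.symm (x, 1)

theorem unitSection_proj (e : Trivialization Circle (π Circle P)) {x : M} (hx : x ∈ e.baseSet) :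
    (unitSection e x).proj = x :=
  e.proj_symm_apply' hx

theorem apply_unitSection (e : Trivialization Circle (π Circle P)) {x : M} (hx : x ∈ e.baseSet) :
    e (unitSection e x) = (x, 1) :=
  e.apply_symm_apply' hx

section Smooth

variable (E) [hP : IsSmoothCircleBundle E P]

include hP

theorem trivialization_rot (e : Trivialization Circle (π Circle P)) [MemTrivializationAtlas e]
    (z : Circle) {p : TotalSpace Circle P} (hp : p.proj ∈ e.baseSet) :
    (e (rot z p)).2 = z * (e p).2 :=
  hP.equivariant e p.proj hp z p.2

theorem eq_of_trivialization_eq (e : Trivialization Circle (π Circle P)) {p q : TotalSpace Circle P}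
    (hp : p.proj ∈ e.baseSet) (hpq : p.proj = q.proj) (h : (e p).2 = (e q).2) : p = q := by
  have hp' : p ∈ e.source := e.mem_source.2 hp
  have hq' : q ∈ e.source := e.mem_source.2 (hpq ▸ hp)
  refine e.toOpenPartialHomeomorph.injOn hp' hq' (Prod.ext ?_ h)
  exact (e.coe_fst hp').trans (hpq.trans (e.coe_fst hq').symm)

theorem eq_rot_of_trivialization (e : Trivialization Circle (π Circle P))
    [MemTrivializationAtlas e] {p q : TotalSpace Circle P} (hp : p.proj ∈ e.baseSet)
    (hpq : p.proj = q.proj) : q = rot ((e q).2 / (e p).2) p := by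
  refine eq_of_trivialization_eq E e (hpq ▸ hp) hpq.symm ?_
  rw [trivialization_rot E e _ hp, div_mul_cancel]

theorem eq_rot_unitSection (e : Trivialization Circle (π Circle P))
    [MemTrivializationAtlas e] {p : TotalSpace Circle P} (hp : p.proj ∈ e.baseSet) :
    p = rot (e p).2 (unitSection e p.proj) := by
  have h1 := unitSection_proj e hp
  have := eq_rot_of_trivialization E e (p := unitSection e p.proj) (q := p) (by rwa [h1]) h1
  rwa [apply_unitSection e hp, div_one] at this

theorem exists_eq_rot {p q : TotalSpace Circle P} (hpq : p.proj = q.proj) : ∃ z, q = rot z p :=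
  ⟨_, eq_rot_of_trivialization E (trivializationAt Circle P p.proj)
    (FiberBundle.mem_baseSet_trivializationAt' p.proj) hpq⟩

theorem rot_injective {z w : Circle} {p : TotalSpace Circle P} (h : rot z p = rot w p) :
    z = w := by
  have h1 := FiberBundle.mem_baseSet_trivializationAt' (F := Circle) (E := P) p.proj
  have h2 := trivialization_rot E (trivializationAt Circle P p.proj) z h1
  rw [h, trivialization_rot E (trivializationAt Circle P p.proj) w h1] at h2
  exact (mul_right_cancel h2).symm

/-- The change of trivializations is multiplication by the transition function. -/
theorem trivialization_change (e e' : Trivialization Circle (π Circle P))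
    [MemTrivializationAtlas e] [MemTrivializationAtlas e'] {p : TotalSpace Circle P}
    (hp : p.proj ∈ e.baseSet) (hp' : p.proj ∈ e'.baseSet) :
    (e' p).2 = (e p).2 * (e' (unitSection e p.proj)).2 := by
  conv_lhs => rw [eq_rot_unitSection E e hp]
  exact trivialization_rot E e' _ (by rwa [unitSection_proj e hp])

variable {V : Type*} [AddCommGroup V] [Module ℝ V] [TopologicalSpace V]
  [IsTopologicalAddGroup V] [ContinuousSMul ℝ V] [T2Space V]
  {X : Type*} [TopologicalSpace X] [ChartedSpace V X]

variable {E}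

theorem eventually_mem_baseSet (e : Trivialization Circle (π Circle P))
    {k : X → TotalSpace Circle P} {x : X} (hk : ContinuousAt (fun y => (k y).proj) x)
    (hx : (k x).proj ∈ e.baseSet) : ∀ᶠ y in 𝓝 x, (k y).proj ∈ e.baseSet :=
  hk.eventually (e.open_baseSet.mem_nhds hx)

theorem smoothAt_trivialization_change (e e' : Trivialization Circle (π Circle P))
    [MemTrivializationAtlas e] [MemTrivializationAtlas e'] {k : X → TotalSpace Circle P} {x : X}
    (hx : (k x).proj ∈ e.baseSet) (hx' : (k x).proj ∈ e'.baseSet)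
    (h1 : IsSmoothMapAt V E (fun y => (k y).proj) x)
    (h2 : IsSmoothMapAt V Line (fun y => (e (k y)).2) x) :
    IsSmoothMapAt V Line (fun y => (e' (k y)).2) x := by
  have h3 := IsSmoothMapAt.comp (g := fun b => (e' (unitSection e b)).2)
    (f := fun y => (k y).proj) (hP.smooth_transition e e' _ ⟨hx, hx'⟩) h1
  refine (h2.circle_mul h3).congr ?_
  filter_upwards [eventually_mem_baseSet (E := E) e h1.1 hx,
    eventually_mem_baseSet (E := E) e' h1.1 hx'] with y hy hy'
  exact (trivialization_change E e e' hy hy').symm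

/-- Smoothness of a map to the total space, in terms of its components in a trivialization. -/
theorem smoothAt_totalSpace_iff (e : Trivialization Circle (π Circle P))
    [MemTrivializationAtlas e] {k : X → TotalSpace Circle P} {x : X}
    (hx : (k x).proj ∈ e.baseSet) :
    IsSmoothMapAt V (E × Line) k x ↔ IsSmoothMapAt V E (fun y => (k y).proj) x ∧
      IsSmoothMapAt V Line (fun y => (e (k y)).2) x := by
  set e₀ := trivializationAt Circle P (k x).proj with he₀
  have hx₀ : (k x).proj ∈ e₀.baseSet := FiberBundle.mem_baseSet_trivializationAt' _
  constructor
  · intro hk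
    have hkc : ContinuousAt (fun y => (k y).proj) x :=
      (FiberBundle.continuous_proj Circle P).continuousAt.comp hk.1
    have h0 : IsSmoothMapAt V (E × Line) (e₀ ∘ k) x :=
      ⟨(e₀.continuousAt (e₀.mem_source.2 hx₀)).comp hk.1, hk.2⟩
    have h1 : IsSmoothMapAt V E (fun y => (k y).proj) x := by
      refine (IsSmoothMapAt.comp (g := Prod.fst) isSmoothMapAt_fst h0).congr ?_
      filter_upwards [eventually_mem_baseSet (E := E) e₀ hkc hx₀] with y hy
      exact e₀.coe_fst (e₀.mem_source.2 hy)
    exact ⟨h1, smoothAt_trivialization_change e₀ e hx₀ hx h1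
      (IsSmoothMapAt.comp (g := Prod.snd) isSmoothMapAt_snd h0)⟩
  · rintro ⟨h1, h2⟩
    have h3 := smoothAt_trivialization_change e e₀ hx hx₀ h1 h2
    have h4 : IsSmoothMapAt V (E × Line) (e₀ ∘ k) x := by
      refine (h1.prodMk h3).congr ?_
      filter_upwards [eventually_mem_baseSet (E := E) e₀ h1.1 hx₀] with y hy
      exact Prod.ext (e₀.coe_fst (e₀.mem_source.2 hy)).symm rfl
    refine ⟨?_, h4.2⟩
    have h5 : ContinuousAt (e₀.toOpenPartialHomeomorph.symm ∘ e₀ ∘ k) x :=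
      ContinuousAt.comp (f := e₀ ∘ k) (e₀.toOpenPartialHomeomorph.continuousAt_symm
        (e₀.toOpenPartialHomeomorph.map_source (e₀.mem_source.2 hx₀))) h4.1
    refine h5.congr ?_
    filter_upwards [eventually_mem_baseSet (E := E) e₀ h1.1 hx₀] with y hy
    exact e₀.toOpenPartialHomeomorph.left_inv (e₀.mem_source.2 hy)

theorem IsSmoothMapAt.proj {k : X → TotalSpace Circle P} {x : X}
    (h : IsSmoothMapAt V (E × Line) k x) : IsSmoothMapAt V E (fun y => (k y).proj) x :=
  ((smoothAt_totalSpace_iff (trivializationAt Circle P (k x).proj)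
    (FiberBundle.mem_baseSet_trivializationAt' _)).1 h).1

theorem IsSmoothMapAt.trivialization {k : X → TotalSpace Circle P} {x : X}
    (h : IsSmoothMapAt V (E × Line) k x) (e : Trivialization Circle (π Circle P))
    [MemTrivializationAtlas e] (hx : (k x).proj ∈ e.baseSet) :
    IsSmoothMapAt V Line (fun y => (e (k y)).2) x :=
  ((smoothAt_totalSpace_iff e hx).1 h).2

theorem IsSmoothMapAt.unitSection {f : X → M} {x : X} (h : IsSmoothMapAt V E f x)
    (e : Trivialization Circle (π Circle P)) [MemTrivializationAtlas e] (hx : f x ∈ e.baseSet) :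
    IsSmoothMapAt V (E × Line) (fun y => unitSection e (f y)) x := by
  have hev : ∀ᶠ y in 𝓝 x, f y ∈ e.baseSet := h.1.eventually (e.open_baseSet.mem_nhds hx)
  refine (smoothAt_totalSpace_iff e (by rwa [unitSection_proj e hx])).2 ⟨h.congr ?_,
    (isSmoothMapAt_const 1).congr ?_⟩
  · filter_upwards [hev] with y hy using (unitSection_proj e hy).symm
  · filter_upwards [hev] with y hy
    rw [apply_unitSection e hy]

theorem IsSmoothMapAt.rot {k : X → Circle} {γ : X → TotalSpace Circle P} {x : X}
    (hk : IsSmoothMapAt V Line k x) (hγ : IsSmoothMapAt V (E × Line) γ x) :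
    IsSmoothMapAt V (E × Line) (fun y => rot (k y) (γ y)) x := by
  have hx : (γ x).proj ∈ (trivializationAt Circle P (γ x).proj).baseSet :=
    FiberBundle.mem_baseSet_trivializationAt' _
  refine (smoothAt_totalSpace_iff (k := fun y => LC.rot (k y) (γ y))
    (trivializationAt Circle P (γ x).proj) hx).2 ⟨hγ.proj, ?_⟩
  refine (hk.circle_mul (hγ.trivialization (trivializationAt Circle P (γ x).proj) hx)).congr ?_
  filter_upwards [eventually_mem_baseSet (E := E) _ hγ.proj.1 hx] with y hy
  exact (trivialization_rot E _ _ hy).symm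

theorem isSmoothMap_rot (z : Circle) :
    IsSmoothMap (E × Line) (E × Line) (rot z : TotalSpace Circle P → TotalSpace Circle P) :=
  fun p => (isSmoothMapAt_const z).rot (isSmoothMap_id p)

/-- The difference of two maps to the total space that cover the same map. -/
theorem IsSmoothMapAt.exists_rot {γ₁ γ₂ : X → TotalSpace Circle P} {x : X}
    (h₁ : IsSmoothMapAt V (E × Line) γ₁ x) (h₂ : IsSmoothMapAt V (E × Line) γ₂ x)
    (h : ∀ᶠ y in 𝓝 x, (γ₁ y).proj = (γ₂ y).proj) :
    ∃ k : X → Circle, IsSmoothMapAt V Line k x ∧ ∀ᶠ y in 𝓝 x, γ₂ y = LC.rot (k y) (γ₁ y) := by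
  have hx : (γ₁ x).proj ∈ (trivializationAt Circle P (γ₁ x).proj).baseSet :=
    FiberBundle.mem_baseSet_trivializationAt' _
  refine ⟨_, (h₂.trivialization (trivializationAt Circle P (γ₁ x).proj)
    (h.self_of_nhds ▸ hx)).circle_div (h₁.trivialization _ hx), ?_⟩
  filter_upwards [h, eventually_mem_baseSet (E := E) _ h₁.proj.1 hx] with y hy hy'
  exact eq_rot_of_trivialization E _ hy' hy

variable [hM : IsLCManifold E M]

include hM

/-- The total space of a smooth circle bundle over a manifold is a manifold. -/
theorem isLCManifold_totalSpace : IsLCManifold (E × Line) (TotalSpace Circle P) where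
  toT2Space := by
    have := hM.toT2Space
    refine ⟨fun p q hpq => ?_⟩
    rcases eq_or_ne p.proj q.proj with h | h
    · set e := trivializationAt Circle P p.proj with he
      have hp : p ∈ e.source :=
        e.mem_source.2 (FiberBundle.mem_baseSet_trivializationAt' _)
      have hq : q ∈ e.source := e.mem_source.2 (h ▸ FiberBundle.mem_baseSet_trivializationAt' _)
      have hne : e p ≠ e q := fun h => hpq (e.injOn hp hq h)
      obtain ⟨u, v, hu, hv, hpu, hqv, huv⟩ := t2_separation hne
      exact ⟨e.source ∩ e ⁻¹' u, e.source ∩ e ⁻¹' v,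
        e.continuousOn.isOpen_inter_preimage e.open_source hu,
        e.continuousOn.isOpen_inter_preimage e.open_source hv, ⟨hp, hpu⟩, ⟨hq, hqv⟩,
        (huv.preimage e).mono inter_subset_right inter_subset_right⟩
    · obtain ⟨u, v, hu, hv, hpu, hqv, huv⟩ := t2_separation h
      have hc := FiberBundle.continuous_proj Circle P
      exact ⟨_, _, hu.preimage hc, hv.preimage hc, hpu, hqv, huv.preimage _⟩
  compatible := by
    rintro _ ⟨_, ⟨e, he, rfl⟩, c, hc, rfl⟩ _ ⟨_, ⟨e', he', rfl⟩, c', hc', rfl⟩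
    have : MemTrivializationAtlas e := ⟨he⟩
    have : MemTrivializationAtlas e' := ⟨he'⟩
    refine IsSmoothMapOn.isSmoothOn_charts (T := e' ∘ e.toOpenPartialHomeomorph.symm) (c := c)
      (d := c')
      (OpenPartialHomeomorph.isOpen_inter_preimage_symm _ (OpenPartialHomeomorph.open_source _))
      hc hc' (fun y hy => ?_) (fun y hy => ?_) (fun y hy => ?_)
    · exact hy.1.1
    · have h1 : c.symm y ∈ e.target := hy.1.2
      have h2 : e.toOpenPartialHomeomorph.symm (c.symm y) ∈ e'.source := hy.2.1
      have h3 : (c.symm y).1 ∈ e.baseSet := e.mem_target.1 h1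
      have hs : IsSmoothMapAt (E × Line) (E × Line)
          (fun q : M × Circle => e.toOpenPartialHomeomorph.symm q) (c.symm y) := by
        refine (isSmoothMapAt_snd.rot (isSmoothMapAt_fst.unitSection e h3)).congr ?_
        filter_upwards [e.open_target.mem_nhds h1] with q hq
        have hq1 : q.1 ∈ e.baseSet := e.mem_target.1 hq
        refine eq_of_trivialization_eq E e ?_ ?_ ?_
        · simpa [unitSection_proj e hq1] using hq1
        · simpa [unitSection_proj e hq1] using (e.proj_symm_apply hq).symm
        · rw [trivialization_rot E e _ (by rwa [unitSection_proj e hq1]),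
            apply_unitSection e hq1, e.apply_symm_apply hq, mul_one]
      have h4 : (e.toOpenPartialHomeomorph.symm (c.symm y)).proj ∈ e'.baseSet := e'.mem_source.1 h2
      refine (hs.proj.prodMk (hs.trivialization e' h4)).congr ?_
      filter_upwards [eventually_mem_baseSet (E := E) e' hs.proj.1 h4] with q hq
      exact Prod.ext (e'.coe_fst (e'.mem_source.2 hq)).symm rfl
    · exact hy.2.2

end Smooth

end CircleBundles

/-! ### Horizontal curves -/

section HorizontalCurves

set_option linter.unusedSectionVars false

variable {E : Type*} [AddCommGroup E] [Module ℝ E] [TopologicalSpace E]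
  [IsTopologicalAddGroup E] [ContinuousSMul ℝ E] [LocallyConvexSpace ℝ E] [T2Space E]
  {M : Type*} [TopologicalSpace M] [ChartedSpace E M] [hM : IsLCManifold E M]
  {P : M → Type*} [∀ x, TopologicalSpace (P x)] [TopologicalSpace (TotalSpace Circle P)]
  [FiberBundle Circle P] [∀ x, MulAction Circle (P x)] [hP : IsSmoothCircleBundle E P]

include hM hP

/-- The normalization of a connection form, along a whole orbit. -/
theorem IsConnection.apply_orbit {θ : TotalSpace Circle P → E × Line → ℝ} (hθ : IsConnection E θ)
    (p : TotalSpace Circle P) (s : ℝ) :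
    θ (rot (Circle.exp (2 * Real.pi * s)) p)
      (tmap ℝ (E × Line) (fun t : ℝ => rot (Circle.exp (2 * Real.pi * t)) p) s 1) = 1 := by
  set q := rot (Circle.exp (2 * Real.pi * s)) p with hq
  have a3 : (fun t : ℝ => rot (Circle.exp (2 * Real.pi * t)) p) =
      (fun t : ℝ => rot (Circle.exp (2 * Real.pi * t)) q) ∘ fun t : ℝ => t - s := by
    funext t
    simp only [hq, Function.comp_apply]
    rw [← rot_mul, ← Circle.exp_add]
    congr 2
    show Circle.exp (2 * Real.pi * t) = Circle.exp (2 * Real.pi * (t - s) + 2 * Real.pi * s)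
    congr 1
    ring
  have a4 : IsSmoothMapAt ℝ ℝ (fun t : ℝ => t - s) s :=
    isSmoothMap_of_contDiff (contDiff_id.sub contDiff_const) s
  have a5 : IsSmoothMapAt ℝ (E × Line)
      (fun t : ℝ => rot (Circle.exp (2 * Real.pi * t)) q) (s - s) :=
    (isSmoothMap_circleExp _).rot (isSmoothMapAt_const _)
  have a6 := tmap_comp (f := fun t : ℝ => t - s) a5 a4 1
  rw [a3, a6, tmap_real_eq_deriv ((hasDerivAt_id' s).sub_const s), sub_self]
  exact hθ.normalized q

/-- A principal connection form evaluated on the derivative of a map that is twisted by a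
`𝕋`-valued function `exp(2πiκ)`. -/
theorem IsConnection.apply_rot_exp {V : Type*} [AddCommGroup V] [Module ℝ V] [TopologicalSpace V]
    [IsTopologicalAddGroup V] [ContinuousSMul ℝ V] [LocallyConvexSpace ℝ V] [T2Space V]
    {X : Type*} [TopologicalSpace X] [ChartedSpace V X]
    {θ : TotalSpace Circle P → E × Line → ℝ} (hθ : IsConnection E θ)
    {κ : X → ℝ} {σ : X → TotalSpace Circle P} {x : X} (hκ : IsSmoothMapAt V ℝ κ x)
    (hσ : IsSmoothMapAt V (E × Line) σ x) (v : V) :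
    θ (rot (Circle.exp (2 * Real.pi * κ x)) (σ x))
      (tmap V (E × Line) (fun y => rot (Circle.exp (2 * Real.pi * κ y)) (σ y)) x v) =
      tmap V ℝ κ x v + θ (σ x) (tmap V (E × Line) σ x v) := by
  have hlin := hθ.isOneForm.1
  -- the map is `R ∘ (κ, σ)`; the tangent map of `R` is computed on the two factors separately
  obtain ⟨R, hR⟩ : ∃ R : ℝ × TotalSpace Circle P → TotalSpace Circle P,
    R = fun q => rot (Circle.exp (2 * Real.pi * q.1)) q.2 := ⟨_, rfl⟩
  have hRs : IsSmoothMapAt (ℝ × (E × Line)) (E × Line) R (κ x, σ x) := by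
    rw [hR]
    exact IsSmoothMapAt.rot (IsSmoothMapAt.circleExp isSmoothMapAt_fst) isSmoothMapAt_snd
  have hTR := isLinearMap_tmap hRs
  have h1 : tmap (ℝ × (E × Line)) (E × Line) R (κ x, σ x) (1, 0) =
      tmap ℝ (E × Line) (fun t : ℝ => rot (Circle.exp (2 * Real.pi * t)) (σ x)) (κ x) 1 := by
    have a1 : IsSmoothMapAt ℝ (ℝ × (E × Line)) (fun t : ℝ => (t, σ x)) (κ x) :=
      (isSmoothMap_id _).prodMk (isSmoothMapAt_const _)
    have a2 : tmap ℝ (ℝ × (E × Line)) (fun t : ℝ => (t, σ x)) (κ x) 1 = (1, 0) := by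
      rw [tmap_prodMk (f := fun t : ℝ => t) (isSmoothMap_id _) (isSmoothMapAt_const _),
        tmap_const]
      exact congrArg (fun a => (a, (0 : E × Line))) (tmap_id (κ x) 1)
    rw [← a2, ← tmap_comp (f := fun t : ℝ => (t, σ x)) hRs a1, hR]
    rfl
  have h2 : ∀ w, tmap (ℝ × (E × Line)) (E × Line) R (κ x, σ x) (0, w) =
      tmap (E × Line) (E × Line) (rot (Circle.exp (2 * Real.pi * κ x))) (σ x) w := by
    intro w
    have a1 : IsSmoothMapAt (E × Line) (ℝ × (E × Line))
        (fun q : TotalSpace Circle P => (κ x, q)) (σ x) :=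
      (isSmoothMapAt_const _).prodMk (isSmoothMap_id _)
    have a2 : tmap (E × Line) (ℝ × (E × Line)) (fun q : TotalSpace Circle P => (κ x, q)) (σ x) w =
        (0, w) := by
      rw [tmap_prodMk (g := fun q : TotalSpace Circle P => q) (isSmoothMapAt_const _)
        (isSmoothMap_id _), tmap_const]
      exact congrArg (fun a => ((0 : ℝ), a)) (tmap_id (σ x) w)
    rw [← a2, ← tmap_comp (f := fun q : TotalSpace Circle P => (κ x, q)) hRs a1, hR]
    rfl
  have h3 : IsSmoothMapAt V (ℝ × (E × Line)) (fun y => (κ y, σ y)) x := hκ.prodMk hσ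
  have h4 : tmap V (E × Line) (fun y => rot (Circle.exp (2 * Real.pi * κ y)) (σ y)) x v =
      tmap (ℝ × (E × Line)) (E × Line) R (κ x, σ x)
        (tmap V (ℝ × (E × Line)) (fun y => (κ y, σ y)) x v) := by
    rw [← tmap_comp (f := fun y => (κ y, σ y)) hRs h3, hR]
    rfl
  have h5 : ((tmap V ℝ κ x v, tmap V (E × Line) σ x v) : ℝ × (E × Line)) =
      tmap V ℝ κ x v • ((1, 0) : ℝ × (E × Line)) + (0, tmap V (E × Line) σ x v) := by
    ext <;> simp
  rw [h4, tmap_prodMk hκ hσ, h5, hTR.map_add, hTR.map_smul, h1, h2, (hlin _).map_add,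
    (hlin _).map_smul, hθ.apply_orbit, hθ.invariant, smul_eq_mul, mul_one]

omit hM hP in
/-- The curve `γ` is smooth near `t` and its velocity at `t` is horizontal. -/
def IsHorizontalAt (θ : TotalSpace Circle P → E × Line → ℝ) (γ : ℝ → TotalSpace Circle P)
    (t : ℝ) : Prop :=
  IsSmoothMapAt ℝ (E × Line) γ t ∧ θ (γ t) (tmap ℝ (E × Line) γ t 1) = 0

variable {θ : TotalSpace Circle P → E × Line → ℝ}

omit hM hP in
theorem IsHorizontalAt.congr {γ γ' : ℝ → TotalSpace Circle P} {t : ℝ} (h : IsHorizontalAt θ γ t)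
    (hγ : γ =ᶠ[𝓝 t] γ') : IsHorizontalAt θ γ' t := by
  refine ⟨h.1.congr hγ, ?_⟩
  rw [← tmap_congr hγ, ← hγ.self_of_nhds]
  exact h.2

theorem IsHorizontalAt.rot (hθ : IsConnection E θ) {γ : ℝ → TotalSpace Circle P} {t : ℝ}
    (h : IsHorizontalAt θ γ t) (z : Circle) : IsHorizontalAt θ (fun s => rot z (γ s)) t := by
  refine ⟨(isSmoothMapAt_const z).rot h.1, ?_⟩
  have := tmap_comp (g := LC.rot z) (isSmoothMap_rot z (γ t)) h.1 1
  rw [Function.comp_def] at this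
  rw [this, hθ.invariant, h.2]

/-- Horizontal lifts of a curve that stays in the domain of a trivialization are given by an
explicit integral. -/
theorem IsConnection.isHorizontalAt_integral (hθ : IsConnection E θ)
    (e : Trivialization Circle (π Circle P)) [MemTrivializationAtlas e] {f : ℝ → M} {I : Set ℝ}
    (hI : IsOpen I) (hI' : I.OrdConnected) (hf : IsSmoothMapOn ℝ E f I)
    (hfe : ∀ t ∈ I, f t ∈ e.baseSet) {t₀ : ℝ} (ht₀ : t₀ ∈ I) (κ₀ : ℝ) {t : ℝ} (ht : t ∈ I) :
    IsHorizontalAt θ (fun t => LC.rot (Circle.exp (2 * Real.pi * (κ₀ - ∫ s in t₀..t,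
      θ (unitSection e (f s)) (tmap ℝ (E × Line) (fun r => unitSection e (f r)) s 1))))
        (unitSection e (f t))) t := by
  have hL := isLCManifold_totalSpace (E := E) (P := P)
  have hu : IsSmoothMapOn ℝ (E × Line) (fun r => unitSection e (f r)) I := fun t ht =>
    (hf t ht).unitSection e (hfe t ht)
  have ha : IsSmoothOn (fun s => θ (unitSection e (f s))
      (tmap ℝ (E × Line) (fun r => unitSection e (f r)) s 1)) I := by
    have h2 : IsSmoothOn (fun t : ℝ => (t, (1 : ℝ))) I := (isSmoothOn_id _).prodMk hI fun n => by
      simpa using isCk_affine n (1 : ℝ) (0 : ℝ →L[ℝ] ℝ) _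
    exact (hθ.isOneForm.isSmoothOn_pullback hI hu).comp h2 hI (hI.prod isOpen_univ)
      fun t ht => ⟨ht, mem_univ _⟩
  have hd := fun t (ht : t ∈ I) =>
    (hasDerivAt_integral_of_isOpen hI hI' (ha 0).continuousOn ht₀ ht).const_sub κ₀
  have hneg : IsSmoothOn (fun s => - θ (unitSection e (f s))
      (tmap ℝ (E × Line) (fun r => unitSection e (f r)) s 1)) I :=
    IsSmoothOn.comp (g := fun t : ℝ => -t) (isSmoothOn_of_contDiffOn isOpen_univ
      contDiff_neg.contDiffOn) ha hI isOpen_univ (mapsTo_univ _ _)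
  have hκ := (isSmoothMapOn_self_iff hI).2 (isSmoothOn_of_hasDerivAt hI hd hneg)
  refine ⟨(hκ t ht).circleExp.rot (hu t ht), ?_⟩
  rw [hθ.apply_rot_exp (hκ t ht) (hu t ht), tmap_real_eq_deriv (hd t ht)]
  exact neg_add_cancel _

/-- Two horizontal curves with the same projection differ by a constant. -/
theorem IsConnection.eq_rot_of_isHorizontalAt (hθ : IsConnection E θ)
    {γ₁ γ₂ : ℝ → TotalSpace Circle P} {I : Set ℝ} (hI : IsOpen I) (hI' : IsPreconnected I)
    (h₁ : ∀ t ∈ I, IsHorizontalAt θ γ₁ t) (h₂ : ∀ t ∈ I, IsHorizontalAt θ γ₂ t)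
    (h : ∀ t ∈ I, (γ₁ t).proj = (γ₂ t).proj) {s t : ℝ} (hs : s ∈ I) (ht : t ∈ I) {z : Circle}
    (hz : γ₂ s = rot z (γ₁ s)) : γ₂ t = rot z (γ₁ t) := by
  refine hI'.induction₂ (fun s t => ∀ z, γ₂ s = LC.rot z (γ₁ s) → γ₂ t = LC.rot z (γ₁ t))
    (fun s hs => ?_) (fun a b c _ _ _ hab hbc z hz => hbc z (hab z hz))
    (fun a b ha _ hab z hz => ?_) hs ht z hz
  · obtain ⟨k, hk, hk'⟩ := (h₁ s hs).1.exists_rot (h₂ s hs).1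
      (eventually_of_mem (hI.mem_nhds hs) h)
    obtain ⟨κ, hκ, hexp⟩ := hk.exists_log
    obtain ⟨ε, hε, hball⟩ := Metric.eventually_nhds_iff_ball.1
      ((hκ.eventually.and hk'.eventually_nhds).and (hI.mem_nhds hs))
    have hder : ∀ t ∈ Metric.ball s ε, HasDerivAt κ 0 t := by
      intro t ht
      obtain ⟨⟨b1, b2⟩, b3⟩ := hball t ht
      have b4 : (fun t => LC.rot (Circle.exp (2 * Real.pi * κ t)) (γ₁ t)) =ᶠ[𝓝 t] γ₂ := by
        filter_upwards [b2] with r hr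
        rw [hexp, hr]
      have b5 := hθ.apply_rot_exp b1 (h₁ t b3).1 1
      rw [tmap_congr b4, (h₁ t b3).2, add_zero] at b5
      have b6 : LC.rot (Circle.exp (2 * Real.pi * κ t)) (γ₁ t) = γ₂ t := b4.self_of_nhds
      rw [b6, (h₂ t b3).2] at b5
      rw [b5]
      exact b1.hasDerivAt
    refine nhdsWithin_le_nhds (mem_of_superset (Metric.ball_mem_nhds s hε) fun t ht z hz => ?_)
    have hκt : κ t = κ s := Metric.isOpen_ball.is_const_of_deriv_eq_zero
      (convex_ball s ε).isPreconnected
      (fun r hr => (hder r hr).differentiableAt.differentiableWithinAt)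
      (fun r hr => (hder r hr).deriv) ht (Metric.mem_ball_self hε)
    have hzk : z = k s := rot_injective E (hz.symm.trans hk'.self_of_nhds)
    show γ₂ t = LC.rot z (γ₁ t)
    rw [hzk, ← hexp s, ← hκt, hexp t]
    exact (hball t ht).1.2.self_of_nhds
  · obtain ⟨w, hw⟩ := exists_eq_rot E (h a ha)
    have := hab w hw
    rw [hz] at this
    rwa [rot_injective E this]

/-- Smooth curves in the base have horizontal lifts. -/
theorem IsConnection.exists_horizontal_lift (hθ : IsConnection E θ) {f : ℝ → M}
    (hf : IsSmoothMap ℝ E f) {p : TotalSpace Circle P} (hp : p.proj = f 0) :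
    ∃ γ : ℝ → TotalSpace Circle P, (∀ t, IsHorizontalAt θ γ t) ∧ (∀ t, (γ t).proj = f t) ∧
      γ 0 = p := by
  -- lifts exist locally, and lifts over overlapping intervals are glued after a rotation
  have key : ∀ s t : ℝ, ∃ I : Set ℝ, IsOpen I ∧ I.OrdConnected ∧ s ∈ I ∧ t ∈ I ∧
      ∃ γ : ℝ → TotalSpace Circle P, ∀ r ∈ I, IsHorizontalAt θ γ r ∧ (γ r).proj = f r := by
    intro s t
    refine isPreconnected_univ.induction₂ (fun s t : ℝ => ∃ I : Set ℝ, IsOpen I ∧ I.OrdConnected ∧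
      s ∈ I ∧ t ∈ I ∧
      ∃ γ : ℝ → TotalSpace Circle P, ∀ r ∈ I, IsHorizontalAt θ γ r ∧ (γ r).proj = f r)
      (fun s _ => ?_) (fun a b c _ _ _ hab hbc => ?_) (fun a b _ _ hab => ?_)
      (mem_univ s) (mem_univ t)
    · have hmem : f s ∈ (trivializationAt Circle P (f s)).baseSet :=
        FiberBundle.mem_baseSet_trivializationAt' _
      obtain ⟨ε, hε, hball⟩ := Metric.eventually_nhds_iff_ball.1
        (hf.continuous.continuousAt.eventually
        ((trivializationAt Circle P (f s)).open_baseSet.mem_nhds hmem))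
      refine nhdsWithin_le_nhds (mem_of_superset (Metric.ball_mem_nhds s hε) fun t ht =>
        ⟨Metric.ball s ε, Metric.isOpen_ball, (convex_ball s ε).ordConnected,
          Metric.mem_ball_self hε, ht, _, fun r hr =>
          ⟨hθ.isHorizontalAt_integral (trivializationAt Circle P (f s)) Metric.isOpen_ball
            (convex_ball s ε).ordConnected (fun r _ => hf r) hball (Metric.mem_ball_self hε) 0 hr,
            ?_⟩⟩)
      exact unitSection_proj _ (hball r hr)
    · obtain ⟨I, hI, hI', haI, hbI, γ, hγ⟩ := hab
      obtain ⟨J, hJ, hJ', hbJ, hcJ, δ, hδ⟩ := hbc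
      obtain ⟨z, hz⟩ := exists_eq_rot E ((hδ b hbJ).2.trans (hγ b hbI).2.symm)
      have hagree : ∀ r ∈ I ∩ J, γ r = LC.rot z (δ r) := fun r hr =>
        hθ.eq_rot_of_isHorizontalAt (hI.inter hJ) (hI'.inter hJ').isPreconnected
          (fun t ht => (hδ t ht.2).1) (fun t ht => (hγ t ht.1).1)
          (fun t ht => (hδ t ht.2).2.trans (hγ t ht.1).2.symm) ⟨hbI, hbJ⟩ hr hz
      classical
      refine ⟨I ∪ J, hI.union hJ, (hI'.isPreconnected.union b hbI hbJ
        hJ'.isPreconnected).ordConnected, Or.inl haI, Or.inr hcJ,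
        fun r => if r ∈ I then γ r else LC.rot z (δ r), fun r hr => ?_⟩
      have hJeq : ∀ r ∈ J, (if r ∈ I then γ r else LC.rot z (δ r)) = LC.rot z (δ r) := by
        intro r hr
        split_ifs with h
        · exact hagree r ⟨h, hr⟩
        · rfl
      rcases hr with hr | hr
      · refine ⟨(hγ r hr).1.congr ?_, by
          show (if r ∈ I then γ r else LC.rot z (δ r)).proj = f r
          rw [if_pos hr]; exact (hγ r hr).2⟩
        filter_upwards [hI.mem_nhds hr] with t ht
        rw [if_pos ht]
      · refine ⟨((hδ r hr).1.rot hθ z).congr ?_, by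
          show (if r ∈ I then γ r else LC.rot z (δ r)).proj = f r
          rw [hJeq r hr]; exact (hδ r hr).2⟩
        filter_upwards [hJ.mem_nhds hr] with t ht
        rw [hJeq t ht]
    · obtain ⟨I, hI, hI', haI, hbI, γ, hγ⟩ := hab
      exact ⟨I, hI, hI', hbI, haI, γ, hγ⟩
  have key' : ∀ t : ℝ, ∃ I : Set ℝ, IsOpen I ∧ I.OrdConnected ∧ (0 : ℝ) ∈ I ∧ t ∈ I ∧
      ∃ γ : ℝ → TotalSpace Circle P, γ 0 = p ∧
        ∀ r ∈ I, IsHorizontalAt θ γ r ∧ (γ r).proj = f r := by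
    intro t
    obtain ⟨I, hI, hI', h0, ht, γ, hγ⟩ := key 0 t
    obtain ⟨z, hz⟩ := exists_eq_rot E ((hγ 0 h0).2.trans hp.symm)
    exact ⟨I, hI, hI', h0, ht, fun s => LC.rot z (γ s), hz.symm, fun r hr =>
      ⟨(hγ r hr).1.rot hθ z, (hγ r hr).2⟩⟩
  choose I hI hI' h0 hmem γ hγ0 hγ using key'
  -- by uniqueness, the lifts over the intervals `I t` agree with each other
  have hagree : ∀ t, ∀ r ∈ I t, γ t r = γ r r := by
    intro t r hr
    have := hθ.eq_rot_of_isHorizontalAt ((hI t).inter (hI r)) ((hI' t).inter (hI' r)).isPreconnected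
      (fun s hs => (hγ r s hs.2).1) (fun s hs => (hγ t s hs.1).1)
      (fun s hs => (hγ r s hs.2).2.trans (hγ t s hs.1).2.symm) ⟨h0 t, h0 r⟩ ⟨hr, hmem r⟩ (z := 1)
      (by rw [rot_one, hγ0, hγ0])
    rwa [rot_one] at this
  refine ⟨fun t => γ t t, fun t => (hγ t t (hmem t)).1.congr ?_, fun t => (hγ t t (hmem t)).2,
    hγ0 0⟩
  filter_upwards [(hI t).mem_nhds (hmem t)] with r hr using hagree t r hr

theorem IsConnection.eq_of_horizontal (hθ : IsConnection E θ) {γ₁ γ₂ : ℝ → TotalSpace Circle P}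
    (h₁ : ∀ t, IsHorizontalAt θ γ₁ t) (h₂ : ∀ t, IsHorizontalAt θ γ₂ t)
    (h : ∀ t, (γ₁ t).proj = (γ₂ t).proj) {s : ℝ} (hs : γ₁ s = γ₂ s) (t : ℝ) : γ₁ t = γ₂ t := by
  have := hθ.eq_rot_of_isHorizontalAt isOpen_univ isPreconnected_univ (fun t _ => h₁ t)
    (fun t _ => h₂ t) (fun t _ => h t) (mem_univ s) (mem_univ t) (z := 1) (by rw [rot_one, hs])
  rw [this, rot_one]

end HorizontalCurves

/-! ### Parallel transport -/

section ParallelTransport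

set_option linter.unusedSectionVars false

variable {E : Type*} [AddCommGroup E] [Module ℝ E] [TopologicalSpace E]
  [IsTopologicalAddGroup E] [ContinuousSMul ℝ E] [LocallyConvexSpace ℝ E] [T2Space E]
  {M : Type*} [TopologicalSpace M] [ChartedSpace E M] [hM : IsLCManifold E M]
  {P : M → Type*} [∀ x, TopologicalSpace (P x)] [TopologicalSpace (TotalSpace Circle P)]
  [FiberBundle Circle P] [∀ x, MulAction Circle (P x)] [hP : IsSmoothCircleBundle E P]
  {θ : TotalSpace Circle P → E × Line → ℝ}

theorem isParallel_of_horizontal {γ : ℝ → TotalSpace Circle P} (hγ : ∀ t, IsHorizontalAt θ γ t)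
    (c : SmoothPath E M) (hc : ∀ t : unitInterval, (γ t).proj = c.1 t) :
    IsParallel θ c (γ 0) (γ 1) :=
  ⟨γ, fun t => (hγ t).1, rfl, rfl, fun t => ⟨hc t, (hγ t).2⟩⟩

theorem refPoint_proj (x : M) : (refPoint P x).proj = x :=
  unitSection_proj _ (FiberBundle.mem_baseSet_trivializationAt' x)

include hM hP

theorem IsParallel.rot (hθ : IsConnection E θ) {c : SmoothPath E M} {p q : TotalSpace Circle P}
    (h : IsParallel θ c p q) (z : Circle) : IsParallel θ c (rot z p) (rot z q) := by
  obtain ⟨γ, hγ, h0, h1, h⟩ := h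
  refine ⟨fun t => LC.rot z (γ t), fun t => (isSmoothMapAt_const z).rot (hγ t), congrArg _ h0,
    congrArg _ h1, fun t => ⟨(h t).1, ?_⟩⟩
  exact (IsHorizontalAt.rot hθ ⟨hγ t, (h t).2⟩ z).2

theorem IsConnection.exists_isParallel (hθ : IsConnection E θ) (c : SmoothPath E M)
    {p : TotalSpace Circle P} (hp : p.proj = c.1 0) :
    ∃ q : TotalSpace Circle P, q.proj = c.1 1 ∧ IsParallel θ c p q := by
  obtain ⟨f, hf, hfc⟩ := c.2
  obtain ⟨γ, hγ, hγf, h0⟩ := hθ.exists_horizontal_lift hf (p := p) (by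
    rw [hp]; exact (hfc 0).symm)
  have h1 : (γ 1).proj = c.1 1 := (hγf 1).trans (hfc 1)
  exact ⟨γ 1, h1, h0 ▸ isParallel_of_horizontal hγ c fun t => (hγf t).trans (hfc t)⟩

theorem IsConnection.isParallel_unique (hθ : IsConnection E θ) {c : SmoothPath E M}
    {p q q' : TotalSpace Circle P} (h : IsParallel θ c p q) (h' : IsParallel θ c p q') :
    q = q' := by
  have := (isLCManifold_totalSpace (E := E) (P := P)).toT2Space
  obtain ⟨γ, hγ, h0, h1, h⟩ := h
  obtain ⟨γ', hγ', h0', h1', h'⟩ := h'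
  have hproj : ∀ t ∈ Icc (0 : ℝ) 1, (γ t).proj = (γ' t).proj := fun t ht =>
    (h ⟨t, ht⟩).1.trans (h' ⟨t, ht⟩).1.symm
  -- the two curves are compared on the open interval, where they are horizontal near every point,
  -- and then at the end points by continuity
  have hhalf : (1 / 2 : ℝ) ∈ Ioo (0 : ℝ) 1 := by norm_num
  obtain ⟨z, hz⟩ := exists_eq_rot E (hproj _ (Ioo_subset_Icc_self hhalf))
  have h2 : ∀ t ∈ Ioo (0 : ℝ) 1, γ' t = LC.rot z (γ t) := fun t ht =>
    hθ.eq_rot_of_isHorizontalAt isOpen_Ioo isPreconnected_Ioo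
      (fun t ht => ⟨hγ t, (h ⟨t, Ioo_subset_Icc_self ht⟩).2⟩)
      (fun t ht => ⟨hγ' t, (h' ⟨t, Ioo_subset_Icc_self ht⟩).2⟩)
      (fun t ht => hproj t (Ioo_subset_Icc_self ht)) hhalf ht hz
  have h3 : IsClosed {t : ℝ | γ' t = LC.rot z (γ t)} :=
    isClosed_eq hγ'.continuous ((isSmoothMap_rot (E := E) z).continuous.comp hγ.continuous)
  have h4 : Icc (0 : ℝ) 1 ⊆ {t : ℝ | γ' t = LC.rot z (γ t)} := by
    rw [← closure_Ioo zero_ne_one]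
    exact closure_minimal h2 h3
  have h5 : γ' 0 = LC.rot z (γ 0) := h4 ⟨le_rfl, zero_le_one⟩
  have h6 : γ' 1 = LC.rot z (γ 1) := h4 ⟨zero_le_one, le_rfl⟩
  rw [h0, h0'] at h5
  have h7 : (1 : Circle) = z := rot_injective E (p := p) (by rw [rot_one]; exact h5)
  rw [← h1, ← h1', h6, ← h7, rot_one]

theorem IsConnection.isParallel_transport (hθ : IsConnection E θ) (c : SmoothPath E M) :
    IsParallel θ c (refPoint P (c.1 0)) (LC.rot (transport θ c) (refPoint P (c.1 1))) := by
  refine Classical.epsilon_spec (p := fun u => IsParallel θ c (refPoint P (c.1 0))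
    (LC.rot u (refPoint P (c.1 1)))) ?_
  obtain ⟨q, hq, hc⟩ := hθ.exists_isParallel c (refPoint_proj (P := P) (c.1 0))
  obtain ⟨z, rfl⟩ := exists_eq_rot E ((refPoint_proj (P := P) (c.1 1)).trans hq.symm)
  exact ⟨z, hc⟩

/-- Parallel transport in terms of reference points. -/
theorem IsConnection.isParallel_rot_refPoint_iff (hθ : IsConnection E θ) (c : SmoothPath E M)
    {z w : Circle} : IsParallel θ c (LC.rot z (refPoint P (c.1 0)))
      (LC.rot w (refPoint P (c.1 1))) ↔ w = z * transport θ c := by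
  have h := (hθ.isParallel_transport c).rot hθ z
  rw [← rot_mul] at h
  exact ⟨fun h' => rot_injective E (hθ.isParallel_unique h' h), fun h' => h' ▸ h⟩

end ParallelTransport

/-! ### Smooth curves in manifolds -/

section Segments

set_option linter.unusedSectionVars false

theorem isCk_smul : ∀ (n : ℕ) {F : Type u} [AddCommGroup F] [Module ℝ F] [TopologicalSpace F]
    [IsTopologicalAddGroup F] [ContinuousSMul ℝ F] [LocallyConvexSpace ℝ F] [T2Space F],
    IsCk n (fun p : ℝ × F => p.1 • p.2) univ
  | 0, _, _, _, _, _, _, _, _ => continuous_smul.continuousOn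
  | n + 1, F, _, _, _, _, _, _, _ => by
      have key : ∀ p v : ℝ × F, HasDirDeriv (fun p : ℝ × F => p.1 • p.2) p v
          (v.1 • p.2 + p.1 • v.2) := by
        intro p v
        have h1 : Continuous fun t : ℝ => v.1 • p.2 + p.1 • v.2 + t • v.1 • v.2 := by fun_prop
        refine Tendsto.congr' ?_ ((h1.tendsto' 0 (v.1 • p.2 + p.1 • v.2) (by simp)).mono_left
          nhdsWithin_le_nhds)
        filter_upwards [self_mem_nhdsWithin] with t ht
        have ht' : t ≠ 0 := ht
        have h2 : (p + t • v).1 • (p + t • v).2 - p.1 • p.2 =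
            t • (v.1 • p.2 + p.1 • v.2 + t • v.1 • v.2) := by
          simp only [Prod.fst_add, Prod.snd_add, Prod.smul_fst, Prod.smul_snd, smul_eq_mul]
          module
        rw [h2, inv_smul_smul₀ ht']
      refine ⟨continuous_smul.continuousOn, fun p _ v => ?_, ?_⟩
      · rw [(key p v).dirDeriv_eq]; exact key p v
      · have hopen : IsOpen ((univ : Set (ℝ × F)) ×ˢ (univ : Set (ℝ × F))) :=
          isOpen_univ.prod isOpen_univ
        let f₁ := ContinuousLinearMap.fst ℝ (ℝ × F) (ℝ × F)
        let f₂ := ContinuousLinearMap.snd ℝ (ℝ × F) (ℝ × F)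
        have h1 := ((isCk_smul n (F := F)).comp_linear
          (((ContinuousLinearMap.fst ℝ ℝ F).comp f₂).prod
            ((ContinuousLinearMap.snd ℝ ℝ F).comp f₁)) isOpen_univ).mono
          (V := univ ×ˢ univ) fun _ _ => mem_univ _
        have h2 := ((isCk_smul n (F := F)).comp_linear
          (((ContinuousLinearMap.fst ℝ ℝ F).comp f₁).prod
            ((ContinuousLinearMap.snd ℝ ℝ F).comp f₂)) isOpen_univ).mono
          (V := univ ×ˢ univ) fun _ _ => mem_univ _
        have h3 : IsCk n (fun p : F × F => (0 : F) + (ContinuousLinearMap.fst ℝ F F +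
          ContinuousLinearMap.snd ℝ F F) p) univ := isCk_affine n 0 _ _
        refine (h3.comp (IsCk.prodMk hopen h1 h2) hopen isOpen_univ (mapsTo_univ _ _)).congr hopen
          fun p _ => ?_
        rw [(key p.1 p.2).dirDeriv_eq]
        simp [f₁, f₂]

variable {F : Type*} [AddCommGroup F] [Module ℝ F] [TopologicalSpace F]
  [IsTopologicalAddGroup F] [ContinuousSMul ℝ F] [LocallyConvexSpace ℝ F] [T2Space F]
  {N : Type*} [TopologicalSpace N] [ChartedSpace F N] [IsLCManifold F N]

/-- Every point has arbitrarily small neighbourhoods `V` whose points are joined by curves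
`seg n n'` in `V` that depend smoothly on the end point. These are straight segments in a chart;
they are reparametrized by a function `ℝ → [0, 1]` so that they are defined on all of `ℝ`. -/
theorem exists_segments (n₁ : N) {B : Set N} (hB : B ∈ 𝓝 n₁) :
    ∃ V : Set N, IsOpen V ∧ n₁ ∈ V ∧ V ⊆ B ∧ ∃ seg : N → N → ℝ → N,
      (∀ n ∈ V, ∀ n' ∈ V, ∀ t, seg n n' t ∈ V) ∧ (∀ n ∈ V, ∀ n' ∈ V, seg n n' 0 = n) ∧
      (∀ n ∈ V, ∀ n' ∈ V, seg n n' 1 = n') ∧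
      ∀ n ∈ V, ∀ n' ∈ V, ∀ t, IsSmoothMapAt (F × ℝ) F
        (fun p : N × ℝ => seg n p.1 p.2) (n', t) := by
  set c := chartAt F n₁ with hc
  have hn₁ : n₁ ∈ c.source := mem_chart_source F n₁
  have h1 : c.target ∩ c.symm ⁻¹' B ∈ 𝓝 (c n₁) := by
    refine inter_mem (c.open_target.mem_nhds (c.map_source hn₁)) ?_
    refine (c.continuousAt_symm (c.map_source hn₁)).preimage_mem_nhds ?_
    rwa [c.left_inv hn₁]
  obtain ⟨S, ⟨hS, hSc⟩, hSB⟩ :=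
    (LocallyConvexSpace.convex_basis (𝕜 := ℝ) (c n₁)).mem_iff.1 h1
  have hD : Convex ℝ (interior S) := hSc.interior
  have hDt : interior S ⊆ c.target := fun y hy => (hSB (interior_subset hy)).1
  have hmem : ∀ n n' : N, c n ∈ interior S → c n' ∈ interior S → ∀ t : ℝ,
      c n + Real.smoothTransition t • (c n' - c n) ∈ interior S := fun n n' hn hn' t =>
    hD.add_smul_sub_mem hn hn' ⟨Real.smoothTransition.nonneg t, Real.smoothTransition.le_one t⟩
  have hV : ∀ y ∈ interior S, c.symm y ∈ c.source ∩ c ⁻¹' interior S := fun y hy =>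
    ⟨c.map_target (hDt hy), by rw [mem_preimage, c.right_inv (hDt hy)]; exact hy⟩
  refine ⟨c.source ∩ c ⁻¹' interior S, c.isOpen_inter_preimage isOpen_interior,
    ⟨hn₁, mem_interior_iff_mem_nhds.2 hS⟩, fun n hn => ?_,
    fun n n' t => c.symm (c n + Real.smoothTransition t • (c n' - c n)),
    fun n hn n' hn' t => hV _ (hmem n n' hn.2 hn'.2 t), fun n hn n' hn' => ?_,
    fun n hn n' hn' => ?_, fun n hn n' hn' t => ?_⟩
  · have := (hSB (interior_subset hn.2)).2
    rwa [mem_preimage, c.left_inv hn.1] at this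
  · simp [Real.smoothTransition.zero, c.left_inv hn.1]
  · simp [Real.smoothTransition.one, c.left_inv hn'.1]
  · refine IsSmoothMapAt.comp (g := c.symm) (isSmoothMapAt_chart_symm (chart_mem_atlas F n₁)
      (hDt (hmem n n' hn.2 hn'.2 t))) ?_
    have h2 : IsSmoothMapAt (F × ℝ) ℝ (fun p : N × ℝ => Real.smoothTransition p.2) (n', t) :=
      IsSmoothMapAt.comp (g := Real.smoothTransition) (f := fun p : N × ℝ => p.2)
        (isSmoothMap_of_contDiff Real.smoothTransition.contDiff t) isSmoothMapAt_snd
    have h3 : IsSmoothMapAt (F × ℝ) F (fun p : N × ℝ => -c n + ContinuousLinearMap.id ℝ F (c p.1))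
        (n', t) :=
      IsSmoothMapAt.comp (g := fun y : F => -c n + ContinuousLinearMap.id ℝ F y)
        (f := fun p : N × ℝ => c p.1) (isSmoothMap_affine (-c n) (ContinuousLinearMap.id ℝ F) _)
        (IsSmoothMapAt.comp (g := c) (isSmoothMapAt_chart (chart_mem_atlas F n₁) hn'.1)
          isSmoothMapAt_fst)
    have h4 := h2.comp₂ (fun m => isCk_smul m) h3
    have h5 := IsSmoothMapAt.comp (g := fun y : F => c n + ContinuousLinearMap.id ℝ F y)
      (isSmoothMap_affine (c n) (ContinuousLinearMap.id ℝ F) _) h4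
    refine h5.congr (Eventually.of_forall fun p => ?_)
    simp [sub_eq_neg_add]

/-- In a connected manifold, all points can be reached from a given one by smooth curves. -/
theorem smoothCurve_induction [ConnectedSpace N] {S : N → Prop} {n₀ : N} (h₀ : S n₀)
    (h : ∀ γ : ℝ → N, IsSmoothMap ℝ F γ → S (γ 0) → S (γ 1)) (n : N) : S n := by
  refine (isPreconnected_univ.induction₂ (fun x y : N => S x ↔ S y) (fun x _ => ?_)
    (fun _ _ _ _ _ _ => Iff.trans) (fun _ _ _ _ => Iff.symm) (mem_univ n₀) (mem_univ n)).1 h₀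
  obtain ⟨V, hV, hxV, -, seg, -, h0, h1, hs⟩ := exists_segments (F := F) x univ_mem
  have hcurve : ∀ a ∈ V, ∀ b ∈ V, IsSmoothMap ℝ F (seg a b) := fun a ha b hb t =>
    IsSmoothMapAt.comp (g := fun p : N × ℝ => seg a p.1 p.2) (f := fun t : ℝ => (b, t))
      (hs a ha b hb t) ((isSmoothMapAt_const b).prodMk (isSmoothMap_id t))
  have hstep : ∀ a ∈ V, ∀ b ∈ V, S a → S b := fun a ha b hb hSa => by
    have := h _ (hcurve a ha b hb)
    rw [h0 a ha b hb, h1 a ha b hb] at this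
    exact this hSa
  exact nhdsWithin_le_nhds (mem_of_superset (hV.mem_nhds hxV) fun y hy =>
    ⟨hstep x hxV y hy, hstep y hy x hxV⟩)

/-- Every tangent vector is the velocity of a smooth curve that is defined on all of `ℝ`. -/
theorem exists_curve_with_velocity (x : N) (v : F) :
    ∃ γ : ℝ → N, IsSmoothMap ℝ F γ ∧ γ 0 = x ∧ tmap ℝ F γ 0 1 = v := by
  set c := chartAt F x with hc
  have hx : x ∈ c.source := mem_chart_source F x
  have hline : Tendsto (fun t : ℝ => c x + t • v) (𝓝 0) (𝓝 (c x)) := by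
    have : Continuous fun t : ℝ => c x + t • v := by fun_prop
    exact this.tendsto' 0 (c x) (by simp)
  obtain ⟨ε, hε, hball⟩ := Metric.eventually_nhds_iff_ball.1
    (hline.eventually (c.open_target.mem_nhds (c.map_source hx)))
  -- a bounded reparametrization with derivative `1` at `0`
  set τ : ℝ → ℝ := fun t => ε / 2 * Real.sin (t / (ε / 2)) with hτ
  have hτb : ∀ t, τ t ∈ Metric.ball (0 : ℝ) ε := by
    intro t
    rw [mem_ball_zero_iff, Real.norm_eq_abs, hτ, abs_mul, abs_of_pos (half_pos hε)]
    nlinarith [Real.abs_sin_le_one (t / (ε / 2))]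
  have hτs : ContDiff ℝ (⊤ : ℕ∞) τ :=
    contDiff_const.mul (Real.contDiff_sin.comp (contDiff_id.div_const _))
  have hτ0 : τ 0 = 0 := by simp [hτ]
  have hτd : HasDerivAt τ 1 0 := by
    have h1 : HasDerivAt (fun t : ℝ => t / (ε / 2)) (1 / (ε / 2)) 0 :=
      (hasDerivAt_id' 0).div_const _
    have h2 := (h1.sin).const_mul (ε / 2)
    have h3 : ε / 2 * (Real.cos (0 / (ε / 2)) * (1 / (ε / 2))) = 1 := by
      rw [zero_div, Real.cos_zero]; field_simp
    rwa [h3] at h2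
  have hβ : ∀ t, IsSmoothMapAt ℝ F
      (fun t => c x + ContinuousLinearMap.toSpanSingleton ℝ v (τ t)) t := fun t =>
    IsSmoothMapAt.comp (g := fun s : ℝ => c x + ContinuousLinearMap.toSpanSingleton ℝ v s)
      (isSmoothMap_affine _ _ _) (isSmoothMap_of_contDiff hτs t)
  have hβt : ∀ t, c x + ContinuousLinearMap.toSpanSingleton ℝ v (τ t) ∈ c.target := fun t =>
    hball _ (hτb t)
  refine ⟨fun t => c.symm (c x + ContinuousLinearMap.toSpanSingleton ℝ v (τ t)), fun t =>
    IsSmoothMapAt.comp (g := c.symm) (isSmoothMapAt_chart_symm (chart_mem_atlas F x) (hβt t))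
      (hβ t), by simp [hτ0, c.left_inv hx], HasDirDeriv.dirDeriv_eq ?_⟩
  have h1 : Tendsto (fun t : ℝ => (t⁻¹ * τ t) • v) (𝓝[≠] 0) (𝓝 ((1 : ℝ) • v)) := by
    have := hasDerivAt_iff_tendsto_slope_zero.1 hτd
    simp only [zero_add, hτ0, sub_zero, smul_eq_mul] at this
    exact this.smul_const v
  rw [one_smul] at h1
  refine h1.congr fun t => ?_
  have h2 : ∀ t, c (c.symm (c x + (τ t) • v)) = c x + (τ t) • v := fun t => by
    simpa using c.right_inv (hβt t)
  have h3 : c.symm (c x + ContinuousLinearMap.toSpanSingleton ℝ v (τ 0)) = x := by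
    simp [hτ0, c.left_inv hx]
  simp only [inCharts, h3]
  simp [chartAt_self_eq, ← hc, h2, hτ0, c.left_inv hx, smul_smul]

end Segments

/-! ### Parallel maps between bundles with connection -/

section ParallelMaps

set_option linter.unusedSectionVars false

variable {E : Type*} [AddCommGroup E] [Module ℝ E] [TopologicalSpace E]
  [IsTopologicalAddGroup E] [ContinuousSMul ℝ E] [LocallyConvexSpace ℝ E] [T2Space E]
  {M : Type*} [TopologicalSpace M] [ChartedSpace E M] [hM : IsLCManifold E M]
  {P : M → Type*} [∀ x, TopologicalSpace (P x)] [TopologicalSpace (TotalSpace Circle P)]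
  [FiberBundle Circle P] [∀ x, MulAction Circle (P x)] [hP : IsSmoothCircleBundle E P]
  {F : Type*} [AddCommGroup F] [Module ℝ F] [TopologicalSpace F]
  [IsTopologicalAddGroup F] [ContinuousSMul ℝ F] [LocallyConvexSpace ℝ F] [T2Space F]
  {N : Type*} [TopologicalSpace N] [ChartedSpace F N] [hN : IsLCManifold F N]
  {Q : N → Type*} [∀ x, TopologicalSpace (Q x)] [TopologicalSpace (TotalSpace Circle Q)]
  [FiberBundle Circle Q] [∀ x, MulAction Circle (Q x)] [hQ : IsSmoothCircleBundle F Q]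
  {θ : TotalSpace Circle P → E × Line → ℝ} {η : TotalSpace Circle Q → F × Line → ℝ}

/-- A `𝕋`-equivariant map between total spaces of circle bundles with connection over the map `f`
of the bases which sends horizontal curves to horizontal curves. It is not assumed to be smooth. -/
structure IsParallelMap (η : TotalSpace Circle Q → F × Line → ℝ)
    (θ : TotalSpace Circle P → E × Line → ℝ) (f : N → M)
    (χ : TotalSpace Circle Q → TotalSpace Circle P) : Prop where
  equivariant : ∀ z q, χ (rot z q) = rot z (χ q)
  covers : ∀ q, (χ q).proj = f q.proj
  horizontal : ∀ γ : ℝ → TotalSpace Circle Q, (∀ t, IsHorizontalAt η γ t) →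
    ∀ t, IsHorizontalAt θ (χ ∘ γ) t

theorem IsParallelMap.of_isSmoothMap {f : N → M} {χ : TotalSpace Circle Q → TotalSpace Circle P}
    (h₁ : ∀ z q, χ (rot z q) = rot z (χ q)) (h₂ : ∀ q, (χ q).proj = f q.proj)
    (hχ : IsSmoothMap (F × Line) (E × Line) χ)
    (h₃ : ∀ q v, θ (χ q) (tmap (F × Line) (E × Line) χ q v) = η q v) :
    IsParallelMap η θ f χ where
  equivariant := h₁
  covers := h₂
  horizontal γ hγ t := by
    refine ⟨(hχ (γ t)).comp (hγ t).1, ?_⟩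
    rw [tmap_comp (hχ (γ t)) (hγ t).1, Function.comp_apply, h₃]
    exact (hγ t).2

include hM hP hN hQ

/-- A parallel map over a connected base is determined by its value at one point. -/
theorem IsParallelMap.eq_of_apply_eq [ConnectedSpace N] (hθ : IsConnection E θ)
    (hη : IsConnection F η) {f : N → M} {χ χ' : TotalSpace Circle Q → TotalSpace Circle P}
    (h : IsParallelMap η θ f χ) (h' : IsParallelMap η θ f χ') {q₀ : TotalSpace Circle Q}
    (h₀ : χ q₀ = χ' q₀) : χ = χ' := by
  have hfib : ∀ q q' : TotalSpace Circle Q, q.proj = q'.proj → χ q = χ' q → χ q' = χ' q' := by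
    intro q q' hq hχ
    obtain ⟨z, rfl⟩ := exists_eq_rot F hq
    rw [h.equivariant, h'.equivariant, hχ]
  have key : ∀ n, ∃ q : TotalSpace Circle Q, q.proj = n ∧ χ q = χ' q := by
    refine smoothCurve_induction (F := F) ⟨q₀, rfl, h₀⟩ fun γ hγ hS => ?_
    obtain ⟨q, hq, hχ⟩ := hS
    obtain ⟨δ, hδ, hδγ, hδ0⟩ := hη.exists_horizontal_lift hγ hq
    refine ⟨δ 1, hδγ 1, hθ.eq_of_horizontal (h.horizontal δ hδ) (h'.horizontal δ hδ)
      (fun t => (h.covers _).trans (h'.covers _).symm) (s := 0) ?_ 1⟩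
    simpa [hδ0] using hχ
  funext q
  obtain ⟨q', hq', hχ⟩ := key q.proj
  exact hfib q' q hq' hχ

/-- Smooth parallel maps preserve the connection forms. -/
theorem IsParallelMap.preserves (hθ : IsConnection E θ) (hη : IsConnection F η) {f : N → M}
    {χ : TotalSpace Circle Q → TotalSpace Circle P} (h : IsParallelMap η θ f χ)
    (hχ : IsSmoothMap (F × Line) (E × Line) χ) (q : TotalSpace Circle Q) (v : F × Line) :
    θ (χ q) (tmap (F × Line) (E × Line) χ q v) = η q v := by
  have hL := isLCManifold_totalSpace (E := F) (P := Q)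
  obtain ⟨α, hα, rfl, rfl⟩ := exists_curve_with_velocity q v
  obtain ⟨γ, hγ, hγα, hγ0⟩ := hη.exists_horizontal_lift (fun t => (hα t).proj) (p := α 0) rfl
  obtain ⟨k, hk, hk'⟩ := (hγ 0).1.exists_rot (hα 0) (Eventually.of_forall hγα)
  obtain ⟨κ, hκ, hexp⟩ := hk.exists_log
  have e1 : (fun t => rot (Circle.exp (2 * Real.pi * κ t)) (γ t)) =ᶠ[𝓝 0] α := by
    filter_upwards [hk'] with t ht
    rw [hexp, ht]
  have e2 : (fun t => rot (Circle.exp (2 * Real.pi * κ t)) ((χ ∘ γ) t)) =ᶠ[𝓝 0] χ ∘ α := by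
    filter_upwards [e1] with t ht
    rw [Function.comp_apply, Function.comp_apply, ← ht, h.equivariant]
  have e1' : rot (Circle.exp (2 * Real.pi * κ 0)) (γ 0) = α 0 := e1.self_of_nhds
  have e2' : rot (Circle.exp (2 * Real.pi * κ 0)) ((χ ∘ γ) 0) = χ (α 0) := e2.self_of_nhds
  have h1 := hη.apply_rot_exp hκ (hγ 0).1 1
  have h2 := hθ.apply_rot_exp hκ (h.horizontal γ hγ 0).1 1
  rw [tmap_congr e1, (hγ 0).2, add_zero, e1'] at h1
  rw [tmap_congr e2, (h.horizontal γ hγ 0).2, add_zero, e2',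
    tmap_comp (hχ _) (hα 0)] at h2
  exact h2.trans h1.symm

end ParallelMaps

/-! ### Smoothness of families of parallel maps -/

section SmoothDependence

set_option linter.unusedSectionVars false

variable {E : Type*} [AddCommGroup E] [Module ℝ E] [TopologicalSpace E]
  [IsTopologicalAddGroup E] [ContinuousSMul ℝ E] [LocallyConvexSpace ℝ E] [T2Space E]
  {M : Type*} [TopologicalSpace M] [ChartedSpace E M] [hM : IsLCManifold E M]
  {P : M → Type*} [∀ x, TopologicalSpace (P x)] [TopologicalSpace (TotalSpace Circle P)]
  [FiberBundle Circle P] [∀ x, MulAction Circle (P x)] [hP : IsSmoothCircleBundle E P]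
  {F : Type*} [AddCommGroup F] [Module ℝ F] [TopologicalSpace F]
  [IsTopologicalAddGroup F] [ContinuousSMul ℝ F] [LocallyConvexSpace ℝ F] [T2Space F]
  {N : Type*} [TopologicalSpace N] [ChartedSpace F N] [hN : IsLCManifold F N]
  {Q : N → Type*} [∀ x, TopologicalSpace (Q x)] [TopologicalSpace (TotalSpace Circle Q)]
  [FiberBundle Circle Q] [∀ x, MulAction Circle (Q x)] [hQ : IsSmoothCircleBundle F Q]
  {θ : TotalSpace Circle P → E × Line → ℝ} {η : TotalSpace Circle Q → F × Line → ℝ}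

include hM hP hN hQ

/-- The effect of a parallel map along a curve `c` that stays in the domain of a trivialization `e`
and whose image stays in the domain of a trivialization `d`. -/
theorem IsParallelMap.apply_unitSection (hθ : IsConnection E θ) (hη : IsConnection F η)
    {f : N → M} {χ : TotalSpace Circle Q → TotalSpace Circle P} (h : IsParallelMap η θ f χ)
    (e : Trivialization Circle (π Circle Q)) [MemTrivializationAtlas e]
    (d : Trivialization Circle (π Circle P)) [MemTrivializationAtlas d] {c : ℝ → N}
    (hc : IsSmoothMap ℝ F c) (hfc : IsSmoothMap ℝ E (fun t => f (c t)))
    (hce : ∀ t, c t ∈ e.baseSet) (hfcd : ∀ t, f (c t) ∈ d.baseSet) :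
    χ (unitSection e (c 1)) = rot (Circle.exp (2 * Real.pi *
      ((∫ t in (0 : ℝ)..1, η (unitSection e (c t))
          (tmap ℝ (F × Line) (fun s => unitSection e (c s)) t 1)) -
        ∫ t in (0 : ℝ)..1, θ (unitSection d (f (c t)))
          (tmap ℝ (E × Line) (fun s => unitSection d (f (c s))) t 1))) *
      (d (χ (unitSection e (c 0)))).2) (unitSection d (f (c 1))) := by
  have h1 := fun t => hη.isHorizontalAt_integral e isOpen_univ ordConnected_univ
    (fun t _ => hc t) (fun t _ => hce t) (mem_univ 0) 0 (mem_univ t)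
  have h2 := fun t => hθ.isHorizontalAt_integral d isOpen_univ ordConnected_univ
    (fun t _ => hfc t) (fun t _ => hfcd t) (mem_univ 0) 0 (mem_univ t)
  set A := ∫ t in (0 : ℝ)..1, η (unitSection e (c t))
          (tmap ℝ (F × Line) (fun s => unitSection e (c s)) t 1)
  set B := ∫ t in (0 : ℝ)..1, θ (unitSection d (f (c t)))
          (tmap ℝ (E × Line) (fun s => unitSection d (f (c s))) t 1)
  have hproj : ∀ t, (unitSection e (c t)).proj = c t := fun t => unitSection_proj e (hce t)
  have hproj' : ∀ t, (unitSection d (f (c t))).proj = f (c t) :=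
    fun t => unitSection_proj d (hfcd t)
  have h0 : χ (unitSection e (c 0)) =
      rot (d (χ (unitSection e (c 0)))).2 (unitSection d (f (c 0))) := by
    have h3 : (χ (unitSection e (c 0))).proj = f (c 0) := by rw [h.covers, hproj]
    have h4 := eq_rot_unitSection E d (p := χ (unitSection e (c 0))) (by rw [h3]; exact hfcd 0)
    rwa [h3] at h4
  -- compare the image of the horizontal lift of `c` with the horizontal lift of `f ∘ c`
  have h3 := hθ.eq_rot_of_isHorizontalAt isOpen_univ isPreconnected_univ (fun t _ => h2 t)
    (fun t _ => h.horizontal _ h1 t)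
    (fun t _ => by simp [h.covers, hproj, hproj']) (mem_univ 0) (mem_univ 1)
    (z := (d (χ (unitSection e (c 0)))).2) (by simpa using h0)
  have h4 : rot (Circle.exp (2 * Real.pi * (0 - A))) (χ (unitSection e (c 1))) =
      rot (d (χ (unitSection e (c 0)))).2
        (rot (Circle.exp (2 * Real.pi * (0 - B))) (unitSection d (f (c 1)))) := by
    rw [← h.equivariant]
    exact h3
  have h5 := congrArg (rot (Circle.exp (2 * Real.pi * A))) h4
  rw [← rot_mul, ← Circle.exp_add, ← rot_mul, ← rot_mul] at h5
  have h6 : 2 * Real.pi * A + 2 * Real.pi * (0 - A) = 0 := by ring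
  rw [h6, Circle.exp_zero, rot_one] at h5
  rw [h5]
  congr 2
  have h7 : 2 * Real.pi * (A - B) = 2 * Real.pi * A + 2 * Real.pi * (0 - B) := by ring
  rw [h7, Circle.exp_add]
  exact mul_right_comm _ _ _

variable {Y : Type*} [AddCommGroup Y] [Module ℝ Y] [TopologicalSpace Y]
  [IsTopologicalAddGroup Y] [ContinuousSMul ℝ Y] [LocallyConvexSpace ℝ Y] [T2Space Y]
  {X : Type*} [TopologicalSpace X] [ChartedSpace Y X] [hX : IsLCManifold Y X]

include hX

/-- Near `n₁`, a family of parallel maps that depends smoothly on the parameter on one fibre is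
jointly smooth: on nearby fibres it is given by integrals along a smooth family of segments. -/
theorem smoothAt_family_of_smoothAt_fibre (hθ : IsConnection E θ) (hη : IsConnection F η)
    {f : X × N → M} (hf : IsSmoothMap (Y × F) E f)
    {χ : X → TotalSpace Circle Q → TotalSpace Circle P}
    (hχ : ∀ x, IsParallelMap η θ (fun n => f (x, n)) (χ x)) (x₀ : X) (n₁ : N)
    (e : Trivialization Circle (π Circle Q)) [MemTrivializationAtlas e] (he : n₁ ∈ e.baseSet) :
    ∃ V : Set N, IsOpen V ∧ n₁ ∈ V ∧ V ⊆ e.baseSet ∧ ∀ n ∈ V,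
      IsSmoothMapAt Y (E × Line) (fun x => χ x (unitSection e n)) x₀ → ∀ n' ∈ V,
      IsSmoothMapAt (Y × F) (E × Line) (fun p : X × N => χ p.1 (unitSection e p.2)) (x₀, n') := by
  have hLP := isLCManifold_totalSpace (E := E) (P := P)
  have hLQ := isLCManifold_totalSpace (E := F) (P := Q)
  set d := trivializationAt Circle P (f (x₀, n₁)) with hd
  have hd₁ : f (x₀, n₁) ∈ d.baseSet := FiberBundle.mem_baseSet_trivializationAt' _
  have h1 : ∀ᶠ p in 𝓝 (x₀, n₁), f p ∈ d.baseSet :=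
    hf.continuous.continuousAt.eventually (d.open_baseSet.mem_nhds hd₁)
  rw [nhds_prod_eq] at h1
  obtain ⟨A, hA, B, hB, hAB⟩ := eventually_prod_iff.1 h1
  obtain ⟨V, hV, hnV, hVB, seg, hseg, hseg0, hseg1, hsegs⟩ := exists_segments (F := F) n₁
    (inter_mem hB (e.open_baseSet.mem_nhds he))
  have hVe : V ⊆ e.baseSet := fun n hn => (hVB hn).2
  refine ⟨V, hV, hnV, hVe, fun n hn hsm n' hn' => ?_⟩
  have hcurve : ∀ a ∈ V, IsSmoothMap ℝ F (seg n a) := fun a ha t =>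
    IsSmoothMapAt.comp (g := fun p : N × ℝ => seg n p.1 p.2) (f := fun t : ℝ => (a, t))
      (hsegs n hn a ha t) ((isSmoothMapAt_const a).prodMk (isSmoothMap_id t))
  have hfcurve : ∀ x, ∀ a ∈ V, IsSmoothMap ℝ E (fun t => f (x, seg n a t)) := fun x a ha t =>
    IsSmoothMapAt.comp (g := f) (hf _) ((isSmoothMapAt_const x).prodMk (hcurve a ha t))
  -- the two integrals depend smoothly on the end point and on the parameter
  have hI : IsSmoothMapAt F ℝ (fun a => ∫ t in (0 : ℝ)..1, η (unitSection e (seg n a t))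
      (tmap ℝ (F × Line) (fun s => unitSection e (seg n a s)) t 1)) n' := by
    refine hη.isOneForm.isSmoothMapAt_integral
      (Ψ := fun p : N × ℝ => unitSection e (seg n p.1 p.2)) ?_
    filter_upwards [hV.mem_nhds hn'] with a ha t
    exact (hsegs n hn a ha t).unitSection e (hVe (hseg n hn a ha t))
  have hJ : IsSmoothMapAt (Y × F) ℝ (fun p : X × N => ∫ t in (0 : ℝ)..1,
      θ (unitSection d (f (p.1, seg n p.2 t)))
      (tmap ℝ (E × Line) (fun s => unitSection d (f (p.1, seg n p.2 s))) t 1)) (x₀, n') := by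
    refine hθ.isOneForm.isSmoothMapAt_integral
      (Ψ := fun p : (X × N) × ℝ => unitSection d (f (p.1.1, seg n p.1.2 p.2))) ?_
    filter_upwards [prod_mem_nhds hA (hV.mem_nhds hn')] with p hp t
    have g1 : IsSmoothMapAt ((Y × F) × ℝ) (Y × F) (Prod.fst : (X × N) × ℝ → X × N) (p, t) :=
      isSmoothMapAt_fst
    have g2 : IsSmoothMapAt ((Y × F) × ℝ) ℝ (Prod.snd : (X × N) × ℝ → ℝ) (p, t) :=
      isSmoothMapAt_snd
    have g3 : IsSmoothMapAt ((Y × F) × ℝ) Y (fun q : (X × N) × ℝ => q.1.1) (p, t) :=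
      IsSmoothMapAt.comp (g := Prod.fst) isSmoothMapAt_fst g1
    have g4 : IsSmoothMapAt ((Y × F) × ℝ) F (fun q : (X × N) × ℝ => q.1.2) (p, t) :=
      IsSmoothMapAt.comp (g := Prod.snd) isSmoothMapAt_snd g1
    have g5 : IsSmoothMapAt ((Y × F) × ℝ) F (fun q : (X × N) × ℝ => seg n q.1.2 q.2) (p, t) :=
      IsSmoothMapAt.comp (g := fun r : N × ℝ => seg n r.1 r.2)
        (f := fun q : (X × N) × ℝ => (q.1.2, q.2)) (hsegs n hn p.2 hp.2 t) (g4.prodMk g2)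
    have g6 : IsSmoothMapAt ((Y × F) × ℝ) E (fun q : (X × N) × ℝ => f (q.1.1, seg n q.1.2 q.2))
        (p, t) := IsSmoothMapAt.comp (g := f) (hf _) (g3.prodMk g5)
    exact g6.unitSection d (hAB hp.1 (hVB (hseg n hn p.2 hp.2 t)).1)
  have hz : IsSmoothMapAt Y Line (fun x => (d (χ x (unitSection e n))).2) x₀ := by
    refine hsm.trivialization d ?_
    rw [(hχ x₀).covers, unitSection_proj e (hVe hn)]
    exact hAB hA.self_of_nhds (hVB hn).1
  have hfst : IsSmoothMapAt (Y × F) Y (Prod.fst : X × N → X) (x₀, n') := isSmoothMapAt_fst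
  have hsnd : IsSmoothMapAt (Y × F) F (Prod.snd : X × N → N) (x₀, n') := isSmoothMapAt_snd
  have hI' := IsSmoothMapAt.comp (f := (Prod.snd : X × N → N)) hI hsnd
  have hz' := IsSmoothMapAt.comp (f := (Prod.fst : X × N → X)) hz hfst
  refine (((hI'.sub hJ).circleExp.circle_mul hz').rot ((hf (x₀, n')).unitSection d
    (hAB hA.self_of_nhds (hVB hn').1))).congr ?_
  filter_upwards [prod_mem_nhds hA (hV.mem_nhds hn')] with p hp
  have := (hχ p.1).apply_unitSection hθ hη e d (hcurve p.2 hp.2) (hfcurve p.1 p.2 hp.2)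
    (fun t => hVe (hseg n hn p.2 hp.2 t)) (fun t => hAB hp.1 (hVB (hseg n hn p.2 hp.2 t)).1)
  simp only [hseg0 n hn p.2 hp.2, hseg1 n hn p.2 hp.2] at this
  exact this.symm

/-- A family of parallel maps over a connected base that depends smoothly on the parameter at one
point is jointly smooth. -/
theorem smoothAt_family [ConnectedSpace N] (hθ : IsConnection E θ) (hη : IsConnection F η)
    {f : X × N → M} (hf : IsSmoothMap (Y × F) E f)
    {χ : X → TotalSpace Circle Q → TotalSpace Circle P}
    (hχ : ∀ x, IsParallelMap η θ (fun n => f (x, n)) (χ x)) {x₀ : X} {q₀ : TotalSpace Circle Q}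
    (h₀ : IsSmoothMapAt Y (E × Line) (fun x => χ x q₀) x₀) (q : TotalSpace Circle Q) :
    IsSmoothMapAt (Y × (F × Line)) (E × Line) (fun p : X × TotalSpace Circle Q => χ p.1 p.2)
      (x₀, q) := by
  -- smooth dependence on the parameter propagates from one fibre to the nearby ones, and hence to
  -- all fibres
  set S : N → Prop := fun n => ∀ q : TotalSpace Circle Q, q.proj = n →
    IsSmoothMapAt Y (E × Line) (fun x => χ x q) x₀ with hS
  have hrot : ∀ q q' : TotalSpace Circle Q, q.proj = q'.proj →
      IsSmoothMapAt Y (E × Line) (fun x => χ x q) x₀ →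
      IsSmoothMapAt Y (E × Line) (fun x => χ x q') x₀ := by
    intro q q' hq hs
    obtain ⟨z, rfl⟩ := exists_eq_rot F hq
    refine ((isSmoothMapAt_const z).rot hs).congr (Eventually.of_forall fun x => ?_)
    exact ((hχ x).equivariant z q).symm
  have hall : ∀ n, S n := by
    intro n
    refine (isPreconnected_univ.induction₂ (fun a b : N => S a ↔ S b) (fun n₁ _ => ?_)
      (fun _ _ _ _ _ _ => Iff.trans) (fun _ _ _ _ => Iff.symm) (mem_univ q₀.proj)
      (mem_univ n)).1 fun q hq => hrot q₀ q hq.symm h₀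
    obtain ⟨V, hV, hnV, hVe, h⟩ := smoothAt_family_of_smoothAt_fibre hθ hη hf hχ x₀ n₁
      (trivializationAt Circle Q n₁) (FiberBundle.mem_baseSet_trivializationAt' _)
    have hstep : ∀ a ∈ V, ∀ b ∈ V, S a → S b := by
      intro a ha b hb hSa q hq
      have h1 := h a ha (hSa _ (unitSection_proj _ (hVe ha))) b hb
      refine hrot _ q ((unitSection_proj _ (hVe hb)).trans hq.symm)
        (IsSmoothMapAt.comp (f := fun x : X => (x, b)) h1
        ((isSmoothMap_id x₀).prodMk (isSmoothMapAt_const b)))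
    exact nhdsWithin_le_nhds (mem_of_superset (hV.mem_nhds hnV) fun y hy =>
      ⟨hstep n₁ hnV y hy, hstep y hy n₁ hnV⟩)
  set e := trivializationAt Circle Q q.proj with he
  have hq : q.proj ∈ e.baseSet := FiberBundle.mem_baseSet_trivializationAt' _
  obtain ⟨V, hV, hnV, hVe, h⟩ := smoothAt_family_of_smoothAt_fibre hθ hη hf hχ x₀ q.proj e hq
  have h1 := h q.proj hnV (hall _ _ (unitSection_proj _ hq)) q.proj hnV
  have hfst : IsSmoothMapAt (Y × (F × Line)) Y (Prod.fst : X × TotalSpace Circle Q → X) (x₀, q) :=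
    isSmoothMapAt_fst
  have hsnd : IsSmoothMapAt (Y × (F × Line)) (F × Line)
    (Prod.snd : X × TotalSpace Circle Q → TotalSpace Circle Q) (x₀, q) := isSmoothMapAt_snd
  have h2 := IsSmoothMapAt.comp (f := fun p : X × TotalSpace Circle Q => (p.1, p.2.proj)) h1
    (hfst.prodMk hsnd.proj)
  refine ((hsnd.trivialization e hq).rot h2).congr ?_
  filter_upwards [eventually_mem_baseSet (E := F) e hsnd.proj.1 hq] with p hp
  conv_rhs => rw [eq_rot_unitSection F e hp, (hχ p.1).equivariant]
  rfl

end SmoothDependence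

/-! ### Existence of parallel maps -/

section Existence

set_option linter.unusedSectionVars false

variable {E : Type*} [AddCommGroup E] [Module ℝ E] [TopologicalSpace E]
  [IsTopologicalAddGroup E] [ContinuousSMul ℝ E] [LocallyConvexSpace ℝ E] [T2Space E]
  {M : Type*} [TopologicalSpace M] [ChartedSpace E M] [hM : IsLCManifold E M]
  {P : M → Type*} [∀ x, TopologicalSpace (P x)] [TopologicalSpace (TotalSpace Circle P)]
  [FiberBundle Circle P] [∀ x, MulAction Circle (P x)] [hP : IsSmoothCircleBundle E P]
  {F : Type*} [AddCommGroup F] [Module ℝ F] [TopologicalSpace F]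
  [IsTopologicalAddGroup F] [ContinuousSMul ℝ F] [LocallyConvexSpace ℝ F] [T2Space F]
  {N : Type*} [TopologicalSpace N] [ChartedSpace F N] [hN : IsLCManifold F N] [ConnectedSpace N]
  {Q : N → Type*} [∀ x, TopologicalSpace (Q x)] [TopologicalSpace (TotalSpace Circle Q)]
  [FiberBundle Circle Q] [∀ x, MulAction Circle (Q x)] [hQ : IsSmoothCircleBundle F Q]
  {θ : TotalSpace Circle P → E × Line → ℝ} {η : TotalSpace Circle Q → F × Line → ℝ}

include hM hP hN hQ

/-- Parallel maps are smooth: a single map is a constant family, with parameter space `ℝ`. -/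
theorem IsParallelMap.isSmoothMap (hθ : IsConnection E θ) (hη : IsConnection F η)
    {f : N → M} (hf : IsSmoothMap F E f) {χ : TotalSpace Circle Q → TotalSpace Circle P}
    (h : IsParallelMap η θ f χ) : IsSmoothMap (F × Line) (E × Line) χ := by
  intro q
  have hf' : IsSmoothMap (ℝ × F) E (fun p : ℝ × N => f p.2) := fun p =>
    IsSmoothMapAt.comp (hf p.2) isSmoothMapAt_snd
  have := smoothAt_family (X := ℝ) (Y := ℝ) hθ hη hf' (χ := fun _ => χ) (fun _ => h) (x₀ := 0)
    (q₀ := q) (isSmoothMapAt_const _) q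
  exact IsSmoothMapAt.comp (f := fun q : TotalSpace Circle Q => ((0 : ℝ), q)) this
    ((isSmoothMapAt_const _).prodMk (isSmoothMap_id q))

omit hM hP hN hQ [FiberBundle Circle P] [FiberBundle Circle Q] [ConnectedSpace N] in
theorem boundaryOne_single (c : SmoothPath F N) :
    boundaryOne F N (Finsupp.single c 1) =
      Finsupp.single (c.1 1) 1 - Finsupp.single (c.1 0) 1 := by
  simp only [boundaryOne, Finsupp.liftAddHom_apply_single, zmultiplesHom_apply, one_smul]

omit hM hP hQ [FiberBundle Circle P] [FiberBundle Circle Q] in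
/-- Every point of a connected manifold is joined to a given point by a smooth singular
`1`-chain. -/
theorem exists_chain (n₀ n : N) :
    ∃ C : SmoothPath F N →₀ ℤ, boundaryOne F N C = Finsupp.single n 1 - Finsupp.single n₀ 1 := by
  refine smoothCurve_induction (F := F) (S := fun n => ∃ C : SmoothPath F N →₀ ℤ,
    boundaryOne F N C = Finsupp.single n 1 - Finsupp.single n₀ 1) (n₀ := n₀) ⟨0, by simp⟩
    (fun γ hγ hS => ?_) n
  obtain ⟨C, hC⟩ := hS
  obtain ⟨c, hc0, hc1⟩ : ∃ c : SmoothPath F N, c.1 0 = γ 0 ∧ c.1 1 = γ 1 :=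
    ⟨⟨fun t => γ t, γ, hγ, fun _ => rfl⟩, rfl, rfl⟩
  refine ⟨C + Finsupp.single c 1, ?_⟩
  rw [map_add, hC, boundaryOne_single, hc0, hc1]
  abel

/-- Existence of parallel maps: if the holonomies of two circle bundles with connection are
compatible with a map `f` of the base manifolds, the discrepancy of the parallel transports along a
path in `N` and along its image, relative to reference points, only depends on the end points; it
is compensated by a function on `N`. -/
theorem exists_parallelMap (hθ : IsConnection E θ) (hη : IsConnection F η)
    {f : N → M} (hf : IsSmoothMap F E f)
    (hol : ∀ c : OneCycles F N, holonomy η c = holonomy θ (OneCycles.map f hf c)) :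
    ∃ χ : TotalSpace Circle Q → TotalSpace Circle P, IsParallelMap η θ f χ := by
  set r : SmoothPath F N → Circle := fun c => transport θ (c.map f hf) / transport η c with hr
  set R : (SmoothPath F N →₀ ℤ) → Circle := fun C => C.prod fun c n => r c ^ n with hR
  have hRadd : ∀ C D, R (C + D) = R C * R D := fun C D =>
    Finsupp.prod_add_index' (fun _ => zpow_zero _) (fun _ _ _ => zpow_add _ _ _)
  -- equality of the holonomies says that the total discrepancy of a cycle is trivial
  have hRone : ∀ C, boundaryOne F N C = 0 → R C = 1 := by
    intro C hC
    have h1 := hol ⟨C, hC⟩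
    have h2 : holonomy η ⟨C, hC⟩ = C.prod fun c n => transport η c ^ n := rfl
    have h3 : holonomy θ (OneCycles.map f hf ⟨C, hC⟩) =
        (Finsupp.mapDomain (SmoothPath.map f hf) C).prod fun c n => transport θ c ^ n := rfl
    rw [Finsupp.prod_mapDomain_index (fun _ => zpow_zero _) (fun _ _ _ => zpow_add _ _ _)] at h3
    have h4 : R C = (C.prod fun c n => transport θ (c.map f hf) ^ n) /
        C.prod fun c n => transport η c ^ n := by
      simp only [hR, hr, Finsupp.prod, div_zpow, Finset.prod_div_distrib]
    rw [h4, ← h3, ← h2, h1, div_self']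
  obtain ⟨n₀⟩ : Nonempty N := inferInstance
  choose C hC using exists_chain (F := F) n₀
  set k : N → Circle := fun n => R (C n) with hk
  -- hence the discrepancy along `c` is the variation of `k`, the discrepancy of chains from `n₀`
  have hkey : ∀ c : SmoothPath F N, k (c.1 1) = k (c.1 0) * r c := by
    intro c
    have h1 := hRone (C (c.1 0) + Finsupp.single c 1 + -C (c.1 1)) (by
      rw [map_add, map_add, map_neg, hC, hC]
      rw [boundaryOne_single]
      abel)
    have h2 : R (-C (c.1 1)) * R (C (c.1 1)) = 1 := by
      rw [← hRadd, neg_add_cancel]; exact hRone 0 (map_zero _)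
    have h3 : R (Finsupp.single c 1) = r c := by
      simp [hR, Finsupp.prod_single_index]
    rw [hRadd, hRadd, h3] at h1
    rw [hk]
    calc R (C (c.1 1)) = (R (C (c.1 0)) * r c * R (-C (c.1 1))) * R (C (c.1 1)) := by
          rw [h1, one_mul]
      _ = R (C (c.1 0)) * r c := by rw [mul_assoc, h2, mul_one]
  set χ : TotalSpace Circle Q → TotalSpace Circle P := fun q =>
    rot (k q.proj * (trivializationAt Circle Q q.proj q).2) (refPoint P (f q.proj)) with hχ
  have hproj : ∀ q, (χ q).proj = f q.proj := fun q => by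
    rw [hχ]; exact refPoint_proj (P := P) _
  have hbase : ∀ n : N, n ∈ (trivializationAt Circle Q n).baseSet := fun n =>
    FiberBundle.mem_baseSet_trivializationAt' n
  have heq : ∀ q : TotalSpace Circle Q,
      q = rot (trivializationAt Circle Q q.proj q).2 (refPoint Q q.proj) := fun q =>
    eq_rot_unitSection F (trivializationAt Circle Q q.proj) (hbase _)
  have hequi : ∀ z q, χ (rot z q) = rot z (χ q) := by
    intro z q
    simp only [hχ, rot_proj]
    rw [trivialization_rot F _ z (hbase _), ← rot_mul]
    congr 2
    exact mul_left_comm _ _ _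
  have hpar : ∀ (c : SmoothPath F N) (q q' : TotalSpace Circle Q), q.proj = c.1 0 →
      q'.proj = c.1 1 → IsParallel η c q q' → IsParallel θ (c.map f hf) (χ q) (χ q') := by
    intro c q q' hq hq' h
    have h1 := heq q
    have h2 := heq q'
    have h3 := (hη.isParallel_rot_refPoint_iff c
      (z := (trivializationAt Circle Q q.proj q).2)
      (w := (trivializationAt Circle Q q'.proj q').2)).1 (by
        rw [← hq, ← hq', ← h1, ← h2]; exact h)
    have h4 := (hθ.isParallel_rot_refPoint_iff (c.map f hf)
      (z := k q.proj * (trivializationAt Circle Q q.proj q).2)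
      (w := k q'.proj * (trivializationAt Circle Q q'.proj q').2)).2 (by
        rw [h3, hq', hq, hkey c, hr]
        simp only [div_eq_mul_inv]
        rw [show ∀ a b c d : Circle, a * (b * c⁻¹) * (d * c) = a * d * b * (c⁻¹ * c) by
          intro a b c d
          rw [mul_comm d c, mul_assoc, mul_assoc, mul_assoc, mul_assoc, ← mul_assoc c⁻¹ c d,
            inv_mul_cancel, mul_one, one_mul, mul_comm b d], inv_mul_cancel, mul_one])
    rw [hχ]
    simp only [hq, hq'] at h4 ⊢
    exact h4
  refine ⟨χ, hequi, hproj, fun γ hγ => ?_⟩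
  obtain ⟨Γ, hΓ, hΓf, hΓ0⟩ := hθ.exists_horizontal_lift
    (f := fun t => f (γ t).proj) (fun t => IsSmoothMapAt.comp (hf _) (hγ t).1.proj)
    (hproj (γ 0))
  have hscale : ∀ a t : ℝ, IsSmoothMapAt ℝ ℝ (fun s : ℝ => a * s) t := fun a t =>
    isSmoothMap_of_contDiff (contDiff_const.mul contDiff_id) t
  have hscale' : ∀ a t : ℝ, tmap ℝ ℝ (fun s : ℝ => a * s) t 1 = a • 1 := fun a t => by
    rw [tmap_real_eq_deriv ((hasDerivAt_id' t).const_mul a), smul_eq_mul]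
  -- the path `s ↦ γ (a s)`, `0 ≤ s ≤ 1`, ends at `γ a`
  have hpt : ∀ a : ℝ, χ (γ a) = Γ a := by
    intro a
    have hγa : ∀ s, IsHorizontalAt η (γ ∘ fun s => a * s) s := fun s => by
      refine ⟨(hγ _).1.comp (hscale a s), ?_⟩
      rw [tmap_comp (hγ (a * s)).1 (hscale a s), hscale',
        (isLinearMap_tmap (hγ (a * s)).1).map_smul, (hη.isOneForm.1 _).map_smul]
      exact (congrArg (a • ·) (hγ (a * s)).2).trans (smul_zero a)
    have hΓa : ∀ s, IsHorizontalAt θ (Γ ∘ fun s => a * s) s := fun s => by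
      refine ⟨(hΓ _).1.comp (hscale a s), ?_⟩
      rw [tmap_comp (hΓ (a * s)).1 (hscale a s), hscale',
        (isLinearMap_tmap (hΓ (a * s)).1).map_smul, (hθ.isOneForm.1 _).map_smul]
      exact (congrArg (a • ·) (hΓ (a * s)).2).trans (smul_zero a)
    let c : SmoothPath F N := ⟨fun t => (γ (a * t)).proj, fun t => (γ (a * t)).proj,
      fun t => (hγa t).1.proj, fun _ => rfl⟩
    have h1 := isParallel_of_horizontal hγa c fun _ => rfl
    have h2 := isParallel_of_horizontal hΓa (c.map f hf) fun t => hΓf _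
    have h3 := hpar c _ _ rfl rfl h1
    simp only [Function.comp_apply, Set.Icc.coe_zero, Set.Icc.coe_one, mul_zero, mul_one,
      hΓ0] at h2 h3
    exact hθ.isParallel_unique h3 h2
  intro t
  rw [show χ ∘ γ = Γ from funext hpt]
  exact hΓ t

/-- Existence of parallel maps with a prescribed value. -/
theorem exists_parallelMap_apply_eq (hθ : IsConnection E θ) (hη : IsConnection F η)
    {f : N → M} (hf : IsSmoothMap F E f)
    (hol : ∀ c : OneCycles F N, holonomy η c = holonomy θ (OneCycles.map f hf c))
    {q₀ : TotalSpace Circle Q} {p₀ : TotalSpace Circle P} (h₀ : p₀.proj = f q₀.proj) :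
    ∃ χ : TotalSpace Circle Q → TotalSpace Circle P, IsParallelMap η θ f χ ∧ χ q₀ = p₀ := by
  obtain ⟨χ, hχ⟩ := exists_parallelMap hθ hη hf hol
  obtain ⟨z, hz⟩ := exists_eq_rot E ((hχ.covers q₀).trans h₀.symm)
  refine ⟨fun q => rot z (χ q), ⟨fun w q => ?_, fun q => hχ.covers q, fun γ hγ t =>
    (hχ.horizontal γ hγ t).rot hθ z⟩, hz.symm⟩
  rw [hχ.equivariant, rot_comm]

end Existence

/-! ### Pull-backs of forms along smooth maps -/

section PullbackForms

set_option linter.unusedSectionVars false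

variable {V : Type*} [AddCommGroup V] [Module ℝ V] [TopologicalSpace V]
  [IsTopologicalAddGroup V] [ContinuousSMul ℝ V] [LocallyConvexSpace ℝ V] [T2Space V]
  {E : Type*} [AddCommGroup E] [Module ℝ E] [TopologicalSpace E]
  [IsTopologicalAddGroup E] [ContinuousSMul ℝ E] [LocallyConvexSpace ℝ E] [T2Space E]
  {M : Type*} [TopologicalSpace M] [ChartedSpace E M] [IsLCManifold E M]
  {Z : Type*} [TopologicalSpace Z] [ChartedSpace V Z] [IsLCManifold V Z]

theorem IsOneForm.pullback {α : M → E → ℝ} (hα : IsOneForm α) {Λ : Z → M}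
    (hΛ : IsSmoothMap V E Λ) : IsOneForm fun z v => α (Λ z) (tmap V E Λ z v) := by
  refine ⟨fun z => ⟨fun v w => ?_, fun c v => ?_⟩, fun e he => ?_⟩
  · beta_reduce
    rw [(isLinearMap_tmap (hΛ z)).map_add, (hα.1 _).map_add]
  · beta_reduce
    rw [(isLinearMap_tmap (hΛ z)).map_smul, (hα.1 _).map_smul]
  · have hΨ : IsSmoothMapOn V E (Λ ∘ e.symm) e.target := fun y hy =>
      (hΛ _).comp (isSmoothMapAt_chart_symm he hy)
    refine (hα.isSmoothOn_pullback e.open_target hΨ).congr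
      (e.open_target.prod isOpen_univ) fun p hp => ?_
    simp only
    rw [tmap_comp (hΛ _) (isSmoothMapAt_chart_symm he hp.1), Function.comp_apply]

end PullbackForms

/-! ### Equivariant bundle maps -/

section BundleMaps

set_option linter.unusedSectionVars false

variable {E : Type*} [AddCommGroup E] [Module ℝ E] [TopologicalSpace E]
  [IsTopologicalAddGroup E] [ContinuousSMul ℝ E] [LocallyConvexSpace ℝ E] [T2Space E]
  {M : Type*} [TopologicalSpace M] [ChartedSpace E M]
  {P : M → Type*} [∀ x, TopologicalSpace (P x)] [TopologicalSpace (TotalSpace Circle P)]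
  [FiberBundle Circle P] [∀ x, MulAction Circle (P x)] [hP : IsSmoothCircleBundle E P]
  {F : Type*} [AddCommGroup F] [Module ℝ F] [TopologicalSpace F]
  [IsTopologicalAddGroup F] [ContinuousSMul ℝ F] [LocallyConvexSpace ℝ F] [T2Space F]
  {N : Type*} [TopologicalSpace N] [ChartedSpace F N]
  {Q : N → Type*} [∀ x, TopologicalSpace (Q x)] [TopologicalSpace (TotalSpace Circle Q)]
  [FiberBundle Circle Q] [∀ x, MulAction Circle (Q x)] [hQ : IsSmoothCircleBundle F Q]
  {θ : TotalSpace Circle P → E × Line → ℝ} {η : TotalSpace Circle Q → F × Line → ℝ}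
  {V : Type*} [AddCommGroup V] [Module ℝ V] [TopologicalSpace V]
  [IsTopologicalAddGroup V] [ContinuousSMul ℝ V] [LocallyConvexSpace ℝ V] [T2Space V]
  {X : Type*} [TopologicalSpace X] [ChartedSpace V X]
  {f : N → M} {Λ : TotalSpace Circle Q → TotalSpace Circle P}

include hP hQ

/-- Equivariant bundle maps are injective on fibres. -/
theorem eq_of_bundleMap_apply_eq (hequi : ∀ z q, Λ (rot z q) = rot z (Λ q))
    {q q' : TotalSpace Circle Q} (hq : q.proj = q'.proj) (h : Λ q = Λ q') : q = q' := by
  obtain ⟨z, rfl⟩ := exists_eq_rot F hq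
  rw [hequi] at h
  have : (1 : Circle) = z := rot_injective E (p := Λ q) (by rw [rot_one]; exact h)
  rw [← this, rot_one]

/-- Equivariant bundle maps are surjective on fibres. -/
theorem exists_bundleMap_apply_eq (hequi : ∀ z q, Λ (rot z q) = rot z (Λ q))
    (hcov : ∀ q, (Λ q).proj = f q.proj) (n : N) {p : TotalSpace Circle P} (h : p.proj = f n) :
    ∃ q : TotalSpace Circle Q, q.proj = n ∧ Λ q = p := by
  set e := trivializationAt Circle Q n
  have h1 : (unitSection e n).proj = n :=
    unitSection_proj e (FiberBundle.mem_baseSet_trivializationAt' n)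
  obtain ⟨z, hz⟩ := exists_eq_rot E (p := Λ (unitSection e n)) (q := p) (by rw [hcov, h1, h])
  exact ⟨rot z (unitSection e n), h1, by rw [hequi, hz]⟩

/-- A smooth equivariant bundle map `Λ : Q → P` identifies `Q` with the pull-back of `P`: a map to
`Q` is smooth if its compositions with `Λ` and with the bundle projection are smooth. -/
theorem smoothAt_of_bundleMap (hΛ : IsSmoothMap (F × Line) (E × Line) Λ)
    (hequi : ∀ z q, Λ (rot z q) = rot z (Λ q)) {k : X → TotalSpace Circle Q} {x : X}
    (h₁ : IsSmoothMapAt V F (fun y => (k y).proj) x)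
    (h₂ : IsSmoothMapAt V (E × Line) (fun y => Λ (k y)) x) : IsSmoothMapAt V (F × Line) k x := by
  -- `k` differs from a local section along its projection by a function that can be read off from
  -- the images under `Λ`
  set e := trivializationAt Circle Q (k x).proj
  have hx : (k x).proj ∈ e.baseSet := FiberBundle.mem_baseSet_trivializationAt' _
  have hs : IsSmoothMapAt V (F × Line) (fun y => unitSection e (k y).proj) x := h₁.unitSection e hx
  have hk : ∀ᶠ y in 𝓝 x, k y = rot (e (k y)).2 (unitSection e (k y).proj) := by
    filter_upwards [eventually_mem_baseSet (E := F) e h₁.1 hx] with y hy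
    exact eq_rot_unitSection F e hy
  obtain ⟨κ, hκ, h⟩ := (IsSmoothMapAt.comp (hΛ _) hs).exists_rot h₂ (by
    filter_upwards [hk] with y hy
    conv_rhs => rw [hy, hequi]
    rfl)
  refine (hκ.rot hs).congr ?_
  filter_upwards [h, hk] with y hy hy'
  refine eq_of_bundleMap_apply_eq (E := E) (F := F) hequi ?_ ?_
  · rw [rot_proj]; conv_rhs => rw [hy']
    rfl
  · rw [hequi, hy]; rfl

variable [hM : IsLCManifold E M] [hN : IsLCManifold F N]

include hM hN

/-- The pull-back of a connection form along a smooth equivariant bundle map. -/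
theorem IsConnection.pullback (hθ : IsConnection E θ) (hΛ : IsSmoothMap (F × Line) (E × Line) Λ)
    (hequi : ∀ z q, Λ (rot z q) = rot z (Λ q)) :
    IsConnection F fun q v => θ (Λ q) (tmap (F × Line) (E × Line) Λ q v) where
  isOneForm := by
    have hLP := isLCManifold_totalSpace (E := E) (P := P)
    have hLQ := isLCManifold_totalSpace (E := F) (P := Q)
    exact hθ.isOneForm.pullback hΛ
  invariant z q v := by
    have h : Λ ∘ rot z = rot z ∘ Λ := funext fun q => hequi z q
    rw [← tmap_comp (hΛ _) (isSmoothMap_rot z q), h, tmap_comp (isSmoothMap_rot z _) (hΛ q), hequi]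
    exact hθ.invariant z _ _
  normalized q := by
    have h : Λ ∘ (fun t : ℝ => rot (Circle.exp (2 * Real.pi * t)) q) =
        fun t : ℝ => rot (Circle.exp (2 * Real.pi * t)) (Λ q) := funext fun t => hequi _ q
    have h1 : IsSmoothMapAt ℝ (F × Line)
        (fun t : ℝ => rot (Circle.exp (2 * Real.pi * t)) q) 0 :=
      (isSmoothMap_circleExp 0).rot (isSmoothMapAt_const q)
    have h2 : rot (Circle.exp (2 * Real.pi * 0)) q = q := by simp
    have h3 := tmap_comp (g := Λ) (f := fun t : ℝ => rot (Circle.exp (2 * Real.pi * t)) q)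
      (hΛ _) h1 1
    rw [h, h2] at h3
    rw [← h3]
    exact hθ.normalized _

omit hP hQ hM hN in
/-- Smooth bundle maps that preserve the connection forms are compatible with parallel transport. -/
theorem IsParallel.map (hf : IsSmoothMap F E f) (hΛ : IsSmoothMap (F × Line) (E × Line) Λ)
    (hcov : ∀ q, (Λ q).proj = f q.proj)
    (hpres : ∀ q v, θ (Λ q) (tmap (F × Line) (E × Line) Λ q v) = η q v) {c : SmoothPath F N}
    {p q : TotalSpace Circle Q} (h : IsParallel η c p q) :
    IsParallel θ (c.map f hf) (Λ p) (Λ q) := by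
  obtain ⟨γ, hγ, rfl, rfl, h⟩ := h
  refine ⟨Λ ∘ γ, fun t => (hΛ _).comp (hγ t), rfl, rfl, fun t => ⟨?_, ?_⟩⟩
  · rw [Function.comp_apply, hcov, (h t).1]; rfl
  · rw [tmap_comp (hΛ _) (hγ t), Function.comp_apply, hpres, (h t).2]

end BundleMaps

/-! ### Pull-back bundles and their holonomy -/

section PullbackBundle

set_option linter.unusedSectionVars false

variable {E : Type*} [AddCommGroup E] [Module ℝ E] [TopologicalSpace E]
  [IsTopologicalAddGroup E] [ContinuousSMul ℝ E] [LocallyConvexSpace ℝ E] [T2Space E]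
  {M : Type*} [TopologicalSpace M] [ChartedSpace E M]
  {P : M → Type*} [∀ x, TopologicalSpace (P x)] [TopologicalSpace (TotalSpace Circle P)]
  [FiberBundle Circle P] [∀ x, MulAction Circle (P x)] [∀ x, Nonempty (P x)]
  [hP : IsSmoothCircleBundle E P]
  {F : Type*} [AddCommGroup F] [Module ℝ F] [TopologicalSpace F]
  [IsTopologicalAddGroup F] [ContinuousSMul ℝ F] [LocallyConvexSpace ℝ F] [T2Space F]
  {N : Type*} [TopologicalSpace N] [ChartedSpace F N]
  {ψ : C(N, M)} {θ : TotalSpace Circle P → E × Line → ℝ}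

theorem lift_rot (z : Circle) (q : TotalSpace Circle ((ψ : N → M) *ᵖ P)) :
    Pullback.lift ψ (rot z q) = rot z (Pullback.lift ψ q) := rfl

instance instMemTrivializationAtlasPullback (e : Trivialization Circle (π Circle P))
    [he : MemTrivializationAtlas e] : MemTrivializationAtlas (e.pullback ψ) :=
  ⟨⟨e, he, rfl⟩⟩

theorem pullback_symm_apply (e : Trivialization Circle (π Circle P)) {n : N}
    (hn : ψ n ∈ e.baseSet) :
    Pullback.lift ψ ((e.pullback ψ).toOpenPartialHomeomorph.symm (n, 1)) = unitSection e (ψ n) :=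
  e.mk_symm hn 1

/-- The canonical map `ψ^*P → P` respects reference points, because the preferred trivialization of
the pull-back at `n` is the pull-back of the preferred trivialization at `ψ n`. -/
theorem lift_refPoint (n : N) :
    Pullback.lift ψ (refPoint ((ψ : N → M) *ᵖ P) n) = refPoint P (ψ n) :=
  pullback_symm_apply (trivializationAt Circle P (ψ n))
    (FiberBundle.mem_baseSet_trivializationAt' _)

variable (hψ : IsSmoothMap F E ψ)

include hP hψ

theorem isSmoothCircleBundle_pullback : IsSmoothCircleBundle F ((ψ : N → M) *ᵖ P) where
  equivariant d hd n hn z p := by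
    obtain ⟨e, he, rfl⟩ := hd.out
    exact hP.equivariant e (ψ n) hn z p
  smooth_transition d d' hd hd' n hn := by
    obtain ⟨e, he, rfl⟩ := hd.out
    obtain ⟨e', he', rfl⟩ := hd'.out
    refine (IsSmoothMapAt.comp (f := ψ) (hP.smooth_transition e e' (ψ n) hn) (hψ n)).congr ?_
    filter_upwards [(hψ n).1.eventually (e.open_baseSet.mem_nhds hn.1)] with y hy
    have := congrArg (fun p => (e' p).2) (pullback_symm_apply e hy)
    exact this.symm

theorem isSmoothMap_lift : IsSmoothMap (F × Line) (E × Line)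
    (Pullback.lift ψ : TotalSpace Circle ((ψ : N → M) *ᵖ P) → TotalSpace Circle P) := by
  have hB := isSmoothCircleBundle_pullback (P := P) hψ
  intro q
  set e := trivializationAt Circle P (ψ q.proj) with he
  have hq : ψ q.proj ∈ e.baseSet := FiberBundle.mem_baseSet_trivializationAt' _
  have hid : IsSmoothMapAt (F × Line) (F × Line)
    (fun q : TotalSpace Circle ((ψ : N → M) *ᵖ P) => q) q := isSmoothMap_id q
  exact (smoothAt_totalSpace_iff e hq).2 ⟨IsSmoothMapAt.comp (g := ψ) (hψ _) hid.proj,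
    hid.trivialization (e.pullback ψ) hq⟩

variable [hM : IsLCManifold E M] [hN : IsLCManifold F N]

include hM hN

theorem IsConnection.pullbackForm (hθ : IsConnection E θ) :
    IsConnection F (pullbackForm (F := F) ψ θ) := by
  have hB := isSmoothCircleBundle_pullback (P := P) hψ
  exact hθ.pullback (isSmoothMap_lift hψ) lift_rot

/-- The holonomy of the pull-back of a bundle with connection is the pull-back of the holonomy. -/
theorem holonomy_pullbackForm (hθ : IsConnection E θ) :
    holonomy (LC.pullbackForm (F := F) ψ θ) = pullbackCharacter ψ hψ (holonomy θ) := by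
  have hB := isSmoothCircleBundle_pullback (P := P) hψ
  have h : ∀ c : SmoothPath F N,
      transport (LC.pullbackForm (F := F) ψ θ) c = transport θ (c.map ψ hψ) := by
    intro c
    have h1 := ((hθ.pullbackForm hψ).isParallel_transport c).map (θ := θ) hψ
      (isSmoothMap_lift hψ) (fun _ => rfl) (fun _ _ => rfl)
    rw [lift_rot, lift_refPoint, lift_refPoint] at h1
    exact rot_injective E (hθ.isParallel_unique h1 (hθ.isParallel_transport (c.map ψ hψ)))
  ext1 c
  have h3 : pullbackCharacter ψ hψ (holonomy θ) c =
      (Finsupp.mapDomain (SmoothPath.map ψ hψ) c.1).prod fun c n => transport θ c ^ n := rfl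
  rw [Finsupp.prod_mapDomain_index (fun _ => zpow_zero _) (fun _ _ _ => zpow_add _ _ _)] at h3
  rw [h3]
  exact Finsupp.prod_congr fun c _ => by rw [h]

end PullbackBundle

/-! ### Automorphisms covering the group action -/

section Automorphisms

set_option linter.unusedSectionVars false

variable {EG : Type*} [AddCommGroup EG] [Module ℝ EG] [TopologicalSpace EG]
  [IsTopologicalAddGroup EG] [ContinuousSMul ℝ EG] [LocallyConvexSpace ℝ EG] [T2Space EG]
  {G : Type*} [TopologicalSpace G] [ChartedSpace EG G] [Group G]
  {E : Type*} [AddCommGroup E] [Module ℝ E] [TopologicalSpace E]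
  [IsTopologicalAddGroup E] [ContinuousSMul ℝ E] [LocallyConvexSpace ℝ E] [T2Space E]
  {M : Type*} [TopologicalSpace M] [ChartedSpace E M] [hM : IsLCManifold E M]
  [MulAction G M] [hA : IsSmoothAction EG E G M]
  {P : M → Type*} [∀ x, TopologicalSpace (P x)] [TopologicalSpace (TotalSpace Circle P)]
  [FiberBundle Circle P] [∀ x, MulAction Circle (P x)] [∀ x, Nonempty (P x)]
  [hP : IsSmoothCircleBundle E P]
  {θ : TotalSpace Circle P → E × Line → ℝ}

omit hM in
theorem isSmoothMap_orbitMap (x : M) : IsSmoothMap EG E (orbitMap EG G E x) := fun g =>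
  IsSmoothMapAt.comp (g := fun q : G × M => q.1 • q.2) (f := fun g : G => (g, x))
    (hA.smooth_smul _) ((isSmoothMap_id g).prodMk (isSmoothMapAt_const x))

theorem isParallelMap_extensionGroup (a : extensionGroup G θ) :
    IsParallelMap θ θ (fun x : M => a.1.1 • x) a.1.2 :=
  .of_isSmoothMap a.2.2.2.1 a.2.2.2.2.1 a.2.1 a.2.2.2.2.2

omit [∀ x, Nonempty (P x)] in
theorem isParallelMap_rot (hM' : IsLCManifold E M) (hP' : IsSmoothCircleBundle E P)
    (hθ : IsConnection E θ) (z : Circle) : IsParallelMap θ θ (fun x : M => x) (rot z) :=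
  .of_isSmoothMap (fun w p => rot_comm z w p) (fun _ => rfl) (isSmoothMap_rot z) (hθ.invariant z)

variable [ConnectedSpace M]

include hM hP

/-- Two automorphisms that cover the action of the same element and agree at one point are equal. -/
theorem extensionGroup_ext (hθ : IsConnection E θ) {a b : extensionGroup G θ}
    (h : a.1.1 = b.1.1) {p : TotalSpace Circle P} (hp : a.1.2 p = b.1.2 p) : a = b := by
  have h1 := isParallelMap_extensionGroup a
  have h2 := isParallelMap_extensionGroup b
  rw [h] at h1
  exact Subtype.ext (Prod.ext h (DFunLike.coe_injective (h1.eq_of_apply_eq hθ hθ h2 hp)))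

include hA

/-- If the holonomy is invariant, every element of `G` is covered by an automorphism of the bundle
with connection, with a prescribed value at one point. -/
theorem exists_extensionGroup (hθ : IsConnection E θ)
    (hinv : IsInvariantCharacter EG G (holonomy θ)) (g : G) {p p' : TotalSpace Circle P}
    (h : p'.proj = g • p.proj) : ∃ a : extensionGroup G θ, a.1.1 = g ∧ a.1.2 p = p' := by
  have key : ∀ (g : G) (p p' : TotalSpace Circle P), p'.proj = g • p.proj →
      ∃ χ : TotalSpace Circle P → TotalSpace Circle P,
        IsParallelMap θ θ (fun x : M => g • x) χ ∧ χ p = p' := fun g p p' h =>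
    exists_parallelMap_apply_eq hθ hθ (IsSmoothAction.isSmoothMap_smul EG G hA g)
      (fun c => (DFunLike.congr_fun (hinv g) c).symm) h
  obtain ⟨χ, hχ, hχp⟩ := key g p p' h
  obtain ⟨χ', hχ', hχp'⟩ := key g⁻¹ p' p (by rw [h, inv_smul_smul])
  -- by uniqueness, the parallel map `χ'` over the action of `g⁻¹` is inverse to `χ`
  have hid := isParallelMap_rot hM hP hθ 1
  have h1 : ∀ q, χ' (χ q) = q := by
    have : IsParallelMap θ θ (fun x : M => x) (χ' ∘ χ) :=
      ⟨fun z q => by simp [hχ.equivariant, hχ'.equivariant],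
        fun q => by simp [hχ.covers, hχ'.covers], fun γ hγ =>
        hχ'.horizontal _ (hχ.horizontal γ hγ)⟩
    have h2 := this.eq_of_apply_eq hθ hθ hid (q₀ := p) (by simp [hχp, hχp'])
    exact fun q => by simpa using congrFun h2 q
  have h2 : ∀ q, χ (χ' q) = q := by
    have : IsParallelMap θ θ (fun x : M => x) (χ ∘ χ') :=
      ⟨fun z q => by simp [hχ.equivariant, hχ'.equivariant],
        fun q => by simp [hχ.covers, hχ'.covers], fun γ hγ =>
        hχ.horizontal _ (hχ'.horizontal γ hγ)⟩
    have h2 := this.eq_of_apply_eq hθ hθ hid (q₀ := p') (by simp [hχp, hχp'])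
    exact fun q => by simpa using congrFun h2 q
  have hs : IsSmoothMap (E × Line) (E × Line) χ :=
    hχ.isSmoothMap hθ hθ (IsSmoothAction.isSmoothMap_smul EG G hA g)
  have hs' : IsSmoothMap (E × Line) (E × Line) χ' :=
    hχ'.isSmoothMap hθ hθ (IsSmoothAction.isSmoothMap_smul EG G hA g⁻¹)
  exact ⟨⟨(g, ⟨χ, χ', h1, h2⟩), hs, hs', hχ.equivariant, hχ.covers, hχ.preserves hθ hθ hs⟩,
    rfl, hχp⟩

/-- Evaluation at `p` identifies the extension with the pull-back of `P` along the orbit map. -/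
theorem bijective_evalAt (hθ : IsConnection E θ)
    (hinv : IsInvariantCharacter EG G (holonomy θ)) (p : TotalSpace Circle P) :
    Function.Bijective (evalAt (G := G) (θ := θ) EG p) := by
  refine ⟨fun a b h => ?_, fun y => ?_⟩
  · have h1 : a.1.1 = b.1.1 := congrArg TotalSpace.proj h
    refine extensionGroup_ext hθ h1 (p := p) ?_
    rw [← lift_evalAt EG p a, h, lift_evalAt]
  · have hB := isSmoothCircleBundle_pullback (P := P) (isSmoothMap_orbitMap (EG := EG) (E := E)
      (G := G) p.proj)
    obtain ⟨a, ha, hap⟩ := exists_extensionGroup (EG := EG) hθ hinv y.proj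
      (p := p) (p' := Pullback.lift (orbitMap EG G E p.proj) y) rfl
    refine ⟨a, ?_⟩
    have h1 := lift_evalAt EG p a
    rw [hap] at h1
    exact eq_of_bundleMap_apply_eq (E := E) (F := EG) lift_rot ha h1

end Automorphisms

/-! ### The manifold structure of the extension -/

section ExtensionManifold

set_option linter.unusedSectionVars false

variable {EG : Type*} [AddCommGroup EG] [Module ℝ EG] [TopologicalSpace EG]
  [IsTopologicalAddGroup EG] [ContinuousSMul ℝ EG] [LocallyConvexSpace ℝ EG] [T2Space EG]
  {G : Type*} [TopologicalSpace G] [ChartedSpace EG G] [Group G]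
  {E : Type*} [AddCommGroup E] [Module ℝ E] [TopologicalSpace E]
  [IsTopologicalAddGroup E] [ContinuousSMul ℝ E] [LocallyConvexSpace ℝ E] [T2Space E]
  {M : Type*} [TopologicalSpace M] [ChartedSpace E M]
  [MulAction G M] [hA : IsSmoothAction EG E G M]
  {P : M → Type*} [∀ x, TopologicalSpace (P x)] [TopologicalSpace (TotalSpace Circle P)]
  [FiberBundle Circle P] [∀ x, MulAction Circle (P x)] [∀ x, Nonempty (P x)]
  [hP : IsSmoothCircleBundle E P]
  {θ : TotalSpace Circle P → E × Line → ℝ} {p : TotalSpace Circle P}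
  [hb : Fact (Function.Bijective (evalAt (G := G) (θ := θ) EG p))]
  {V : Type*} [AddCommGroup V] [Module ℝ V] [TopologicalSpace V]
  [IsTopologicalAddGroup V] [ContinuousSMul ℝ V] [LocallyConvexSpace ℝ V] [T2Space V]
  {X : Type*} [TopologicalSpace X] [ChartedSpace V X]

/-- An element of the manifold `ExtensionAt EG θ p`, as an element of the group underlying it. -/
def ExtensionAt.val (a : ExtensionAt (G := G) EG θ p) : extensionGroup G θ := a

/-- The charts of the extension are those of the pull-back of `P`, composed with `evalAt`; hence
the two maps have the same expression in charts. -/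
theorem smoothAt_extensionAt_iff_evalAt {k : X → extensionGroup G θ} {x : X} :
    IsSmoothMapAt V (EG × Line) (N := ExtensionAt (G := G) EG θ p) k x ↔
      IsSmoothMapAt V (EG × Line) (fun y => evalAt EG p (k y)) x := by
  refine and_congr ?_ Iff.rfl
  exact (evalHomeomorph EG θ p hb.out).isInducing.continuousAt_iff

include hP in
/-- A map to the extension of `G` is smooth if its component in `G` and its value at the base
point `p` are smooth. -/
theorem smoothAt_extensionAt_iff {k : X → extensionGroup G θ} {x : X} :
    IsSmoothMapAt V (EG × Line) (N := ExtensionAt (G := G) EG θ p) k x ↔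
      IsSmoothMapAt V EG (fun y => (k y).1.1) x ∧
        IsSmoothMapAt V (E × Line) (fun y => (k y).1.2 p) x := by
  have hsm := isSmoothMap_orbitMap (EG := EG) (E := E) (G := G) p.proj
  have hB := isSmoothCircleBundle_pullback (P := P) hsm
  rw [smoothAt_extensionAt_iff_evalAt]
  have h : ∀ y, Pullback.lift (orbitMap EG G E p.proj) (evalAt EG p (k y)) = (k y).1.2 p :=
    fun y => lift_evalAt EG p (k y)
  constructor
  · intro hk
    refine ⟨hk.proj, ?_⟩
    simpa only [Function.comp_def, h] using (isSmoothMap_lift (P := P) hsm _).comp hk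
  · rintro ⟨h1, h2⟩
    refine smoothAt_of_bundleMap (isSmoothMap_lift (P := P) hsm) lift_rot h1 ?_
    simpa only [h] using h2

variable [hG : IsLCManifold EG G] [hM : IsLCManifold E M]

include hP hG hM

/-- The extension inherits the structure of a manifold from the pull-back of `P`. -/
theorem isLCManifold_extensionAt :
    IsLCManifold (EG × Line) (ExtensionAt (G := G) EG θ p) := by
  have hsm := isSmoothMap_orbitMap (EG := EG) (E := E) (G := G) p.proj
  have hB := isSmoothCircleBundle_pullback (P := P) hsm
  have hL := isLCManifold_totalSpace (E := EG) (P := ((orbitMap EG G E p.proj : G → M) *ᵖ P))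
  exact
  { toT2Space := by
      have := hL.toT2Space
      exact (evalHomeomorph EG θ p hb.out).symm.t2Space
    compatible := by
      rintro _ ⟨_, hd, c, hc, rfl⟩ _ ⟨_, hd', c', hc', rfl⟩
      have h1 := OpenPartialHomeomorph.singletonChartedSpace_mem_atlas_eq _ _ _ hd
      have h2 := OpenPartialHomeomorph.singletonChartedSpace_mem_atlas_eq _ _ _ hd'
      subst h1 h2
      set φ := evalHomeomorph (G := G) EG θ p hb.out
      have h3 := hL.compatible c hc c' hc'
      have hopen : IsOpen (c.target ∩ c.symm ⁻¹' c'.source) :=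
        c.isOpen_inter_preimage_symm c'.open_source
      have h4 : ((φ.toOpenPartialHomeomorph.trans c).target ∩
          (φ.toOpenPartialHomeomorph.trans c).symm ⁻¹' (φ.toOpenPartialHomeomorph.trans c').source) =
          c.target ∩ c.symm ⁻¹' c'.source := by
        ext y; simp
      rw [h4]
      exact h3.congr hopen fun y _ => by simp }

/-- The action of the extension of `G` on the bundle is smooth, since the automorphisms form a
family of parallel maps that depends smoothly on the parameter at the base point `p`. -/
theorem smoothAt_extensionAt_apply [ConnectedSpace M] (hθ : IsConnection E θ)
    {k : X → extensionGroup G θ} {l : X → TotalSpace Circle P} {x : X}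
    (hk : IsSmoothMapAt V (EG × Line) (N := ExtensionAt (G := G) EG θ p) k x)
    (hl : IsSmoothMapAt V (E × Line) l x) :
    IsSmoothMapAt V (E × Line) (fun y => (k y).1.2 (l y)) x := by
  have hL := isLCManifold_extensionAt (EG := EG) (G := G) (θ := θ) (p := p)
  have hid : ∀ a : ExtensionAt (G := G) EG θ p,
      IsSmoothMapAt (EG × Line) EG (fun b : ExtensionAt (G := G) EG θ p => b.val.1.1) a ∧
      IsSmoothMapAt (EG × Line) (E × Line)
        (fun b : ExtensionAt (G := G) EG θ p => b.val.1.2 p) a := fun a =>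
    smoothAt_extensionAt_iff.1 (isSmoothMap_id a)
  have hf : IsSmoothMap ((EG × Line) × E) E
      (fun q : ExtensionAt (G := G) EG θ p × M => q.1.val.1.1 • q.2) :=
    fun q => IsSmoothMapAt.comp (g := fun r : G × M => r.1 • r.2)
      (f := fun q : ExtensionAt (G := G) EG θ p × M => (q.1.val.1.1, q.2)) (hA.smooth_smul _)
      ((IsSmoothMapAt.comp (f := fun q : ExtensionAt (G := G) EG θ p × M => q.1) (hid q.1).1
        isSmoothMapAt_fst).prodMk isSmoothMapAt_snd)
  have h1 := smoothAt_family (X := ExtensionAt (G := G) EG θ p) hθ hθ hf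
    (χ := fun a => a.val.1.2)
    (fun a => isParallelMap_extensionGroup a.val) (x₀ := k x) (q₀ := p) (hid (k x)).2 (l x)
  exact IsSmoothMapAt.comp (g := fun q : ExtensionAt (G := G) EG θ p × TotalSpace Circle P =>
    q.1.val.1.2 q.2) (f := fun y => ((k y : ExtensionAt (G := G) EG θ p), l y)) h1
    (hk.prodMk hl)

end ExtensionManifold

/-! ### The central Lie group extension -/

section LieExtension

set_option linter.unusedSectionVars false

variable {EG : Type*} [AddCommGroup EG] [Module ℝ EG] [TopologicalSpace EG]
  [IsTopologicalAddGroup EG] [ContinuousSMul ℝ EG] [LocallyConvexSpace ℝ EG] [T2Space EG]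
  {G : Type*} [TopologicalSpace G] [ChartedSpace EG G] [Group G] [hG : IsLCLieGroup EG G]
  {E : Type*} [AddCommGroup E] [Module ℝ E] [TopologicalSpace E]
  [IsTopologicalAddGroup E] [ContinuousSMul ℝ E] [LocallyConvexSpace ℝ E] [T2Space E]
  {M : Type*} [TopologicalSpace M] [ChartedSpace E M] [hM : IsLCManifold E M] [ConnectedSpace M]
  [MulAction G M] [hA : IsSmoothAction EG E G M]
  {P : M → Type*} [∀ x, TopologicalSpace (P x)] [TopologicalSpace (TotalSpace Circle P)]
  [FiberBundle Circle P] [∀ x, MulAction Circle (P x)] [∀ x, Nonempty (P x)]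
  [hP : IsSmoothCircleBundle E P]
  {θ : TotalSpace Circle P → E × Line → ℝ}

/-- The inclusion `z ↦ (1, rot z)` of `𝕋` in the extension of `G`. -/
noncomputable def extensionIncl (hP : IsSmoothCircleBundle E P)
    (hθ : IsConnection E θ) : Circle →* extensionGroup G θ where
  toFun z := ⟨(1, rot z), isSmoothMap_rot z, by
      have h : ((rot z).symm : TotalSpace Circle P → TotalSpace Circle P) = rot z⁻¹ := by
        funext p
        rw [Equiv.symm_apply_eq, ← rot_mul, mul_inv_cancel, rot_one]
      rw [h]
      exact isSmoothMap_rot z⁻¹, fun w p => rot_comm z w p,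
    fun p => (one_smul G p.proj).symm, hθ.invariant z⟩
  map_one' := Subtype.ext (Prod.ext rfl (Equiv.ext rot_one))
  map_mul' z w := Subtype.ext (Prod.ext (one_mul 1).symm (Equiv.ext fun p => rot_mul z w p))

variable {p : TotalSpace Circle P}
  [hb : Fact (Function.Bijective (evalAt (G := G) (θ := θ) EG p))]
  {V : Type*} [AddCommGroup V] [Module ℝ V] [TopologicalSpace V]
  [IsTopologicalAddGroup V] [ContinuousSMul ℝ V] [LocallyConvexSpace ℝ V] [T2Space V]
  {X : Type*} [TopologicalSpace X] [ChartedSpace V X]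

theorem IsSmoothMapAt.extension_mul (hθ : IsConnection E θ) {k l : X → extensionGroup G θ} {x : X}
    (hk : IsSmoothMapAt V (EG × Line) (N := ExtensionAt (G := G) EG θ p) k x)
    (hl : IsSmoothMapAt V (EG × Line) (N := ExtensionAt (G := G) EG θ p) l x) :
    IsSmoothMapAt V (EG × Line) (N := ExtensionAt (G := G) EG θ p) (fun y => k y * l y) x := by
  have hk' := smoothAt_extensionAt_iff.1 hk
  have hl' := smoothAt_extensionAt_iff.1 hl
  have h : IsSmoothMapAt V (E × Line) (fun y => (k y).1.2 ((l y).1.2 p)) x :=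
    smoothAt_extensionAt_apply hθ hk hl'.2
  exact smoothAt_extensionAt_iff.2 ⟨IsSmoothMapAt.comp (g := fun q : G × G => q.1 * q.2)
    (f := fun y => ((k y).1.1, (l y).1.1)) (hG.smooth_mul _) (hk'.1.prodMk hl'.1), h⟩

/-- Inversion is smooth: the point `a⁻¹ p` lies over the point `g⁻¹ • p.proj`, and is obtained from
a local section `s` near that point by comparing `p` with `a (s (g⁻¹ • p.proj))`. -/
theorem IsSmoothMapAt.extension_inv (hθ : IsConnection E θ) {k : X → extensionGroup G θ} {x : X}
    (hk : IsSmoothMapAt V (EG × Line) (N := ExtensionAt (G := G) EG θ p) k x) :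
    IsSmoothMapAt V (EG × Line) (N := ExtensionAt (G := G) EG θ p) (fun y => (k y)⁻¹) x := by
  have hk' := smoothAt_extensionAt_iff.1 hk
  have hinv : IsSmoothMapAt V EG (fun y => ((k y).1.1)⁻¹) x :=
    IsSmoothMapAt.comp (g := fun g : G => g⁻¹) (f := fun y => (k y).1.1) (hG.smooth_inv _) hk'.1
  refine smoothAt_extensionAt_iff.2 ⟨hinv, ?_⟩
  have hpt : IsSmoothMapAt V E (fun y => ((k y).1.1)⁻¹ • p.proj) x :=
    IsSmoothMapAt.comp (g := orbitMap EG G E p.proj) (f := fun y => ((k y).1.1)⁻¹)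
      (isSmoothMap_orbitMap p.proj _) hinv
  set e := trivializationAt Circle P (((k x).1.1)⁻¹ • p.proj)
  have hx : ((k x).1.1)⁻¹ • p.proj ∈ e.baseSet := FiberBundle.mem_baseSet_trivializationAt' _
  have hs := hpt.unitSection e hx
  have hev : ∀ᶠ y in 𝓝 x, ((k y).1.1)⁻¹ • p.proj ∈ e.baseSet :=
    hpt.1.eventually (e.open_baseSet.mem_nhds hx)
  obtain ⟨κ, hκ, h⟩ := (smoothAt_extensionAt_apply hθ hk hs).exists_rot
    (isSmoothMapAt_const p) (by
      filter_upwards [hev] with y hy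
      rw [proj_apply, unitSection_proj e hy, smul_inv_smul])
  refine (hκ.rot hs).congr ?_
  filter_upwards [h] with y hy
  have h1 : p = (k y).1.2 (LC.rot (κ y) (LC.unitSection e (((k y).1.1)⁻¹ • p.proj))) := by
    rw [(k y).2.2.2.1]; exact hy
  exact (Equiv.symm_apply_eq _).2 h1 |>.symm

/-- The group of automorphisms, with the manifold structure defined by the base point `p`, is a
central extension of Lie groups. -/
theorem isCentralLieExtension (hθ : IsConnection E θ)
    (hinv : IsInvariantCharacter EG G (holonomy θ)) :
    IsCentralLieExtension EG G (EG × Line) (G' := ExtensionAt (G := G) EG θ p)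
      (extensionIncl hP hθ) (extensionProj θ) where
  lieGroup :=
    { isLCManifold_extensionAt (EG := EG) (G := G) (θ := θ) (p := p) with
      smooth_mul := fun q => IsSmoothMapAt.extension_mul hθ
        (k := fun q : ExtensionAt (G := G) EG θ p × ExtensionAt (G := G) EG θ p => q.1.val)
        (l := fun q : ExtensionAt (G := G) EG θ p × ExtensionAt (G := G) EG θ p => q.2.val)
        isSmoothMapAt_fst isSmoothMapAt_snd
      smooth_inv := fun a => IsSmoothMapAt.extension_inv hθ
        (k := fun a : ExtensionAt (G := G) EG θ p => a.val) (isSmoothMap_id a) }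
  injective z w h := by
    have h1 : rot z p = rot w p := congrArg (fun a : extensionGroup G θ => a.1.2 p) h
    exact rot_injective E h1
  exact := by
    refine le_antisymm ?_ fun a ha => ?_
    · rintro _ ⟨z, rfl⟩
      rfl
    -- an automorphism over the identity rotates `p`, and is determined by its value at `p`
    · have ha1 : (ExtensionAt.val a).1.1 = 1 := ha
      obtain ⟨z, hz⟩ := exists_eq_rot E (p := p) (q := (ExtensionAt.val a).1.2 p) (by
        rw [proj_apply, ha1, one_smul])
      exact ⟨z, extensionGroup_ext hθ ha1.symm (p := p) hz.symm⟩
  surjective g := by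
    obtain ⟨a, ha, -⟩ := exists_extensionGroup (EG := EG) hθ hinv g (p := p)
      (p' := refPoint P (g • p.proj)) (refPoint_proj _)
    exact ⟨a, ha⟩
  central z a := Subtype.ext (Prod.ext ((one_mul _).trans (mul_one _).symm)
    (Equiv.ext fun q => ((ExtensionAt.val a).2.2.2.1 z q).symm))
  smooth_inclusion z := smoothAt_extensionAt_iff.2
    ⟨isSmoothMapAt_const 1, IsSmoothMapAt.rot (isSmoothMap_id z) (isSmoothMapAt_const p)⟩
  smooth_projection a := (smoothAt_extensionAt_iff.1 (isSmoothMap_id a)).1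
  local_section g := by
    set e := trivializationAt Circle P (g • p.proj)
    have key : ∀ x : G, ∃ a : extensionGroup G θ, a.1.1 = x ∧
        (x • p.proj ∈ e.baseSet → a.1.2 p = unitSection e (x • p.proj)) := by
      intro x
      by_cases hx : x • p.proj ∈ e.baseSet
      · obtain ⟨a, ha, hap⟩ := exists_extensionGroup (EG := EG) hθ hinv x (unitSection_proj e hx)
        exact ⟨a, ha, fun _ => hap⟩
      · obtain ⟨a, ha, -⟩ := exists_extensionGroup (EG := EG) hθ hinv x (p := p)
          (p' := refPoint P (x • p.proj)) (refPoint_proj _)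
        exact ⟨a, ha, fun h => absurd h hx⟩
    choose s hs hs' using key
    have hsm := isSmoothMap_orbitMap (EG := EG) (E := E) (G := G) p.proj
    refine ⟨orbitMap EG G E p.proj ⁻¹' e.baseSet, e.open_baseSet.preimage
      (orbitMap EG G E p.proj).continuous, FiberBundle.mem_baseSet_trivializationAt' _, s,
      fun x hx => ?_, fun x _ => hs x⟩
    refine smoothAt_extensionAt_iff.2 ⟨?_, ?_⟩
    · simp only [hs]
      exact isSmoothMap_id x
    · refine ((hsm x).unitSection e hx).congr ?_
      filter_upwards [(hsm x).1.eventually (e.open_baseSet.mem_nhds hx)] with y hy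
      exact (hs' y hy).symm

omit hb in
theorem isLieExtension (hθ : IsConnection E θ)
    (hinv : IsInvariantCharacter EG G (holonomy θ)) : IsLieExtension EG G θ :=
  ⟨extensionIncl hP hθ, fun _ => rfl, fun p =>
    have : Fact (Function.Bijective (evalAt (G := G) (θ := θ) EG p)) :=
      ⟨bijective_evalAt hθ hinv p⟩
    ⟨this, isCentralLieExtension hθ hinv⟩⟩

end LieExtension

/-! ### Comparison of the extensions -/

section Comparison

set_option linter.unusedSectionVars false

variable {EG : Type*} [AddCommGroup EG] [Module ℝ EG] [TopologicalSpace EG]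
  [IsTopologicalAddGroup EG] [ContinuousSMul ℝ EG] [LocallyConvexSpace ℝ EG] [T2Space EG]
  {G : Type*} [TopologicalSpace G] [ChartedSpace EG G] [Group G] [hG : IsLCLieGroup EG G]
  {E : Type*} [AddCommGroup E] [Module ℝ E] [TopologicalSpace E]
  [IsTopologicalAddGroup E] [ContinuousSMul ℝ E] [LocallyConvexSpace ℝ E] [T2Space E]
  {M : Type*} [TopologicalSpace M] [ChartedSpace E M] [hM : IsLCManifold E M] [ConnectedSpace M]
  [MulAction G M] [hA : IsSmoothAction EG E G M]
  {P : M → Type*} [∀ x, TopologicalSpace (P x)] [TopologicalSpace (TotalSpace Circle P)]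
  [FiberBundle Circle P] [∀ x, MulAction Circle (P x)] [∀ x, Nonempty (P x)]
  [hP : IsSmoothCircleBundle E P]
  {F : Type*} [AddCommGroup F] [Module ℝ F] [TopologicalSpace F]
  [IsTopologicalAddGroup F] [ContinuousSMul ℝ F] [LocallyConvexSpace ℝ F] [T2Space F]
  {N : Type*} [TopologicalSpace N] [ChartedSpace F N] [hN : IsLCManifold F N] [ConnectedSpace N]
  [MulAction G N] [hA' : IsSmoothAction EG F G N]
  {Q : N → Type*} [∀ x, TopologicalSpace (Q x)] [TopologicalSpace (TotalSpace Circle Q)]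
  [FiberBundle Circle Q] [∀ x, MulAction Circle (Q x)] [∀ x, Nonempty (Q x)]
  [hQ : IsSmoothCircleBundle F Q]
  {θ : TotalSpace Circle P → E × Line → ℝ} {η : TotalSpace Circle Q → F × Line → ℝ}

include hG hM hP hN hQ hA hA' in
/-- A parallel map `Λ : Q → P` over a `G`-equivariant map induces an isomorphism of the extensions
of `G`: an automorphism of `P` and an automorphism of `Q` over the same element of `G` correspond
to each other if they are intertwined by `Λ`. -/
theorem exists_extensionIso (hθ : IsConnection E θ) (hη : IsConnection F η)
    (hinv : IsInvariantCharacter EG G (holonomy θ))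
    (hinv' : IsInvariantCharacter EG G (holonomy η)) {ψ : N → M} (hψ : IsSmoothMap F E ψ)
    (hψG : ∀ (g : G) (n : N), ψ (g • n) = g • ψ n)
    {Λ : TotalSpace Circle Q → TotalSpace Circle P} (h : IsParallelMap η θ ψ Λ) :
    ∃ Φ : extensionGroup G θ ≃* extensionGroup G η,
      (∀ (a : extensionGroup G θ) (q : TotalSpace Circle Q),
        ((Φ a).1.2 q).proj = a.1.1 • q.proj ∧ Λ ((Φ a).1.2 q) = a.1.2 (Λ q)) ∧
      IsSmoothExtensionIso EG θ η Φ := by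
  have hΛ := h.isSmoothMap hθ hη hψ
  obtain ⟨n₀⟩ : Nonempty N := inferInstance
  obtain ⟨q₀, -⟩ : ∃ q : TotalSpace Circle Q, q = refPoint Q n₀ := ⟨_, rfl⟩
  -- the intertwining relation, which can be checked at a single point
  let R : extensionGroup G θ → extensionGroup G η → Prop := fun a b =>
    a.1.1 = b.1.1 ∧ ∀ q, Λ (b.1.2 q) = a.1.2 (Λ q)
  have hR : ∀ a b, a.1.1 = b.1.1 → Λ (b.1.2 q₀) = a.1.2 (Λ q₀) → R a b := by
    intro a b hab h₀
    have ha := isParallelMap_extensionGroup a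
    have hb := isParallelMap_extensionGroup b
    have h1 : IsParallelMap η θ (fun n => a.1.1 • ψ n) (Λ ∘ b.1.2) :=
      ⟨fun z q => by simp [hb.equivariant, h.equivariant],
        fun q => by simp [hb.covers, h.covers, hψG, hab],
        fun γ hγ => h.horizontal _ (hb.horizontal γ hγ)⟩
    have h2 : IsParallelMap η θ (fun n => a.1.1 • ψ n) (a.1.2 ∘ Λ) :=
      ⟨fun z q => by simp [ha.equivariant, h.equivariant],
        fun q => by simp [ha.covers, h.covers],
        fun γ hγ => ha.horizontal _ (h.horizontal γ hγ)⟩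
    exact ⟨hab, congrFun (h1.eq_of_apply_eq hθ hη h2 h₀)⟩
  have hto : ∀ a, ∃ b, R a b := by
    intro a
    obtain ⟨q, hq, hqΛ⟩ := exists_bundleMap_apply_eq (E := E) (F := F) h.equivariant h.covers
      (a.1.1 • q₀.proj) (p := a.1.2 (Λ q₀)) (by rw [proj_apply, h.covers, hψG])
    obtain ⟨b, hb, hbq⟩ := exists_extensionGroup (EG := EG) hη hinv' a.1.1 hq
    exact ⟨b, hR a b hb.symm (by rw [hbq, hqΛ])⟩
  have hfrom : ∀ b, ∃ a, R a b := by
    intro b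
    obtain ⟨a, ha, hap⟩ := exists_extensionGroup (EG := EG) hθ hinv b.1.1
      (p := Λ q₀) (p' := Λ (b.1.2 q₀)) (by rw [h.covers, h.covers, proj_apply, hψG])
    exact ⟨a, hR a b ha hap.symm⟩
  have huniq : ∀ {a b b'}, R a b → R a b' → b = b' := by
    intro a b b' hb hb'
    have hg : b.1.1 = b'.1.1 := hb.1.symm.trans hb'.1
    refine extensionGroup_ext hη hg (p := q₀) (eq_of_bundleMap_apply_eq (E := E) (F := F)
      h.equivariant ?_ ((hb.2 q₀).trans (hb'.2 q₀).symm))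
    rw [proj_apply, proj_apply, hg]
  have huniq' : ∀ {a a' b}, R a b → R a' b → a = a' := fun ha ha' =>
    extensionGroup_ext hθ (ha.1.trans ha'.1.symm) (p := Λ q₀)
      ((ha.2 q₀).symm.trans (ha'.2 q₀))
  choose fwd hto using hto
  choose bwd hfrom using hfrom
  let Φ : extensionGroup G θ ≃* extensionGroup G η :=
    { toFun := fwd
      invFun := bwd
      left_inv := fun a => huniq' (hfrom _) (hto a)
      right_inv := fun b => huniq (hto _) (hfrom b)
      map_mul' := fun a a' => huniq (hto _)
        ⟨congrArg₂ (· * ·) (hto a).1 (hto a').1, fun q =>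
          ((hto a).2 _).trans (congrArg a.1.2 ((hto a').2 q))⟩ }
  refine ⟨Φ, fun a q => ⟨?_, (hto a).2 q⟩, fun a => (hto a).1.symm, fun z a ha => ?_, ?_⟩
  · rw [proj_apply, (hto a).1]; rfl
  · have h1 : R a (extensionIncl hQ hη z) :=
      ⟨congrArg Prod.fst ha, fun q => (h.equivariant z q).trans
        (congrArg (fun c : G × Equiv.Perm (TotalSpace Circle P) => c.2 (Λ q)) ha).symm⟩
    exact congrArg Subtype.val (huniq (hto a) h1)
  intro p q hp hq
  constructor
  · intro a
    have ha : IsSmoothMapAt (EG × Line) (EG × Line) (N := ExtensionAt (G := G) EG θ p)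
      (fun b : ExtensionAt (G := G) EG θ p => b.val) a := isSmoothMap_id a
    have ha' := smoothAt_extensionAt_iff.1 ha
    have h1 : IsSmoothMapAt (EG × Line) EG
        (fun b : ExtensionAt (G := G) EG θ p => (fwd b.val).1.1) a := by
      simpa only [← (hto _).1] using ha'.1
    refine (smoothAt_extensionAt_iff (k := fun b : ExtensionAt (G := G) EG θ p => fwd b.val)).2
      ⟨h1, smoothAt_of_bundleMap hΛ h.equivariant ?_ ?_⟩
    · simp only [proj_apply]
      exact IsSmoothMapAt.comp (g := orbitMap EG G F q.proj) (isSmoothMap_orbitMap _ _) h1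
    · simp only [(hto _).2]
      exact smoothAt_extensionAt_apply hθ ha (isSmoothMapAt_const _)
  · intro b
    have hb : IsSmoothMapAt (EG × Line) (EG × Line) (N := ExtensionAt (G := G) EG η q)
      (fun b : ExtensionAt (G := G) EG η q => b.val) b := isSmoothMap_id b
    have hb' := smoothAt_extensionAt_iff.1 hb
    have h1 : IsSmoothMapAt (EG × Line) EG
        (fun b : ExtensionAt (G := G) EG η q => (bwd b.val).1.1) b := by
      simpa only [(hfrom _).1] using hb'.1
    -- with base point `Λ q`, smoothness is immediate; the base point is then changed to `p`
    have hf : Fact (Function.Bijective (evalAt (G := G) (θ := θ) EG (Λ q))) :=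
      ⟨bijective_evalAt hθ hinv _⟩
    have h2 : IsSmoothMapAt (EG × Line) (EG × Line) (N := ExtensionAt (G := G) EG θ (Λ q))
        (fun b : ExtensionAt (G := G) EG η q => bwd b.val) b := by
      refine smoothAt_extensionAt_iff.2 ⟨h1, ?_⟩
      simp only [← (hfrom _).2]
      exact IsSmoothMapAt.comp (g := Λ) (hΛ _) hb'.2
    exact (smoothAt_extensionAt_iff (k := fun b : ExtensionAt (G := G) EG η q => bwd b.val)).2
      ⟨h1, smoothAt_extensionAt_apply hθ h2 (isSmoothMapAt_const p)⟩

omit [ConnectedSpace M] [ConnectedSpace N] in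
/-- Pull-backs of invariant characters along equivariant maps are invariant. -/
theorem IsInvariantCharacter.pullback {ψ : N → M} (hψ : IsSmoothMap F E ψ)
    (hψG : ∀ (g : G) (n : N), ψ (g • n) = g • ψ n) {k : AddChar (OneCycles E M) Circle}
    (hk : IsInvariantCharacter EG G k) :
    IsInvariantCharacter EG G (pullbackCharacter ψ hψ k) := by
  intro g
  ext1 c
  have h1 := IsSmoothAction.isSmoothMap_smul EG G hA' g
  have h2 := IsSmoothAction.isSmoothMap_smul EG G hA g
  have h3 : OneCycles.map ψ hψ (OneCycles.map _ h1 c) =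
      OneCycles.map _ h2 (OneCycles.map ψ hψ c) := by
    refine Subtype.ext ?_
    show Finsupp.mapDomain _ (Finsupp.mapDomain _ c.1) =
      Finsupp.mapDomain _ (Finsupp.mapDomain _ c.1)
    rw [← Finsupp.mapDomain_comp, ← Finsupp.mapDomain_comp]
    congr 1
    funext γ
    exact Subtype.ext (funext fun t => hψG g _)
  show k (OneCycles.map ψ hψ (OneCycles.map _ h1 c)) = k (OneCycles.map ψ hψ c)
  rw [h3]
  exact DFunLike.congr_fun (hk g) (OneCycles.map ψ hψ c)

end Comparison

end LC

theorem mainTheorem8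
    {EG : Type*} [AddCommGroup EG] [Module ℝ EG] [TopologicalSpace EG]
    [IsTopologicalAddGroup EG] [ContinuousSMul ℝ EG] [LocallyConvexSpace ℝ EG] [T2Space EG]
    {G : Type*} [TopologicalSpace G] [ChartedSpace EG G] [Group G] [IsLCLieGroup EG G]
    {E : Type*} [AddCommGroup E] [Module ℝ E] [TopologicalSpace E]
    [IsTopologicalAddGroup E] [ContinuousSMul ℝ E] [LocallyConvexSpace ℝ E] [T2Space E]
    {M : Type*} [TopologicalSpace M] [ChartedSpace E M] [IsLCManifold E M] [ConnectedSpace M]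
    [MulAction G M] [IsSmoothAction EG E G M]
    {F : Type*} [AddCommGroup F] [Module ℝ F] [TopologicalSpace F]
    [IsTopologicalAddGroup F] [ContinuousSMul ℝ F] [LocallyConvexSpace ℝ F] [T2Space F]
    {N : Type*} [TopologicalSpace N] [ChartedSpace F N] [IsLCManifold F N] [ConnectedSpace N]
    [MulAction G N] [IsSmoothAction EG F G N]
    (ψ : C(N, M)) (hψ : IsSmoothMap F E ψ) (hψG : ∀ (g : G) (n : N), ψ (g • n) = g • ψ n) :
    -- the comparison of the extensions obtained from a bundle and from its pull-back
    (∀ (P : M → Type*) [∀ x, TopologicalSpace (P x)] [TopologicalSpace (TotalSpace Circle P)]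
        [FiberBundle Circle P] [∀ x, MulAction Circle (P x)] [∀ x, Nonempty (P x)]
        [IsSmoothCircleBundle E P] (θ : TotalSpace Circle P → E × Line → ℝ),
      IsConnection E θ → IsInvariantCharacter EG G (holonomy θ) →
        IsSmoothCircleBundle F ((ψ : N → M) *ᵖ P) ∧
        IsConnection F (pullbackForm (F := F) ψ θ) ∧
        IsLieExtension EG G θ ∧
        IsLieExtension EG G (pullbackForm (F := F) ψ θ) ∧
        ∃ Φ : extensionGroup G θ ≃* extensionGroup G (pullbackForm (F := F) ψ θ),
          (∀ (a : extensionGroup G θ) (q : TotalSpace Circle ((ψ : N → M) *ᵖ P)),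
            ((Φ a).1.2 q).proj = a.1.1 • q.proj ∧
            Pullback.lift ψ ((Φ a).1.2 q) = a.1.2 (Pullback.lift ψ q)) ∧
          IsSmoothExtensionIso EG θ (pullbackForm (F := F) ψ θ) Φ) ∧
    -- the comparison of the extensions obtained from related differential characters
    (∀ (hM : AddChar (OneCycles E M) Circle) (hN : AddChar (OneCycles F N) Circle),
      IsDifferentialCharacter hM → IsDifferentialCharacter hN →
      IsInvariantCharacter EG G hM → IsInvariantCharacter EG G hN →
      pullbackCharacter ψ hψ hM = hN →
      ∀ (P : M → Type*) [∀ x, TopologicalSpace (P x)] [TopologicalSpace (TotalSpace Circle P)]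
        [FiberBundle Circle P] [∀ x, MulAction Circle (P x)] [∀ x, Nonempty (P x)]
        [IsSmoothCircleBundle E P] (θ : TotalSpace Circle P → E × Line → ℝ)
        (Q : N → Type*) [∀ x, TopologicalSpace (Q x)] [TopologicalSpace (TotalSpace Circle Q)]
        [FiberBundle Circle Q] [∀ x, MulAction Circle (Q x)] [∀ x, Nonempty (Q x)]
        [IsSmoothCircleBundle F Q] (η : TotalSpace Circle Q → F × Line → ℝ),
      IsConnection E θ → holonomy θ = hM → IsConnection F η → holonomy η = hN →
        IsLieExtension EG G θ ∧ IsLieExtension EG G η ∧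
        ∃ Φ : extensionGroup G θ ≃* extensionGroup G η, IsSmoothExtensionIso EG θ η Φ) := by
  refine ⟨?_, ?_⟩
  · intro P _ _ _ _ _ hP θ hθ hinv
    have hB := isSmoothCircleBundle_pullback (P := P) hψ
    have hη := hθ.pullbackForm hψ
    have hinv' : IsInvariantCharacter EG G (holonomy (pullbackForm (F := F) ψ θ)) := by
      rw [holonomy_pullbackForm hψ hθ]
      exact hinv.pullback hψ hψG
    exact ⟨hB, hη, isLieExtension hθ hinv, isLieExtension hη hinv',
      exists_extensionIso hθ hη hinv hinv' hψ hψG (Λ := Pullback.lift ψ)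
        (.of_isSmoothMap lift_rot (fun _ => rfl) (isSmoothMap_lift hψ) fun _ _ => rfl)⟩
  · rintro hM hN - - hinv hinv' hMN P _ _ _ _ _ hP θ Q _ _ _ _ _ hQ η hθ rfl hη rfl
    obtain ⟨Λ, hΛ⟩ := exists_parallelMap hθ hη hψ fun c => (DFunLike.congr_fun hMN c).symm
    obtain ⟨Φ, -, hΦ⟩ := exists_extensionIso hθ hη hinv hinv' hψ hψG hΛ
    exact ⟨isLieExtension hθ hinv, isLieExtension hη hinv', Φ, hΦ⟩
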